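/- Let $G\subset \mathrm{SL}(n,\mathbb C)$ be a finite abelian subgroup of order $r$. Fix a primitive $r$-th root of unity $\varepsilon$ and a basis of $\mathbb C^n$ in which $G$ is diagonal. For $g=\operatorname{diag}(\varepsilon^{a_1},\dots,\varepsilon^{a_n})\in G$ with $0\le a_i<r$ put $\hat g=\frac1r(a_1,\dots,a_n)$; let $N=\mathbb Z^n+\sum_{g\in G}\mathbb Z\hat g\subset\mathbb R^n$ and $\sigma=\operatorname{Cone}(e_1,\dots,e_n)$, so that $\mathbb C^n/G=U_{\sigma,N}$. For $u\in\mathbb R^n$ let $\operatorname{age}(u)=u_1+\dots+u_n$. The Hilbert basis $\mathbf{Hlb}_N(\sigma)$ is the set of nonzero elements of $\sigma\cap N$ that are not a sum of two nonzero elements of $\sigma\cap N$. Let $\Xi$ be a fan in $(\mathbb R^n,N)$ defining a Hilbert basis resolution $X_\Xi\to\mathbb C^n/G$, that is: $\Xi$ refines $\sigma$, every cone of $\Xi$ is smooth, and the set of ray generators of $\Xi$ is $\mathbf{Hlb}_N(\sigma)$. Let $g\in G$ be a junior element, i.e. $\operatorname{age}(\hat g)=1$, let $\rho_g=\operatorname{Cone}(\hat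 g)$, let $E_g=V(\rho_g)\subset X_\Xi$ be the closure of the torus orbit of $\rho_g$, and let $\Xi_g$ be the set of all faces of the $n$-dimensional cones of $\Xi$ that have $\rho_g$ as a face. Then: 1. $\Xi_g$ is a fan, and the natural morphism $X_{\Xi_g}\to X_\Xi$ is an open immersion that maps the orbit closure of $\rho_g$ in $X_{\Xi_g}$ onto $E_g$; in particular $X_{\Xi_g}$ is an open subvariety of $X_\Xi$ containing $E_g$. 2. For each ray generator $u\neq\hat g$ of $\Xi_g$ with $\operatorname{Cone}(\hat g,u)\in\Xi_g$ (these correspond to the rays of the star fan of $\rho_g$, which is the fan of $E_g$) let $D_{\bar u}=V(\operatorname{Cone}(\hat g,u))\subset E_g$ be the corresponding torus-invariant prime divisor. The ages of these $u$ are integers, and with $D=-\sum_u\operatorname{age}(u)\,D_{\bar u}$ the variety $X_{\Xi_g}$ is isomorphic to the total space of the line bundle $\mathcal O_{E_g}(D)$, the inclusion $E_g\subset X_{\Xi_g}$ corresponding to the zero section; that is, there is a morphism $\pi:X_{\Xi_g}\to E_g$ which is a line bundle with sheaf of sections isomorphic to $\mathcal O_{E_g}(D)$ and with zero section the inclusion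 of $E_g$. 3. In the classical topology, $E_g$ is a strong deformation retract of $X_{\Xi_g}$. -/

import Mathlib

open scoped Topology

/-! ## Complex varieties as spaces with functions -/

/-- A space with functions over `ℂ`: a topology (the Zariski topology) together with, for every open
`U`, the algebra of regular functions on `U`. A regular function on `U` is represented by a function
on all of `X` whose values off `U` are irrelevant (`regular_congr`). -/
class SpaceWithFunctions (X : Type*) where
  zariski : TopologicalSpace X
  regular : Set X → Subalgebra ℂ (X → ℂ)
  regular_congr : ∀ {U : Set X} {f g : X → ℂ}, f ∈ regular U → Set.EqOn f g U → g ∈ regular U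
  regular_mono : ∀ {U W : Set X}, W ⊆ U → regular U ≤ regular W
  regular_local : ∀ {U : Set X} {f : X → ℂ},
    (∀ x ∈ U, ∃ W, IsOpen[zariski] W ∧ x ∈ W ∧ f ∈ regular (U ∩ W)) → f ∈ regular U
  regular_inv : ∀ {U : Set X} {f : X → ℂ}, IsOpen[zariski] U → f ∈ regular U →
    IsOpen[zariski] {x | x ∈ U ∧ f x ≠ 0} ∧ f⁻¹ ∈ regular {x | x ∈ U ∧ f x ≠ 0}

namespace SpaceWithFunctions

section Basic

variable {X Y : Type*} [SpaceWithFunctions X] [SpaceWithFunctions Y]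

/-- Zariski open subsets. -/
def ZOpen (U : Set X) : Prop := IsOpen[zariski] U

/-- Zariski closure. -/
def zclosure (A : Set X) : Set X := @closure X zariski A

/-- Morphisms: Zariski continuous maps that pull regular functions back to regular functions. -/
def IsMorphism (f : X → Y) : Prop :=
  ∀ W : Set Y, ZOpen W → ZOpen (f ⁻¹' W) ∧ ∀ k ∈ regular W, k ∘ f ∈ regular (f ⁻¹' W)

/-- Isomorphisms: morphisms with an inverse morphism. -/
def IsIsomorphism (f : X → Y) : Prop :=
  IsMorphism f ∧ ∃ g : Y → X, IsMorphism g ∧ Function.LeftInverse g f ∧ Function.RightInverse g f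

variable (X) in
/-- The classical (Euclidean) topology: the coarsest one in which Zariski open sets are open and
regular functions on them are continuous. -/
@[reducible] def classicalTopology : TopologicalSpace X :=
  TopologicalSpace.generateFrom
    {s | ∃ U : Set X, ZOpen U ∧ ∃ f ∈ regular U, ∃ O : Set ℂ, IsOpen O ∧ s = {x | x ∈ U ∧ f x ∈ O}}

end Basic

/-! ### Affine varieties -/

/-- The complex points of the maximal spectrum of the `ℂ`-algebra `A`. -/
abbrev Specm (A : Type*) [CommRing A] [Algebra ℂ A] : Type _ := A →ₐ[ℂ] ℂ

/-- The affine variety of `A`: the principal open sets `q ≠ 0` form a basis of the topology and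
regular functions are locally fractions `p / q`. -/
instance {A : Type*} [CommRing A] [Algebra ℂ A] : SpaceWithFunctions (Specm A) where
  zariski :=
    { IsOpen := fun s => ∀ γ ∈ s, ∃ q : A, γ q ≠ 0 ∧ ∀ δ : Specm A, δ q ≠ 0 → δ ∈ s
      isOpen_univ := fun γ _ => ⟨1, by simp, fun _ _ => trivial⟩
      isOpen_inter := fun s t hs ht γ hγ => by
        obtain ⟨p, hp, hp'⟩ := hs γ hγ.1
        obtain ⟨q, hq, hq'⟩ := ht γ hγ.2
        refine ⟨p * q, by simp [hp, hq], fun δ hδ => ?_⟩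
        rw [map_mul] at hδ
        exact ⟨hp' δ (left_ne_zero_of_mul hδ), hq' δ (right_ne_zero_of_mul hδ)⟩
      isOpen_sUnion := fun S hS γ hγ => by
        obtain ⟨s, hs, hγs⟩ := hγ
        obtain ⟨q, hq, hq'⟩ := hS s hs γ hγs
        exact ⟨q, hq, fun δ hδ => ⟨s, hs, hq' δ hδ⟩⟩ }
  regular U :=
    { carrier := {f | ∀ γ ∈ U, ∃ p q : A, γ q ≠ 0 ∧ ∀ δ ∈ U, δ q ≠ 0 → f δ = δ p / δ q}
      mul_mem' := fun {f g} hf hg γ hγ => by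
        obtain ⟨p, q, hq, h⟩ := hf γ hγ
        obtain ⟨p', q', hq', h'⟩ := hg γ hγ
        refine ⟨p * p', q * q', by simp [hq, hq'], fun δ hδ hn => ?_⟩
        rw [map_mul] at hn
        rw [Pi.mul_apply, h δ hδ (left_ne_zero_of_mul hn), h' δ hδ (right_ne_zero_of_mul hn),
          map_mul, map_mul, div_mul_div_comm]
      add_mem' := fun {f g} hf hg γ hγ => by
        obtain ⟨p, q, hq, h⟩ := hf γ hγ
        obtain ⟨p', q', hq', h'⟩ := hg γ hγ
        refine ⟨p * q' + q * p', q * q', by simp [hq, hq'], fun δ hδ hn => ?_⟩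
        rw [map_mul] at hn
        rw [Pi.add_apply, h δ hδ (left_ne_zero_of_mul hn), h' δ hδ (right_ne_zero_of_mul hn),
          map_add, map_mul, map_mul, map_mul,
          div_add_div _ _ (left_ne_zero_of_mul hn) (right_ne_zero_of_mul hn)]
      algebraMap_mem' := fun c γ _ => ⟨algebraMap ℂ A c, 1, by simp, fun δ _ _ => by simp⟩ }
  regular_congr := fun hf hfg γ hγ => by
    obtain ⟨p, q, hq, h⟩ := hf γ hγ
    exact ⟨p, q, hq, fun δ hδ hn => by rw [← hfg hδ, h δ hδ hn]⟩
  regular_mono := fun hWU f hf γ hγ => by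
    obtain ⟨p, q, hq, h⟩ := hf γ (hWU hγ)
    exact ⟨p, q, hq, fun δ hδ hn => h δ (hWU hδ) hn⟩
  regular_local := fun {U f} H γ hγ => by
    obtain ⟨W, hW, hγW, hf⟩ := H γ hγ
    obtain ⟨p, q, hq, h⟩ := hf γ ⟨hγ, hγW⟩
    obtain ⟨r, hr, hr'⟩ := hW γ hγW
    refine ⟨p * r, q * r, by simp [hq, hr], fun δ hδ hn => ?_⟩
    rw [map_mul] at hn
    rw [h δ ⟨hδ, hr' δ (right_ne_zero_of_mul hn)⟩ (left_ne_zero_of_mul hn), map_mul, map_mul,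
      mul_div_mul_right _ _ (right_ne_zero_of_mul hn)]
  regular_inv := fun {U f} hU hf => by
    constructor
    · intro γ hγ
      obtain ⟨p, q, hq, h⟩ := hf γ hγ.1
      obtain ⟨r, hr, hr'⟩ := hU γ hγ.1
      have hp : γ p ≠ 0 := fun h0 => hγ.2 (by rw [h γ hγ.1 hq, h0, zero_div])
      refine ⟨p * q * r, by simp [hp, hq, hr], fun δ hn => ?_⟩
      rw [map_mul, map_mul] at hn
      have hδ := hr' δ (right_ne_zero_of_mul hn)
      have hpq := left_ne_zero_of_mul hn
      refine ⟨hδ, ?_⟩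
      rw [h δ hδ (right_ne_zero_of_mul hpq)]
      exact div_ne_zero (left_ne_zero_of_mul hpq) (right_ne_zero_of_mul hpq)
    · intro γ hγ
      obtain ⟨p, q, hq, h⟩ := hf γ hγ.1
      have hp : γ p ≠ 0 := fun h0 => hγ.2 (by rw [h γ hγ.1 hq, h0, zero_div])
      refine ⟨q * q, p * q, by simp [hp, hq], fun δ hδ hn => ?_⟩
      rw [map_mul] at hn
      rw [Pi.inv_apply, h δ hδ.1 (right_ne_zero_of_mul hn), map_mul, map_mul, inv_div,
        mul_div_mul_right _ _ (right_ne_zero_of_mul hn)]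

/-! ### Gluing, subvarieties, products with the affine line -/

/-- The structure glued from charts `c i : Y i → X`: a subset is open, and a function on an open
subset is regular, if and only if this is so in every chart. -/
abbrev glued {ι : Type*} {Y : ι → Type*} {X : Type*} [∀ i, SpaceWithFunctions (Y i)]
    (c : ∀ i, Y i → X) : SpaceWithFunctions X where
  zariski :=
    { IsOpen := fun s => ∀ i, IsOpen[zariski] (c i ⁻¹' s)
      isOpen_univ := fun i => (zariski (X := Y i)).isOpen_univ
      isOpen_inter := fun s t hs ht i => (zariski (X := Y i)).isOpen_inter _ _ (hs i) (ht i)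
      isOpen_sUnion := fun S hS i => by
        rw [Set.preimage_sUnion]
        exact @isOpen_biUnion _ _ zariski _ _ fun s hs => hS s hs i }
  regular U :=
    { carrier := {f | ∀ i, f ∘ c i ∈ regular (c i ⁻¹' U)}
      mul_mem' := fun hf hg i => mul_mem (hf i) (hg i)
      add_mem' := fun hf hg i => add_mem (hf i) (hg i)
      algebraMap_mem' := fun r i => (regular (c i ⁻¹' U)).algebraMap_mem r }
  regular_congr := fun hf hfg i => regular_congr (hf i) fun y hy => hfg hy
  regular_mono := fun h f hf i => regular_mono (Set.preimage_mono h) (hf i)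
  regular_local := fun H i => regular_local fun y hy => by
    obtain ⟨W, hW, hyW, hf⟩ := H (c i y) hy
    exact ⟨c i ⁻¹' W, hW i, hyW, hf i⟩
  regular_inv := fun hU hf =>
    ⟨fun i => (regular_inv (hU i) (hf i)).1, fun i => (regular_inv (hU i) (hf i)).2⟩

/-- The induced structure on a (locally closed) subset: regular functions are those that locally
extend to regular functions of the ambient space. -/
instance {X : Type*} [SpaceWithFunctions X] (A : Set X) : SpaceWithFunctions A where
  zariski := TopologicalSpace.induced Subtype.val zariski
  regular U :=
    { carrier := {f | ∀ x ∈ U, ∃ W : Set X, IsOpen[zariski] W ∧ x.1 ∈ W ∧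
        ∃ F ∈ regular W, ∀ y ∈ U, y.1 ∈ W → f y = F y}
      mul_mem' := fun {f g} hf hg x hx => by
        obtain ⟨W, hW, hxW, F, hF, h⟩ := hf x hx
        obtain ⟨W', hW', hxW', F', hF', h'⟩ := hg x hx
        exact ⟨W ∩ W', zariski.isOpen_inter _ _ hW hW', ⟨hxW, hxW'⟩, F * F',
          mul_mem (regular_mono Set.inter_subset_left hF)
            (regular_mono Set.inter_subset_right hF'),
          fun y hy hyW => by simp [h y hy hyW.1, h' y hy hyW.2]⟩
      add_mem' := fun {f g} hf hg x hx => by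
        obtain ⟨W, hW, hxW, F, hF, h⟩ := hf x hx
        obtain ⟨W', hW', hxW', F', hF', h'⟩ := hg x hx
        exact ⟨W ∩ W', zariski.isOpen_inter _ _ hW hW', ⟨hxW, hxW'⟩, F + F',
          add_mem (regular_mono Set.inter_subset_left hF)
            (regular_mono Set.inter_subset_right hF'),
          fun y hy hyW => by simp [h y hy hyW.1, h' y hy hyW.2]⟩
      algebraMap_mem' := fun c x _ => ⟨Set.univ, zariski.isOpen_univ, trivial,
        algebraMap ℂ (X → ℂ) c, (regular Set.univ).algebraMap_mem c, fun _ _ _ => rfl⟩ }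
  regular_congr := fun hf hfg x hx => by
    obtain ⟨W, hW, hxW, F, hF, h⟩ := hf x hx
    exact ⟨W, hW, hxW, F, hF, fun y hy hyW => by rw [← hfg hy, h y hy hyW]⟩
  regular_mono := fun hWU f hf x hx => by
    obtain ⟨W, hW, hxW, F, hF, h⟩ := hf x (hWU hx)
    exact ⟨W, hW, hxW, F, hF, fun y hy hyW => h y (hWU hy) hyW⟩
  regular_local := fun H x hx => by
    obtain ⟨_, ⟨W, hW, rfl⟩, hxW, hf⟩ := H x hx
    obtain ⟨W', hW', hxW', F, hF, h⟩ := hf x ⟨hx, hxW⟩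
    exact ⟨W ∩ W', zariski.isOpen_inter _ _ hW hW', ⟨hxW, hxW'⟩, F,
      regular_mono Set.inter_subset_right hF, fun y hy hyW => h y ⟨hy, hyW.1⟩ hyW.2⟩
  regular_inv := fun {U f} hU hf => by
    obtain ⟨U', hU', rfl⟩ := hU
    constructor
    · refine (@isOpen_iff_forall_mem_open A
        (TopologicalSpace.induced Subtype.val zariski) _).2 fun x hx => ?_
      obtain ⟨W, hW, hxW, F, hF, h⟩ := hf x hx.1
      have hV := (regular_inv (zariski.isOpen_inter _ _ hU' hW)
        (regular_mono Set.inter_subset_right hF)).1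
      refine ⟨Subtype.val ⁻¹' {y | y ∈ U' ∩ W ∧ F y ≠ 0}, ?_, ⟨_, hV, rfl⟩, ⟨⟨hx.1, hxW⟩, ?_⟩⟩
      · intro y hy
        exact ⟨hy.1.1, by rw [h y hy.1.1 hy.1.2]; exact hy.2⟩
      · rw [← h x hx.1 hxW]
        exact hx.2
    · intro x hx
      obtain ⟨W, hW, hxW, F, hF, h⟩ := hf x hx.1
      have hV := regular_inv hW hF
      refine ⟨_, hV.1, ⟨hxW, ?_⟩, _, hV.2, fun y hy hyW => ?_⟩
      · rw [← h x hx.1 hxW]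
        exact hx.2
      · rw [Pi.inv_apply, Pi.inv_apply, h y hy.1 hyW.1]

/-- The value at `z = (x, t)` of a polynomial in `t` whose coefficients are regular on `W`. -/
noncomputable def polyVal {X : Type*} [SpaceWithFunctions X] {W : Set X}
    (p : Polynomial (regular W)) (z : X × ℂ) : ℂ :=
  p.eval₂ ((Pi.evalRingHom (fun _ : X => ℂ) z.1).comp (regular W).val.toRingHom) z.2

/-- Restriction of the coefficients to a smaller set. -/
noncomputable def polyRes {X : Type*} [SpaceWithFunctions X] {W W' : Set X} (h : W' ⊆ W)
    (p : Polynomial (regular W)) : Polynomial (regular W') :=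
  p.map (Subalgebra.inclusion (regular_mono h)).toRingHom

theorem polyVal_res {X : Type*} [SpaceWithFunctions X] {W W' : Set X} (h : W' ⊆ W)
    (p : Polynomial (regular W)) (z : X × ℂ) : polyVal (polyRes h p) z = polyVal p z := by
  simp only [polyVal, polyRes, Polynomial.eval₂_map]
  rfl

theorem polyVal_mul {X : Type*} [SpaceWithFunctions X] {W : Set X}
    (p q : Polynomial (regular W)) (z : X × ℂ) : polyVal (p * q) z = polyVal p z * polyVal q z :=
  Polynomial.eval₂_mul _ _

theorem polyVal_add {X : Type*} [SpaceWithFunctions X] {W : Set X}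
    (p q : Polynomial (regular W)) (z : X × ℂ) : polyVal (p + q) z = polyVal p z + polyVal q z :=
  Polynomial.eval₂_add _ _

theorem polyVal_one {X : Type*} [SpaceWithFunctions X] {W : Set X} (z : X × ℂ) :
    polyVal (1 : Polynomial (regular W)) z = 1 :=
  Polynomial.eval₂_one _ _

/-- The product `X × 𝔸¹`: the sets `{(x, t) | x ∈ W, q (x, t) ≠ 0}` with `W` open and `q` a
polynomial in `t` over the regular functions on `W` form a basis of the topology, and regular
functions are locally fractions `p / q` of such polynomials. -/
noncomputable instance {X : Type*} [SpaceWithFunctions X] : SpaceWithFunctions (X × ℂ) where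
  zariski :=
    { IsOpen := fun s => ∀ z ∈ s, ∃ W : Set X, IsOpen[zariski] W ∧ z.1 ∈ W ∧
        ∃ q : Polynomial (regular W), polyVal q z ≠ 0 ∧ ∀ w : X × ℂ, w.1 ∈ W → polyVal q w ≠ 0 → w ∈ s
      isOpen_univ := fun z _ => ⟨Set.univ, zariski.isOpen_univ, trivial, 1,
        by simp [polyVal_one], fun _ _ _ => trivial⟩
      isOpen_inter := fun s t hs ht z hz => by
        obtain ⟨W, hW, hzW, q, hq, h⟩ := hs z hz.1
        obtain ⟨W', hW', hzW', q', hq', h'⟩ := ht z hz.2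
        refine ⟨W ∩ W', zariski.isOpen_inter _ _ hW hW', ⟨hzW, hzW'⟩,
          polyRes Set.inter_subset_left q * polyRes Set.inter_subset_right q', ?_, ?_⟩
        · rw [polyVal_mul, polyVal_res, polyVal_res]
          exact mul_ne_zero hq hq'
        · intro w hw hn
          rw [polyVal_mul, polyVal_res, polyVal_res] at hn
          exact ⟨h w hw.1 (left_ne_zero_of_mul hn), h' w hw.2 (right_ne_zero_of_mul hn)⟩
      isOpen_sUnion := fun S hS z hz => by
        obtain ⟨s, hs, hzs⟩ := hz
        obtain ⟨W, hW, hzW, q, hq, h⟩ := hS s hs z hzs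
        exact ⟨W, hW, hzW, q, hq, fun w hw hn => ⟨s, hs, h w hw hn⟩⟩ }
  regular U :=
    { carrier := {f | ∀ z ∈ U, ∃ W : Set X, IsOpen[zariski] W ∧ z.1 ∈ W ∧
        ∃ p q : Polynomial (regular W), polyVal q z ≠ 0 ∧
          ∀ w ∈ U, w.1 ∈ W → polyVal q w ≠ 0 → f w = polyVal p w / polyVal q w}
      mul_mem' := fun {f g} hf hg z hz => by
        obtain ⟨W, hW, hzW, p, q, hq, h⟩ := hf z hz
        obtain ⟨W', hW', hzW', p', q', hq', h'⟩ := hg z hz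
        refine ⟨W ∩ W', zariski.isOpen_inter _ _ hW hW', ⟨hzW, hzW'⟩,
          polyRes Set.inter_subset_left p * polyRes Set.inter_subset_right p',
          polyRes Set.inter_subset_left q * polyRes Set.inter_subset_right q', ?_, ?_⟩
        · rw [polyVal_mul, polyVal_res, polyVal_res]
          exact mul_ne_zero hq hq'
        · intro w hw hwW hn
          rw [polyVal_mul, polyVal_res, polyVal_res] at hn
          rw [polyVal_mul, polyVal_mul, polyVal_res, polyVal_res, polyVal_res, polyVal_res,
            Pi.mul_apply, h w hw hwW.1 (left_ne_zero_of_mul hn),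
            h' w hw hwW.2 (right_ne_zero_of_mul hn), div_mul_div_comm]
      add_mem' := fun {f g} hf hg z hz => by
        obtain ⟨W, hW, hzW, p, q, hq, h⟩ := hf z hz
        obtain ⟨W', hW', hzW', p', q', hq', h'⟩ := hg z hz
        refine ⟨W ∩ W', zariski.isOpen_inter _ _ hW hW', ⟨hzW, hzW'⟩,
          polyRes Set.inter_subset_left p * polyRes Set.inter_subset_right q' +
            polyRes Set.inter_subset_left q * polyRes Set.inter_subset_right p',
          polyRes Set.inter_subset_left q * polyRes Set.inter_subset_right q', ?_, ?_⟩
        · rw [polyVal_mul, polyVal_res, polyVal_res]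
          exact mul_ne_zero hq hq'
        · intro w hw hwW hn
          rw [polyVal_mul, polyVal_res, polyVal_res] at hn
          rw [polyVal_add, polyVal_mul, polyVal_mul, polyVal_mul, polyVal_res, polyVal_res,
            polyVal_res, polyVal_res, Pi.add_apply, h w hw hwW.1 (left_ne_zero_of_mul hn),
            h' w hw hwW.2 (right_ne_zero_of_mul hn),
            div_add_div _ _ (left_ne_zero_of_mul hn) (right_ne_zero_of_mul hn)]
      algebraMap_mem' := fun c z _ => ⟨Set.univ, zariski.isOpen_univ, trivial,
        Polynomial.C (algebraMap ℂ _ c), 1, by simp [polyVal_one], fun w _ _ _ => by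
          rw [polyVal_one, div_one]
          simp only [polyVal, Polynomial.eval₂_C]
          rfl⟩ }
  regular_congr := fun hf hfg z hz => by
    obtain ⟨W, hW, hzW, p, q, hq, h⟩ := hf z hz
    exact ⟨W, hW, hzW, p, q, hq, fun w hw hwW hn => by rw [← hfg hw, h w hw hwW hn]⟩
  regular_mono := fun hWU f hf z hz => by
    obtain ⟨W, hW, hzW, p, q, hq, h⟩ := hf z (hWU hz)
    exact ⟨W, hW, hzW, p, q, hq, fun w hw hwW hn => h w (hWU hw) hwW hn⟩
  regular_local := fun {U f} H z hz => by
    obtain ⟨Ω, hΩ, hzΩ, hf⟩ := H z hz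
    obtain ⟨W, hW, hzW, p, q, hq, h⟩ := hf z ⟨hz, hzΩ⟩
    obtain ⟨W', hW', hzW', r, hr, h'⟩ := hΩ z hzΩ
    refine ⟨W ∩ W', zariski.isOpen_inter _ _ hW hW', ⟨hzW, hzW'⟩,
      polyRes Set.inter_subset_left p * polyRes Set.inter_subset_right r,
      polyRes Set.inter_subset_left q * polyRes Set.inter_subset_right r, ?_, ?_⟩
    · rw [polyVal_mul, polyVal_res, polyVal_res]
      exact mul_ne_zero hq hr
    · intro w hw hwW hn
      rw [polyVal_mul, polyVal_res, polyVal_res] at hn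
      rw [polyVal_mul, polyVal_mul, polyVal_res, polyVal_res, polyVal_res,
        mul_div_mul_right _ _ (right_ne_zero_of_mul hn)]
      exact h w ⟨hw, h' w hwW.2 (right_ne_zero_of_mul hn)⟩ hwW.1 (left_ne_zero_of_mul hn)
  regular_inv := fun {U f} hU hf => by
    constructor
    · intro z hz
      obtain ⟨W, hW, hzW, p, q, hq, h⟩ := hf z hz.1
      obtain ⟨W', hW', hzW', r, hr, h'⟩ := hU z hz.1
      have hp : polyVal p z ≠ 0 := fun h0 => hz.2 (by rw [h z hz.1 hzW hq, h0, zero_div])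
      refine ⟨W ∩ W', zariski.isOpen_inter _ _ hW hW', ⟨hzW, hzW'⟩,
        polyRes Set.inter_subset_left (p * q) * polyRes Set.inter_subset_right r, ?_, ?_⟩
      · rw [polyVal_mul, polyVal_res, polyVal_res, polyVal_mul]
        exact mul_ne_zero (mul_ne_zero hp hq) hr
      · intro w hwW hn
        rw [polyVal_mul, polyVal_res, polyVal_res, polyVal_mul] at hn
        have hw := h' w hwW.2 (right_ne_zero_of_mul hn)
        have hpq := left_ne_zero_of_mul hn
        refine ⟨hw, ?_⟩
        rw [h w hw hwW.1 (right_ne_zero_of_mul hpq)]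
        exact div_ne_zero (left_ne_zero_of_mul hpq) (right_ne_zero_of_mul hpq)
    · intro z hz
      obtain ⟨W, hW, hzW, p, q, hq, h⟩ := hf z hz.1
      have hp : polyVal p z ≠ 0 := fun h0 => hz.2 (by rw [h z hz.1 hzW hq, h0, zero_div])
      refine ⟨W, hW, hzW, q * q, p * q, ?_, fun w hw hwW hn => ?_⟩
      · rw [polyVal_mul]
        exact mul_ne_zero hp hq
      · rw [polyVal_mul] at hn
        rw [Pi.inv_apply, h w hw.1 hwW (right_ne_zero_of_mul hn), polyVal_mul, polyVal_mul, inv_div,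
          mul_div_mul_right _ _ (right_ne_zero_of_mul hn)]

section Bundles

variable {X Y E T ι : Type*} [SpaceWithFunctions X] [SpaceWithFunctions Y] [SpaceWithFunctions E]
  [SpaceWithFunctions T]

/-- Open immersions: isomorphisms onto a Zariski open subset. -/
def IsOpenImmersion (f : X → Y) : Prop :=
  ZOpen (Set.range f) ∧ IsIsomorphism (Set.rangeFactorization f)

/-! ### Divisors, the sheaf of a divisor and total spaces -/

/-- `h` is a local equation on the open set `W` of the closed subset `Z`: it generates the ideal
sheaf of `Z` over `W`. -/
def IsLocalEquation (W Z : Set E) (h : E → ℂ) : Prop :=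
  h ∈ regular W ∧ (∀ x ∈ W ∩ Z, h x = 0) ∧
    ∀ W' ⊆ W, ZOpen W' → ∀ k ∈ regular W', (∀ x ∈ W' ∩ Z, k x = 0) →
      ∃ q ∈ regular W', ∀ x ∈ W', k x = q x * h x

/-- `f` is a section over `U` of the sheaf `𝒪(D)`, `D = ∑ i, a i • Z i`, a finite formal sum of
prime divisors: a function on `U ∖ ⋃ i, Z i` (values elsewhere are irrelevant) such that locally
`f * ∏ i, h i ^ a i` extends to a regular function, where `h i` is a local equation of `Z i`. -/
def IsDivisorSection (Z : ι → Set E) (a : ι → ℤ) (U : Set E) (f : E → ℂ) : Prop :=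
  ∀ x ∈ U, ∃ W ⊆ U, ZOpen W ∧ x ∈ W ∧ ∃ h : ι → E → ℂ, (∀ i, IsLocalEquation W (Z i) (h i)) ∧
    ∃ k ∈ regular W, ∀ y ∈ W \ ⋃ i, Z i, f y * ∏ᶠ i, h i y ^ a i = k y

/-- `t` is a trivializing fibre coordinate of `π : T → E` over the open set `U`: the map `(π, t)` is
an isomorphism from the preimage of `U` to `U × 𝔸¹`. -/
def IsTrivialization (π : T → E) (U : Set E) (t : T → ℂ) : Prop :=
  ZOpen U ∧ IsIsomorphism (fun v : π ⁻¹' U => ((⟨π v.1, v.2⟩, t v.1) : U × ℂ))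

/-- An atlas making `π : T → E` a line bundle: trivializations over an open cover of `E`, any two
of which differ by multiplication with an invertible regular function on the base. -/
structure IsLineBundleAtlas (π : T → E) (A : Set (Set E × (T → ℂ))) : Prop where
  isMorphism : IsMorphism π
  trivialization : ∀ c ∈ A, IsTrivialization π c.1 c.2
  cover : ∀ x : E, ∃ c ∈ A, x ∈ c.1
  linear : ∀ c ∈ A, ∀ c' ∈ A, ∃ u ∈ regular (c.1 ∩ c'.1), (∀ x ∈ c.1 ∩ c'.1, u x ≠ 0) ∧
    ∀ v : T, π v ∈ c.1 ∩ c'.1 → c'.2 v = u (π v) * c.2 v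

/-- `s` is a regular section of `π` over `U`. -/
def IsSection (π : T → E) (U : Set E) (s : U → T) : Prop :=
  IsMorphism s ∧ ∀ x : U, π (s x) = x

/-- The sheaf of sections of the line bundle `π` with atlas `A` is isomorphic, as a sheaf of
`𝒪_E`-modules, to `𝒪_E(D)` with `D = ∑ i, a i • Z i`. Sections of `𝒪_E(D)` over `U` are identified
when they agree on `U ∖ ⋃ i, Z i`. -/
def HasSheafOfSections (π : T → E) (A : Set (Set E × (T → ℂ))) (Z : ι → Set E) (a : ι → ℤ) : Prop :=
  ∃ Φ : ∀ U : Set E, (U → T) → (E → ℂ),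
    (∀ U, ZOpen U → ∀ s, IsSection π U s → IsDivisorSection Z a U (Φ U s)) ∧
    (∀ U, ZOpen U → ∀ s s', IsSection π U s → IsSection π U s' →
      Set.EqOn (Φ U s) (Φ U s') (U \ ⋃ i, Z i) → s = s') ∧
    (∀ U, ZOpen U → ∀ f, IsDivisorSection Z a U f →
      ∃ s, IsSection π U s ∧ Set.EqOn (Φ U s) f (U \ ⋃ i, Z i)) ∧
    (∀ U W, ZOpen U → ZOpen W → ∀ hWU : W ⊆ U, ∀ s, IsSection π U s →
      Set.EqOn (Φ W (s ∘ Set.inclusion hWU)) (Φ U s) (W \ ⋃ i, Z i)) ∧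
    (∀ U, ZOpen U → ∀ s₁ s₂ s₃, IsSection π U s₁ → IsSection π U s₂ → IsSection π U s₃ →
      ∀ r ∈ regular U,
      (∀ c ∈ A, ∀ x : U, x.1 ∈ c.1 → c.2 (s₃ x) = r x * c.2 (s₁ x) + c.2 (s₂ x)) →
      Set.EqOn (Φ U s₃) (r * Φ U s₁ + Φ U s₂) (U \ ⋃ i, Z i))

/-- `π : T → E` is the total space of the line bundle `𝒪_E(D)`, `D = ∑ i, a i • Z i`, and the map
`z : E → T` is its zero section. -/
def IsTotalSpace (π : T → E) (z : E → T) (Z : ι → Set E) (a : ι → ℤ) : Prop :=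
  ∃ A : Set (Set E × (T → ℂ)), IsLineBundleAtlas π A ∧ HasSheafOfSections π A Z a ∧
    IsSection π Set.univ (fun x => z x.1) ∧ ∀ c ∈ A, ∀ x ∈ c.1, c.2 (z x) = 0

end Bundles

end SpaceWithFunctions

/-- `A` is a strong deformation retract of `X`. -/
def IsStrongDeformationRetract {X : Type*} [TopologicalSpace X] (A : Set X) : Prop :=
  ∃ r : C(X, X), (∀ x, r x ∈ A) ∧ (ContinuousMap.id X).HomotopicRel r A

/-! ## Toric varieties

`L` is a lattice in the real vector space `V`, and a fan is a set of cones in `V`. -/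

namespace Toric

open SpaceWithFunctions

section General

variable {V : Type*} [AddCommGroup V] [Module ℝ V] (L : AddSubgroup V)

/-- The dual lattice `M`, as a group of linear forms on `V`. -/
def dualLattice : AddSubgroup (Module.Dual ℝ V) where
  carrier := {m | ∀ u ∈ L, ∃ k : ℤ, m u = k}
  zero_mem' := fun _ _ => ⟨0, by simp⟩
  add_mem' := fun {m m'} hm hm' u hu => by
    obtain ⟨k, hk⟩ := hm u hu
    obtain ⟨k', hk'⟩ := hm' u hu
    exact ⟨k + k', by simp [hk, hk']⟩
  neg_mem' := fun {m} hm u hu => by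
    obtain ⟨k, hk⟩ := hm u hu
    exact ⟨-k, by simp [hk]⟩

/-- The monoid `σ^∨ ∩ M`. -/
def dualMonoid (σ : PointedCone ℝ V) : AddSubmonoid (Module.Dual ℝ V) where
  carrier := {m | m ∈ dualLattice L ∧ ∀ u ∈ σ, 0 ≤ m u}
  zero_mem' := ⟨zero_mem _, fun _ _ => le_rfl⟩
  add_mem' := fun hm hm' => ⟨add_mem hm.1 hm'.1, fun u hu => add_nonneg (hm.2 u hu) (hm'.2 u hu)⟩

/-- The coordinate ring `ℂ[σ^∨ ∩ M]`. -/
abbrev CoordRing (σ : PointedCone ℝ V) : Type _ := AddMonoidAlgebra ℂ (dualMonoid L σ)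

/-- The affine toric variety `U_σ = Specm ℂ[σ^∨ ∩ M]`. -/
abbrev AffineToric (σ : PointedCone ℝ V) : Type _ := Specm (CoordRing L σ)

/-- The character `χ^m` as an element of `ℂ[σ^∨ ∩ M]`. -/
noncomputable def character {σ : PointedCone ℝ V} (m : dualMonoid L σ) : CoordRing L σ :=
  AddMonoidAlgebra.single m 1

theorem dualMonoid_anti {τ σ : PointedCone ℝ V} (h : τ ≤ σ) : dualMonoid L σ ≤ dualMonoid L τ :=
  fun _ hm => ⟨hm.1, fun u hu => hm.2 u (h hu)⟩

/-- The toric morphism `U_τ → U_σ` for `τ ⊆ σ`: restriction along `ℂ[σ^∨ ∩ M] ⊆ ℂ[τ^∨ ∩ M]`. -/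
noncomputable def restrict {τ σ : PointedCone ℝ V} (h : τ ≤ σ) (γ : AffineToric L τ) :
    AffineToric L σ :=
  γ.comp (AddMonoidAlgebra.mapDomainAlgHom ℂ ℂ (AddSubmonoid.inclusion (dualMonoid_anti L h)))

/-- `F` is a fan: a finite, nonempty set of strongly convex rational polyhedral cones, closed under
faces, any two of which meet in a common face. -/
structure IsFan (F : Set (PointedCone ℝ V)) : Prop where
  finite : F.Finite
  nonempty : F.Nonempty
  rational : ∀ σ ∈ F, ∃ S : Set V, S.Finite ∧ S ⊆ L ∧ σ = PointedCone.hull ℝ S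
  stronglyConvex : ∀ σ ∈ F, ∀ u ∈ σ, -u ∈ σ → u = 0
  face_mem : ∀ σ ∈ F, ∀ τ : PointedCone ℝ V, τ.IsFaceOf σ → τ ∈ F
  inter_isFace : ∀ σ ∈ F, ∀ τ ∈ F, (σ ⊓ τ).IsFaceOf σ ∧ (σ ⊓ τ).IsFaceOf τ

/-- A cone is smooth if it is generated by a part of a basis of the lattice. -/
def IsSmoothCone (σ : PointedCone ℝ V) : Prop :=
  ∃ (k : ℕ) (b : Module.Basis (Fin k) ℤ L) (s : Set (Fin k)),
    σ = PointedCone.hull ℝ ((fun i => (b i : V)) '' s)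

/-- The fan `F` refines the cone `σ`. -/
def IsRefinement (F : Set (PointedCone ℝ V)) (σ : PointedCone ℝ V) : Prop :=
  IsFan L F ∧ (⋃ τ ∈ F, (τ : Set V)) = σ

/-- The ray generators of a fan: the primitive lattice vectors on its one-dimensional cones. -/
def rayGenerators (F : Set (PointedCone ℝ V)) : Set V :=
  {u | u ∈ L ∧ u ≠ 0 ∧ PointedCone.hull ℝ {u} ∈ F ∧
    ∀ v ∈ L, v ∈ PointedCone.hull ℝ {u} → ∃ k : ℕ, v = k • u}

/-- The Hilbert basis of a strongly convex cone: the nonzero irreducible elements of `σ ∩ L`. -/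
def hilbertBasis (σ : PointedCone ℝ V) : Set V :=
  {u | u ∈ L ∧ u ∈ σ ∧ u ≠ 0 ∧ ∀ v ∈ L, ∀ w ∈ L, v ∈ σ → w ∈ σ → u = v + w → v = 0 ∨ w = 0}

/-- The fan `F` defines a Hilbert basis resolution of the affine toric variety `U_σ`. -/
def IsHilbertBasisResolution (F : Set (PointedCone ℝ V)) (σ : PointedCone ℝ V) : Prop :=
  IsRefinement L F σ ∧ (∀ τ ∈ F, IsSmoothCone L τ) ∧ rayGenerators L F = hilbertBasis L σ

/-- The fan of all faces of those full-dimensional cones of `F` that have `ρ` as a face. -/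
def starNeighborhood (F : Set (PointedCone ℝ V)) (ρ : PointedCone ℝ V) : Set (PointedCone ℝ V) :=
  {τ | ∃ η ∈ F, Module.finrank ℝ (Submodule.span ℝ (η : Set V)) = Module.finrank ℝ V ∧
    ρ.IsFaceOf η ∧ τ.IsFaceOf η}

/-- Gluing of the affine charts `U_σ`, `σ ∈ F`, along `U_τ ⊆ U_σ` for `τ ⊆ σ` in `F`. -/
def Glue (F : Set (PointedCone ℝ V)) (x y : Σ σ : F, AffineToric L σ.1) : Prop :=
  ∃ h : x.1.1 ≤ y.1.1, restrict L h x.2 = y.2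

/-- The toric variety of the fan `F`. -/
def ToricVariety (F : Set (PointedCone ℝ V)) : Type _ := Quot (Glue L F)

variable (F : Set (PointedCone ℝ V))

/-- The affine chart `U_σ → X_F`. -/
def chart (σ : F) (γ : AffineToric L σ.1) : ToricVariety L F := Quot.mk _ ⟨σ, γ⟩

noncomputable instance : SpaceWithFunctions (ToricVariety L F) := glued (chart L F)

/-- The torus orbit `O(τ)`: the points of `U_τ` at which exactly the characters in `τ^⊥` do not
vanish. -/
def orbit (τ : PointedCone ℝ V) : Set (ToricVariety L F) :=
  {x | ∃ (h : τ ∈ F) (γ : AffineToric L τ), x = chart L F ⟨τ, h⟩ γ ∧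
    ∀ m : dualMonoid L τ, γ (character L m) ≠ 0 ↔ ∀ u ∈ τ, m.1 u = 0}

/-- The orbit closure `V(τ)`. -/
def orbitClosure (τ : PointedCone ℝ V) : Set (ToricVariety L F) := zclosure (orbit L F τ)

/-- The toric morphism (the identity on charts) `X_F → X_F'` for fans `F ⊆ F'`. -/
def inclusion {F F' : Set (PointedCone ℝ V)} (h : F ⊆ F') (x : ToricVariety L F) :
    ToricVariety L F' :=
  Quot.lift (r := Glue L F) (fun y => chart L F' ⟨y.1.1, h y.1.2⟩ y.2)
    (fun _ _ hxy => Quot.sound hxy) x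

end General

/-! ## Abelian quotient singularities -/

section Quotient

variable {n : ℕ}

/-- `v` is the fractional expression of `g` with respect to the primitive `r`-th root of unity `ε`
and the eigenbasis `b`: `g = diag(ε ^ a₁, …, ε ^ aₙ)` in the basis `b` with `0 ≤ aᵢ < r`, and
`v = (a₁, …, aₙ) / r`. -/
def IsFractionalExpression (r : ℕ) (ε : ℂ) (b : Module.Basis (Fin n) ℂ (Fin n → ℂ))
    (g : Matrix.SpecialLinearGroup (Fin n) ℂ) (v : Fin n → ℝ) : Prop :=
  ∃ a : Fin n → ℕ, ∀ i, a i < r ∧ g.1.mulVec (b i) = ε ^ a i • b i ∧ v i = (a i : ℝ) / r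

/-- The lattice `N = ℤⁿ + ∑ ℤ ĝ`, the sum being over `g ∈ G`. -/
def lattice (G : Subgroup (Matrix.SpecialLinearGroup (Fin n) ℂ)) (ε : ℂ)
    (b : Module.Basis (Fin n) ℂ (Fin n → ℂ)) : AddSubgroup (Fin n → ℝ) :=
  AddSubgroup.closure (Set.range (fun i => (Pi.single i 1 : Fin n → ℝ)) ∪
    {v | ∃ g ∈ G, IsFractionalExpression (Nat.card G) ε b g v})

variable (n) in
/-- The cone `σ = Cone(e₁, …, eₙ)`. -/
def orthant : PointedCone ℝ (Fin n → ℝ) :=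
  PointedCone.hull ℝ (Set.range fun i => (Pi.single i 1 : Fin n → ℝ))

/-- The age of a vector. -/
def age (v : Fin n → ℝ) : ℝ := ∑ i, v i

/-- The ray generators `u ≠ v` of `F` that span with `v` a cone of `F`. Their classes modulo `v` are
the ray generators of the star fan of `Cone(v)` when `F` is smooth. -/
def starRays (L : AddSubgroup (Fin n → ℝ)) (F : Set (PointedCone ℝ (Fin n → ℝ)))
    (v : Fin n → ℝ) : Set (Fin n → ℝ) :=
  {u | u ∈ rayGenerators L F ∧ u ≠ v ∧ PointedCone.hull ℝ {v, u} ∈ F}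

end Quotient

end Toric

/-! Write `v` for the fractional expression of `g` and `w` for the age form. Having age one, `v` is
not a sum of two nonzero elements of `σ ∩ N`, so it lies in the Hilbert basis and is therefore a ray
generator of `Ξ`. Each full-dimensional cone `η` of `Ξ` with face `ρ` is generated by a basis of
`N`, and `v` is a member of that basis. Thus `X_Ξg` is covered by affine spaces with one coordinate
`x_v` dual to `v`, and `E` is the hyperplane `x_v = 0` in each of them (`IsStarFan`,
`chart_mem_divisor_iff`).

The geometry comes from the one-parameter subgroup of `v`. It multiplies `χ^m` by `t ^ m(v)`, which
still makes sense at `t = 0` on `U_σ` when `v ∈ σ`; these maps glue to `scaling t` on `X_Ξg`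
(`scaling_chart`). In a star chart `scaling t` multiplies `x_v` by `t` and fixes the other
coordinates. So `scaling 0` is a projection `π` onto `E`, and letting `t` run from `1` to `0` gives
the strong deformation retraction. Over the part of `E` in a star chart, `(π, x_v)` is a
trivialization. The forms dual to `v` in two star cones agree on the intersection of the cones
(`coord_eq_coord`), so the two fibre coordinates differ by a character that is invertible on the
overlap and, since its exponent kills `v`, is pulled back from `E` (`exists_transition`). Hence `π`
is a line bundle.

To identify the bundle, use `w`: it is integral on `N` because `G` lies in `SL`, it is nonnegative
on the orthant, and `w v = 1`. So `χ^w` is a global regular function, equal in a star chart to `x_v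
* ∏ x_u ^ age(u)` (`weightFun_eq`) and in particular linear on fibres. Sending a section `s` of `π`
to `χ^w ∘ s` gives functions on `E` divisible by `∏ x_u ^ age(u)`, that is, sections of `𝒪(-∑ age(u)
D_u)`; dividing by the monomial recovers the fibre coordinate of `s` (`IsBoundary.exists_section`,
`IsBoundary.hasSheafOfSections`).

A subfan always gives an open immersion (`isOpenEmb_inclusion`). It contains the whole orbit closure
of `ρ` as soon as every cone of `Ξ` containing `ρ` belongs to `Ξg`. This holds because every cone of
a fan of regular cones refining the orthant lies in a full-dimensional one
(`exists_le_isBasisCone`). -/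

namespace SpaceWithFunctions

/-! ### Morphisms and open embeddings of spaces with functions. -/

section Morphisms

variable {X Y Z : Type*} [SpaceWithFunctions X] [SpaceWithFunctions Y] [SpaceWithFunctions Z]

theorem zOpen_univ : ZOpen (Set.univ : Set X) := zariski.isOpen_univ

theorem ZOpen.inter {U W : Set X} (hU : ZOpen U) (hW : ZOpen W) : ZOpen (U ∩ W) :=
  zariski.isOpen_inter _ _ hU hW

theorem zOpen_of_local {U : Set X} (h : ∀ x ∈ U, ∃ W, ZOpen W ∧ x ∈ W ∧ W ⊆ U) : ZOpen U :=
  (@isOpen_iff_forall_mem_open X zariski U).2 fun x hx => by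
    obtain ⟨W, hW, hxW, hWU⟩ := h x hx
    exact ⟨W, hWU, hW, hxW⟩

theorem regular_of_local {U : Set X} {f : X → ℂ}
    (h : ∀ x ∈ U, ∃ W, ZOpen W ∧ x ∈ W ∧ ∃ g ∈ regular W, Set.EqOn f g (U ∩ W)) :
    f ∈ regular U :=
  regular_local fun x hx => by
    obtain ⟨W, hW, hxW, g, hg, hfg⟩ := h x hx
    exact ⟨W, hW, hxW, regular_congr (regular_mono Set.inter_subset_right hg) hfg.symm⟩

theorem regular_inv_of_ne_zero {U : Set X} (hU : ZOpen U) {q : X → ℂ} (hq : q ∈ regular U)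
    (h : ∀ x ∈ U, q x ≠ 0) : q⁻¹ ∈ regular U := by
  have := (regular_inv hU hq).2
  rwa [show {x | x ∈ U ∧ q x ≠ 0} = U from Set.ext fun x => ⟨fun hx => hx.1, fun hx => ⟨hx, h x hx⟩⟩]
    at this

theorem regular_zpow_of_ne_zero {U : Set X} (hU : ZOpen U) {q : X → ℂ} (hq : q ∈ regular U)
    (h : ∀ x ∈ U, q x ≠ 0) (k : ℤ) : q ^ k ∈ regular U := by
  cases k with
  | ofNat k => simpa using pow_mem hq k
  | negSucc k =>
    rw [zpow_negSucc, ← inv_pow]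
    exact pow_mem (regular_inv_of_ne_zero hU hq h) _

theorem IsMorphism.comp {g : Y → Z} {f : X → Y} (hg : IsMorphism g) (hf : IsMorphism f) :
    IsMorphism (g ∘ f) := fun W hW =>
  ⟨(hf _ (hg W hW).1).1, fun k hk => (hf _ (hg W hW).1).2 _ ((hg W hW).2 k hk)⟩

theorem isMorphism_val (A : Set X) : IsMorphism (Subtype.val : A → X) := fun W hW =>
  ⟨⟨W, hW, rfl⟩, fun k hk _ hx => ⟨W, hW, hx, k, hk, fun _ _ _ => rfl⟩⟩

theorem isMorphism_codRestrict {f : Y → X} (hf : IsMorphism f) {A : Set X} (h : ∀ y, f y ∈ A) :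
    IsMorphism (fun y => (⟨f y, h y⟩ : A)) := by
  rintro _ ⟨W, hW, rfl⟩
  refine ⟨(hf W hW).1, fun k hk => regular_of_local fun y hy => ?_⟩
  obtain ⟨W', hW', hyW', F, hF, hkF⟩ := hk ⟨f y, h y⟩ hy
  refine ⟨f ⁻¹' W', (hf W' hW').1, hyW', F ∘ f, (hf W' hW').2 F hF, fun y' hy' => ?_⟩
  exact hkF ⟨f y', h y'⟩ hy'.1 hy'.2

/-- Isomorphisms onto Zariski open subsets, in terms of images of open sets. -/
structure IsOpenEmb (f : X → Y) : Prop where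
  injective : Function.Injective f
  isMorphism : IsMorphism f
  zOpen_image : ∀ U, ZOpen U → ZOpen (f '' U)
  regular_image : ∀ U, ZOpen U → ∀ k : Y → ℂ, k ∘ f ∈ regular U → k ∈ regular (f '' U)

theorem IsOpenEmb.zOpen_range {f : X → Y} (hf : IsOpenEmb f) : ZOpen (Set.range f) := by
  rw [← Set.image_univ]
  exact hf.zOpen_image _ zOpen_univ

theorem IsOpenEmb.isOpenImmersion {f : X → Y} (hf : IsOpenEmb f) : IsOpenImmersion f := by
  refine ⟨hf.zOpen_range, isMorphism_codRestrict hf.isMorphism Set.mem_range_self,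
    fun y => y.2.choose, fun W hW => ?_, fun x => hf.injective (Set.mem_range_self x).choose_spec,
    fun y => Subtype.ext y.2.choose_spec⟩
  have hpre : (fun y : Set.range f => y.2.choose) ⁻¹' W = Subtype.val ⁻¹' (f '' W) := by
    ext y
    constructor
    · exact fun hy => ⟨_, hy, y.2.choose_spec⟩
    · rintro ⟨x, hx, hxy⟩
      rw [Set.mem_preimage, hf.injective (y.2.choose_spec.trans hxy.symm)]
      exact hx
  rw [hpre]
  -- A function on the source is carried to the target by extending it by `0` off the range, where
  -- its values do not matter.
  refine ⟨⟨_, hf.zOpen_image W hW, rfl⟩, fun k hk y hy => ⟨f '' W, hf.zOpen_image W hW, hy,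
    Function.extend f k 0, hf.regular_image W hW _ ?_, fun z _ _ => ?_⟩⟩
  · rwa [Function.extend_comp hf.injective]
  · conv_rhs => rw [← z.2.choose_spec]
    rw [hf.injective.extend_apply]
    rfl

theorem isOpenEmb_val {A : Set X} (hA : ZOpen A) : IsOpenEmb (Subtype.val : A → X) where
  injective := Subtype.val_injective
  isMorphism := isMorphism_val A
  zOpen_image := by
    rintro _ ⟨W, hW, rfl⟩
    rw [Subtype.image_preimage_coe]
    exact ZOpen.inter hA hW
  regular_image := by
    intro U hU k hk
    refine regular_of_local ?_
    rintro _ ⟨x, hx, rfl⟩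
    obtain ⟨W, hW, hxW, F, hF, h⟩ := hk x hx
    refine ⟨W, hW, hxW, F, hF, ?_⟩
    rintro _ ⟨⟨y, hy, rfl⟩, hyW⟩
    exact h y hy hyW

/-- A map which is a morphism in every chart of a cover by open embeddings is a morphism. -/
theorem isMorphism_of_cover {ι : Type*} {T : ι → Type*} [∀ i, SpaceWithFunctions (T i)]
    {c : ∀ i, T i → X} (hc : ∀ i, IsOpenEmb (c i)) (hcov : ∀ x, ∃ i, x ∈ Set.range (c i))
    {f : X → Y} (hf : ∀ i, IsMorphism (f ∘ c i)) : IsMorphism f := by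
  intro W hW
  have key : ∀ i, c i '' ((f ∘ c i) ⁻¹' W) ⊆ f ⁻¹' W := by
    rintro i _ ⟨t, ht, rfl⟩
    exact ht
  refine ⟨zOpen_of_local fun x hx => ?_, fun k hk => regular_of_local fun x hx => ?_⟩
  · obtain ⟨i, t, rfl⟩ := hcov x
    exact ⟨_, (hc i).zOpen_image _ (hf i W hW).1, ⟨t, hx, rfl⟩, key i⟩
  · obtain ⟨i, t, rfl⟩ := hcov x
    exact ⟨_, (hc i).zOpen_image _ (hf i W hW).1, ⟨t, hx, rfl⟩, k ∘ f,
      (hc i).regular_image _ (hf i W hW).1 _ ((hf i W hW).2 k hk), fun _ _ => rfl⟩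

theorem regular_restrict {A : Set X} {W : Set X} (hW : ZOpen W) {k : X → ℂ} (hk : k ∈ regular W)
    {U : Set A} (hU : ∀ x ∈ U, x.1 ∈ W) : (fun x : A => k x.1) ∈ regular U :=
  regular_mono hU ((isMorphism_val A W hW).2 k hk)

end Morphisms

/-! ### Morphisms to affine varieties. -/

section Affine

variable {A : Type*} [CommRing A] [Algebra ℂ A] {Y : Type*} [SpaceWithFunctions Y]

theorem regular_eval (a : A) (U : Set (Specm A)) : (fun γ : Specm A => γ a) ∈ regular U :=
  fun γ _ => ⟨a, 1, by simp, fun δ _ _ => by simp⟩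

theorem zOpen_ne_zero (a : A) : ZOpen {γ : Specm A | γ a ≠ 0} :=
  fun _ hγ => ⟨a, hγ, fun _ hδ => hδ⟩

/-- A map to an affine variety is a morphism if its coordinate functions are regular. -/
theorem isMorphism_specm {f : Y → Specm A}
    (h : ∀ a : A, (fun y => f y a) ∈ regular (Set.univ : Set Y)) : IsMorphism f := by
  have hopen : ∀ a : A, ZOpen {y | f y a ≠ 0} := fun a => by
    have := (regular_inv zOpen_univ (h a)).1
    simp only [Set.mem_univ, true_and] at this
    exact this
  refine fun W hW => ⟨zOpen_of_local fun y hy => ?_, fun k hk => regular_of_local fun y hy => ?_⟩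
  · obtain ⟨q, hq, hqW⟩ := hW (f y) hy
    exact ⟨_, hopen q, hq, fun y' hy' => hqW _ hy'⟩
  · obtain ⟨p, q, hq, hk⟩ := hk (f y) hy
    refine ⟨_, hopen q, hq, (fun y => f y p) * (fun y => f y q)⁻¹, mul_mem ?_ ?_, fun y' hy' => ?_⟩
    · exact regular_mono (Set.subset_univ _) (h p)
    · exact regular_inv_of_ne_zero (hopen q) (regular_mono (Set.subset_univ _) (h q)) fun _ hx => hx
    · simp [hk (f y') hy'.1 hy'.2, div_eq_mul_inv]

end Affine

/-! ### Morphisms to and from the product with the affine line. -/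

section Product

variable {X Y : Type*} [SpaceWithFunctions X] [SpaceWithFunctions Y]

theorem isMorphism_fst : IsMorphism (Prod.fst : X × ℂ → X) := fun W hW =>
  ⟨fun z hz => ⟨W, hW, hz, 1, by simp [polyVal_one], fun _ hw _ => hw⟩,
    fun k hk z hz => ⟨W, hW, hz, Polynomial.C ⟨k, hk⟩, 1, by simp [polyVal_one], fun w _ _ _ => by
      rw [polyVal_one, div_one]
      simp only [polyVal, Polynomial.eval₂_C]
      rfl⟩⟩

theorem regular_snd (U : Set (X × ℂ)) : (Prod.snd : X × ℂ → ℂ) ∈ regular U := fun z _ =>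
  ⟨Set.univ, zOpen_univ, trivial, Polynomial.X, 1, by simp [polyVal_one], fun w _ _ _ => by
    rw [polyVal_one, div_one]
    simp only [polyVal, Polynomial.eval₂_X]⟩

theorem regular_polyVal {f : Y → X} {t : Y → ℂ} (hf : IsMorphism f)
    (ht : t ∈ regular (Set.univ : Set Y)) {W : Set X} (hW : ZOpen W)
    (p : Polynomial (regular W)) : (fun y => polyVal p (f y, t y)) ∈ regular (f ⁻¹' W) := by
  induction p using Polynomial.induction_on' with
  | add p q hp hq =>
    simp only [polyVal_add]
    exact add_mem hp hq
  | monomial k a =>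
    have : (fun y => polyVal (Polynomial.monomial k a) (f y, t y)) = (a.1 ∘ f) * t ^ k := by
      ext y
      simp only [polyVal, Polynomial.eval₂_monomial]
      rfl
    rw [this]
    exact mul_mem ((hf W hW).2 _ a.2) (pow_mem (regular_mono (Set.subset_univ _) ht) k)

/-- Half of the universal property of `X × 𝔸¹`: open sets and regular functions there are given
locally by polynomials in `t` over regular functions, and these pull back to regular functions by
`regular_polyVal`. -/
theorem isMorphism_prodMk {f : Y → X} {t : Y → ℂ} (hf : IsMorphism f)
    (ht : t ∈ regular (Set.univ : Set Y)) : IsMorphism (fun y => (f y, t y)) := by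
  have hopen : ∀ {W : Set X} (_ : ZOpen W) (q : Polynomial (regular W)),
      ZOpen {y | y ∈ f ⁻¹' W ∧ polyVal q (f y, t y) ≠ 0} := fun hW q =>
    (regular_inv (hf _ hW).1 (regular_polyVal hf ht hW q)).1
  refine fun S hS => ⟨zOpen_of_local fun y hy => ?_, fun k hk => regular_of_local fun y hy => ?_⟩
  · obtain ⟨W, hW, hyW, q, hq, h⟩ := hS _ hy
    exact ⟨_, hopen hW q, ⟨hyW, hq⟩, fun y' hy' => h _ hy'.1 hy'.2⟩
  · obtain ⟨W, hW, hyW, p, q, hq, h⟩ := hk _ hy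
    refine ⟨_, hopen hW q, ⟨hyW, hq⟩,
      (fun y => polyVal p (f y, t y)) * (fun y => polyVal q (f y, t y))⁻¹,
      mul_mem ?_ ?_, fun y' hy' => ?_⟩
    · exact regular_mono (fun _ h => h.1) (regular_polyVal hf ht hW p)
    · exact regular_inv_of_ne_zero (hopen hW q)
        (regular_mono (fun _ h => h.1) (regular_polyVal hf ht hW q)) fun _ hx => hx.2
    · simp [h _ hy'.1 hy'.2.1 hy'.2.2, div_eq_mul_inv]

end Product

/-! ### The classical topology. -/

section Classical

variable {X Y : Type*} [SpaceWithFunctions X] [SpaceWithFunctions Y]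

theorem IsMorphism.continuous {f : X → Y} (hf : IsMorphism f) :
    @Continuous _ _ (classicalTopology X) (classicalTopology Y) f := by
  let _ := classicalTopology X
  refine continuous_generateFrom_iff.2 ?_
  rintro _ ⟨U, hU, k, hk, O, hO, rfl⟩
  exact TopologicalSpace.isOpen_generateFrom_of_mem
    ⟨f ⁻¹' U, (hf U hU).1, k ∘ f, (hf U hU).2 k hk, O, hO, rfl⟩

theorem isOpen_classical_of_zOpen {U : Set X} (hU : ZOpen U) : IsOpen[classicalTopology X] U :=
  TopologicalSpace.isOpen_generateFrom_of_mem
    ⟨U, hU, 1, one_mem _, Set.univ, isOpen_univ, by simp⟩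

/-- Injectivity makes images commute with finite intersections, so only the generating open sets
matter, and an open embedding carries these to generating open sets. -/
theorem IsOpenEmb.isOpenMap {f : X → Y} (hf : IsOpenEmb f) :
    @IsOpenMap _ _ (classicalTopology X) (classicalTopology Y) f := by
  intro s hs
  induction hs with
  | basic s h =>
    obtain ⟨U, hU, k, hk, O, hO, rfl⟩ := h
    refine TopologicalSpace.isOpen_generateFrom_of_mem
      ⟨f '' U, hf.zOpen_image U hU, Function.extend f k 0, hf.regular_image U hU _ ?_, O, hO, ?_⟩
    · rwa [Function.extend_comp hf.injective]
    · ext y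
      constructor
      · rintro ⟨x, hx, rfl⟩
        refine ⟨⟨x, hx.1, rfl⟩, ?_⟩
        rw [hf.injective.extend_apply]
        exact hx.2
      · rintro ⟨⟨x, hx, rfl⟩, h⟩
        rw [hf.injective.extend_apply] at h
        exact ⟨x, ⟨hx, h⟩, rfl⟩
  | univ =>
    rw [Set.image_univ]
    exact isOpen_classical_of_zOpen hf.zOpen_range
  | inter s t _ _ hs ht =>
    rw [Set.image_inter hf.injective]
    exact (classicalTopology Y).isOpen_inter _ _ hs ht
  | sUnion S _ h =>
    rw [Set.image_sUnion]
    refine @isOpen_sUnion _ (classicalTopology Y) _ ?_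
    rintro _ ⟨s, hs, rfl⟩
    exact h s hs

theorem continuous_of_regular {k : X → ℂ} (hk : k ∈ regular (Set.univ : Set X)) :
    @Continuous _ _ (classicalTopology X) _ k := by
  let _ := classicalTopology X
  refine continuous_def.2 fun O hO => ?_
  exact TopologicalSpace.isOpen_generateFrom_of_mem ⟨Set.univ, zOpen_univ, k, hk, O, hO, by
    ext; simp⟩

/-- Near a point, a Zariski open set and a regular function on it involve only finitely many
elements of `A`, so continuity of the evaluations is enough. -/
theorem continuous_specm {A : Type*} [CommRing A] [Algebra ℂ A] {T : Type*} [TopologicalSpace T]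
    {f : T → Specm A} (h : ∀ a, Continuous fun t => f t a) :
    @Continuous _ _ _ (classicalTopology (Specm A)) f := by
  refine continuous_generateFrom_iff.2 ?_
  rintro _ ⟨U, hU, k, hk, O, hO, rfl⟩
  refine isOpen_iff_mem_nhds.2 fun t ht => ?_
  obtain ⟨p, q, hq, hpq⟩ := hk (f t) ht.1
  obtain ⟨r, hr, hrU⟩ := hU (f t) ht.1
  have hk' : ContinuousAt (fun t => f t p / f t q) t := (h p).continuousAt.div (h q).continuousAt hq
  have hO' : O ∈ 𝓝 (f t p / f t q) := by
    rw [← hpq _ ht.1 hq]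
    exact hO.mem_nhds ht.2
  filter_upwards [hk' hO', (h q).continuousAt.eventually_ne hq, (h r).continuousAt.eventually_ne hr]
    with t' h1 h2 h3
  have hU' := hrU _ h3
  exact ⟨hU', by rw [hpq _ hU' h2]; exact h1⟩

end Classical

end SpaceWithFunctions

namespace Toric

open SpaceWithFunctions

/-! ### Regular cones, their faces and the linear forms cutting out faces. -/

section Cones

variable {V : Type*} [AddCommGroup V] [Module ℝ V] {L : AddSubgroup V}

/-- A real basis consisting of lattice vectors whose coordinate forms are integral on the
lattice, i.e. a basis of the lattice. -/
structure IsLatticeBasis {ι : Type*} (L : AddSubgroup V) (B : Module.Basis ι ℝ V) : Prop where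
  mem : ∀ i, B i ∈ L
  coord_mem : ∀ i, B.coord i ∈ dualLattice L

/-- A cone generated by a part of a lattice basis of the ambient space. -/
def IsRegularCone (L : AddSubgroup V) (σ : PointedCone ℝ V) : Prop :=
  ∃ (k : ℕ) (B : Module.Basis (Fin k) ℝ V) (s : Set (Fin k)),
    IsLatticeBasis L B ∧ σ = PointedCone.hull ℝ (B '' s)

theorem mem_hull_basis {ι : Type*} [Fintype ι] (B : Module.Basis ι ℝ V) (s : Set ι) {x : V} :
    x ∈ PointedCone.hull ℝ (B '' s) ↔ (∀ i, 0 ≤ B.coord i x) ∧ ∀ i ∉ s, B.coord i x = 0 := by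
  classical
  constructor
  · intro hx
    induction hx using Submodule.span_induction with
    | mem x hx =>
      obtain ⟨j, hj, rfl⟩ := hx
      refine ⟨fun i => ?_, fun i hi => ?_⟩
      · simp only [Module.Basis.coord_apply, Module.Basis.repr_self, Finsupp.single_apply]
        split_ifs <;> simp
      · simp only [Module.Basis.coord_apply, Module.Basis.repr_self, Finsupp.single_apply]
        rw [if_neg]
        rintro rfl
        exact hi hj
    | zero => simp
    | add x y _ _ hx hy =>
      refine ⟨fun i => ?_, fun i hi => ?_⟩
      · rw [map_add]
        exact add_nonneg (hx.1 i) (hy.1 i)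
      · rw [map_add, hx.2 i hi, hy.2 i hi, add_zero]
    | smul a x _ hx =>
      have : ∀ i, B.coord i (a • x) = (a : ℝ) * B.coord i x := fun i => by
        rw [← smul_eq_mul, ← map_smul]
        rfl
      refine ⟨fun i => ?_, fun i hi => ?_⟩
      · rw [this]
        exact mul_nonneg a.2 (hx.1 i)
      · rw [this, hx.2 i hi, mul_zero]
  · rintro ⟨h0, hs⟩
    rw [← B.sum_repr x]
    refine Submodule.sum_mem _ fun i _ => ?_
    by_cases hi : i ∈ s
    · exact PointedCone.smul_mem _ (h0 i) (PointedCone.subset_hull ⟨i, hi, rfl⟩)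
    · have := hs i hi
      rw [Module.Basis.coord_apply] at this
      rw [this, zero_smul]
      exact zero_mem _

/-- The linear form `m` cuts out the face `τ` of `σ`, and `τ^∨ ∩ M` is obtained from `σ^∨ ∩ M` by
adding `-m`. -/
structure IsFaceCut (L : AddSubgroup V) (τ σ : PointedCone ℝ V) (m : Module.Dual ℝ V) : Prop where
  mem : m ∈ dualMonoid L σ
  mem_iff : ∀ u ∈ σ, u ∈ τ ↔ m u = 0
  bound : ∀ m' ∈ dualMonoid L τ, ∃ k : ℕ, m' + k • m ∈ dualMonoid L σ

theorem apply_eq_sum_coord {ι : Type*} [Fintype ι] (B : Module.Basis ι ℝ V) (m : Module.Dual ℝ V)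
    (x : V) : m x = ∑ i, B.coord i x * m (B i) := by
  conv_lhs => rw [← B.sum_repr x, map_sum]
  exact Finset.sum_congr rfl fun i _ => by rw [map_smul, smul_eq_mul, B.coord_apply]

theorem coord_nonneg_basis {ι : Type*} (B : Module.Basis ι ℝ V) (i j : ι) :
    0 ≤ B.coord i (B j) := by
  classical
  simp only [Module.Basis.coord_apply, Module.Basis.repr_self, Finsupp.single_apply]
  split_ifs <;> simp

/-- A vector of the cone is the sum of its components along the basis, all of which lie in the cone.
A face contains the summands of its elements, so a nonzero coordinate would put `B i` into `τ`. -/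
theorem coord_eq_zero_of_face {ι : Type*} [Fintype ι] {B : Module.Basis ι ℝ V} {s : Set ι}
    {τ : PointedCone ℝ V} (hτ : τ.IsFaceOf (PointedCone.hull ℝ (B '' s))) {u : V} (hu : u ∈ τ)
    {i : ι} (hi : B i ∉ τ) : B.coord i u = 0 := by
  classical
  have hu' := (mem_hull_basis B s).1 (hτ.le hu)
  have hmem : ∀ j, B.coord j u • B j ∈ PointedCone.hull ℝ (B '' s) := fun j => by
    by_cases hj : j ∈ s
    · exact PointedCone.smul_mem _ (hu'.1 j) (PointedCone.subset_hull ⟨j, hj, rfl⟩)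
    · rw [hu'.2 j hj, zero_smul]
      exact zero_mem _
  by_contra hne
  have h1 : B.coord i u • B i ∈ τ := by
    refine hτ.mem_of_sum_mem (f := fun i => B.coord i u • B i) hmem ?_ i
    simpa [Module.Basis.coord_apply, B.sum_repr] using hu
  have h2 := PointedCone.smul_mem τ (inv_nonneg.2 (hu'.1 i)) h1
  rw [smul_smul, inv_mul_cancel₀ hne, one_smul] at h2
  exact hi h2

theorem isFaceCut_of_mem_iff {τ σ : PointedCone ℝ V} {m : Module.Dual ℝ V}
    (hσ : IsRegularCone L σ) (hm : m ∈ dualMonoid L σ) (h : ∀ u ∈ σ, u ∈ τ ↔ m u = 0) :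
    IsFaceCut L τ σ m := by
  refine ⟨hm, h, fun m' hm' => ?_⟩
  obtain ⟨k, B, s, hB, rfl⟩ := hσ
  -- This multiple dominates every `|m' (B i)|`. On generators outside `τ` the integer `m (B i)` is
  -- at least `1`, so it compensates a negative `m' (B i)`; on generators in `τ` the form `m'` is
  -- already nonnegative.
  refine ⟨∑ i, ⌈|m' (B i)|⌉₊, add_mem hm'.1 (nsmul_mem hm.1 _), fun u hu => ?_⟩
  have hu' := (mem_hull_basis B s).1 hu
  rw [apply_eq_sum_coord B]
  refine Finset.sum_nonneg fun i _ => ?_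
  by_cases his : i ∈ s
  · refine mul_nonneg (hu'.1 i) ?_
    rw [LinearMap.add_apply, LinearMap.smul_apply, nsmul_eq_mul]
    have hBi : B i ∈ PointedCone.hull ℝ (B '' s) := PointedCone.subset_hull ⟨i, his, rfl⟩
    by_cases hi : B i ∈ τ
    · exact add_nonneg (hm'.2 _ hi) (mul_nonneg (Nat.cast_nonneg _) (hm.2 _ hBi))
    · have hmi : 1 ≤ m (B i) := by
        obtain ⟨c, hc⟩ := hm.1 (B i) (hB.mem i)
        have h0 : m (B i) ≠ 0 := fun h0 => hi ((h _ hBi).2 h0)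
        have h1 := lt_of_le_of_ne (hm.2 _ hBi) h0.symm
        rw [hc] at h1 ⊢
        exact_mod_cast h1
      have h1 : (⌈|m' (B i)|⌉₊ : ℝ) ≤ ((∑ i, ⌈|m' (B i)|⌉₊ : ℕ) : ℝ) := by
        exact_mod_cast Finset.single_le_sum (f := fun i => ⌈|m' (B i)|⌉₊) (fun _ _ => Nat.zero_le _)
          (Finset.mem_univ i)
      have h2 := mul_le_mul_of_nonneg_left hmi (Nat.cast_nonneg (α := ℝ) (∑ i, ⌈|m' (B i)|⌉₊))
      linarith [Nat.le_ceil |m' (B i)|, neg_abs_le (m' (B i))]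
  · rw [hu'.2 i his, zero_mul]

/-- The cutting form is the sum of the dual forms of the generators of `σ` not in `τ`; on `σ` it
vanishes only when all these coordinates do. -/
theorem exists_isFaceCut {τ σ : PointedCone ℝ V} (hσ : IsRegularCone L σ) (hτ : τ.IsFaceOf σ) :
    ∃ m, IsFaceCut L τ σ m := by
  classical
  obtain ⟨k, B, s, hB, rfl⟩ := id hσ
  set T : Finset (Fin k) := Finset.univ.filter fun i => i ∈ s ∧ B i ∉ τ
  have hmu : ∀ u, (∑ i ∈ T, B.coord i) u = ∑ i ∈ T, B.coord i u := fun u => by simp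
  refine ⟨∑ i ∈ T, B.coord i, isFaceCut_of_mem_iff hσ ⟨sum_mem fun i _ => hB.coord_mem i, ?_⟩ ?_⟩
  · intro u hu
    rw [hmu]
    exact Finset.sum_nonneg fun i _ => ((mem_hull_basis B s).1 hu).1 i
  · intro u hu
    have hu' := (mem_hull_basis B s).1 hu
    rw [hmu, Finset.sum_eq_zero_iff_of_nonneg fun i _ => hu'.1 i]
    refine ⟨fun huτ i hi => coord_eq_zero_of_face hτ huτ (Finset.mem_filter.1 hi).2.2, fun h => ?_⟩
    rw [← B.sum_repr u]
    refine Submodule.sum_mem _ fun i _ => ?_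
    by_cases hi : B i ∈ τ
    · exact PointedCone.smul_mem _ (hu'.1 i) hi
    · have h0 : B.coord i u = 0 := by
        by_cases his : i ∈ s
        · exact h i (Finset.mem_filter.2 ⟨Finset.mem_univ _, his, hi⟩)
        · exact hu'.2 i his
      rw [Module.Basis.coord_apply] at h0
      rw [h0, zero_smul]
      exact zero_mem _

theorem IsFaceCut.inf {τ τ' σ : PointedCone ℝ V} {m m' : Module.Dual ℝ V} (hσ : IsRegularCone L σ)
    (hm : IsFaceCut L τ σ m) (hm' : IsFaceCut L τ' σ m') : IsFaceCut L (τ ⊓ τ') σ (m + m') :=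
  isFaceCut_of_mem_iff hσ (add_mem hm.mem hm'.mem) fun u hu => by
    rw [Submodule.mem_inf, hm.mem_iff u hu, hm'.mem_iff u hu, LinearMap.add_apply,
      add_eq_zero_iff_of_nonneg (hm.mem.2 u hu) (hm'.mem.2 u hu)]

end Cones

/-! ### Points of affine toric varieties and the open embedding attached to a face. -/

section Affine

variable {V : Type*} [AddCommGroup V] [Module ℝ V] {L : AddSubgroup V} {σ τ : PointedCone ℝ V}

theorem character_zero : character L (0 : dualMonoid L σ) = 1 := rfl

theorem character_add (m m' : dualMonoid L σ) :
    character L (m + m') = character L m * character L m' := by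
  simp [character, AddMonoidAlgebra.single_mul_single]

theorem character_nsmul (k : ℕ) (m : dualMonoid L σ) :
    character L (k • m) = character L m ^ k := by
  simp [character, AddMonoidAlgebra.single_pow]

theorem affineToric_ext {γ δ : AffineToric L σ}
    (h : ∀ m, γ (character L m) = δ (character L m)) : γ = δ :=
  AddMonoidAlgebra.algHom_ext (fun m => h m) (by ext)

/-- The point of `U_σ` with prescribed values of the characters. -/
noncomputable def mkPoint (f : dualMonoid L σ → ℂ) (h0 : f 0 = 1)
    (hadd : ∀ m m', f (m + m') = f m * f m') : AffineToric L σ :=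
  AddMonoidAlgebra.lift ℂ ℂ (dualMonoid L σ)
    { toFun := fun m => f m.toAdd, map_one' := h0, map_mul' := fun m m' => hadd m.toAdd m'.toAdd }

@[simp] theorem mkPoint_character (f : dualMonoid L σ → ℂ) (h0 : f 0 = 1)
    (hadd : ∀ m m', f (m + m') = f m * f m') (m : dualMonoid L σ) :
    mkPoint f h0 hadd (character L m) = f m := by
  simp [mkPoint, character]

theorem restrict_character (h : τ ≤ σ) (γ : AffineToric L τ) (m : dualMonoid L σ) :
    restrict L h γ (character L m) = γ (character L ⟨m.1, dualMonoid_anti L h m.2⟩) := by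
  simp [restrict, character]
  rfl

theorem restrict_restrict {υ : PointedCone ℝ V} (h : τ ≤ σ) (h' : υ ≤ τ) (γ : AffineToric L υ) :
    restrict L h (restrict L h' γ) = restrict L (h'.trans h) γ :=
  affineToric_ext fun m => by simp only [restrict_character]

theorem restrict_rfl (γ : AffineToric L σ) : restrict L le_rfl γ = γ :=
  affineToric_ext fun m => by simp only [restrict_character]

theorem isMorphism_restrict (h : τ ≤ σ) : IsMorphism (restrict L h) :=
  isMorphism_specm fun a => regular_eval (AddMonoidAlgebra.mapDomainAlgHom ℂ ℂ
    (AddSubmonoid.inclusion (dualMonoid_anti L h)) a) Set.univ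

namespace IsFaceCut

variable {m : Module.Dual ℝ V}

theorem neg_mem (hm : IsFaceCut L τ σ m) (h : τ ≤ σ) : -m ∈ dualMonoid L τ :=
  ⟨AddSubgroup.neg_mem _ hm.mem.1, fun u hu => by
    rw [LinearMap.neg_apply, (hm.mem_iff u (h hu)).1 hu, neg_zero]⟩

theorem apply_ne_zero (hm : IsFaceCut L τ σ m) (h : τ ≤ σ) (δ : AffineToric L τ) :
    δ (character L ⟨m, dualMonoid_anti L h hm.mem⟩) ≠ 0 := by
  intro h0
  have : δ (character L (⟨m, dualMonoid_anti L h hm.mem⟩ + ⟨-m, hm.neg_mem h⟩)) = 1 := by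
    rw [show (⟨m, dualMonoid_anti L h hm.mem⟩ + ⟨-m, hm.neg_mem h⟩ : dualMonoid L τ) = 0 from
      Subtype.ext (add_neg_cancel m), character_zero, map_one]
  rw [character_add, map_mul, h0, zero_mul] at this
  exact zero_ne_one this

theorem restrict_ne_zero (hm : IsFaceCut L τ σ m) (h : τ ≤ σ) (δ : AffineToric L τ) :
    restrict L h δ (character L ⟨m, hm.mem⟩) ≠ 0 := by
  rw [restrict_character]
  exact hm.apply_ne_zero h δ

theorem apply_mul_pow (hm : IsFaceCut L τ σ m) (h : τ ≤ σ) (δ : AffineToric L τ)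
    {m' : Module.Dual ℝ V} (hm' : m' ∈ dualMonoid L τ) {k : ℕ}
    (hk : m' + k • m ∈ dualMonoid L σ) :
    δ (character L ⟨m', hm'⟩) * δ (character L ⟨m, dualMonoid_anti L h hm.mem⟩) ^ k =
      restrict L h δ (character L ⟨m' + k • m, hk⟩) := by
  rw [restrict_character, ← map_pow, ← map_mul, ← character_nsmul, ← character_add]
  rfl

theorem restrict_injective (hm : IsFaceCut L τ σ m) (h : τ ≤ σ) :
    Function.Injective (restrict L h) := by
  intro δ δ' hδ
  refine affineToric_ext fun m' => ?_
  obtain ⟨k, hk⟩ := hm.bound m'.1 m'.2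
  have h1 := hm.apply_mul_pow h δ m'.2 hk
  have h2 := hm.apply_mul_pow h δ' m'.2 hk
  have h3 : δ (character L ⟨m, dualMonoid_anti L h hm.mem⟩) =
      δ' (character L ⟨m, dualMonoid_anti L h hm.mem⟩) := by
    have := congrArg (fun γ => γ (character L ⟨m, hm.mem⟩)) hδ
    simpa only [restrict_character] using this
  rw [← hδ, ← h1, ← h3] at h2
  exact (mul_right_cancel₀ (pow_ne_zero _ (hm.apply_ne_zero h δ)) h2).symm

/-- Points of `U_σ` at which the character of the cut does not vanish come from `U_τ`. -/
theorem exists_restrict_eq (hm : IsFaceCut L τ σ m) (h : τ ≤ σ) (γ : AffineToric L σ)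
    (hγ : γ (character L ⟨m, hm.mem⟩) ≠ 0) : ∃ δ, restrict L h δ = γ := by
  choose k hk using fun m' : dualMonoid L τ => hm.bound m'.1 m'.2
  set c := γ (character L ⟨m, hm.mem⟩) with hc
  -- The quotient `χ^(m' + a m) / (χ^m)^a` at `γ` does not depend on the exponent `a`; it is the
  -- only possible value of `χ^m'` at a preimage of `γ`.
  have key : ∀ (m' : Module.Dual ℝ V) (a b : ℕ) (ha : m' + a • m ∈ dualMonoid L σ)
      (hb : m' + b • m ∈ dualMonoid L σ),
      γ (character L ⟨_, ha⟩) * c ^ b = γ (character L ⟨_, hb⟩) * c ^ a := by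
    intro m' a b ha hb
    rw [hc, ← map_pow, ← map_mul, ← character_nsmul, ← character_add, ← map_pow, ← map_mul,
      ← character_nsmul, ← character_add]
    congr 2
    exact Subtype.ext (add_right_comm m' (a • m) (b • m))
  refine ⟨mkPoint (fun m' => γ (character L ⟨_, hk m'⟩) / c ^ k m') ?_ ?_, ?_⟩
  · rw [div_eq_one_iff_eq (pow_ne_zero _ hγ)]
    have hz : (0 : Module.Dual ℝ V) + 0 • m ∈ dualMonoid L σ := by simp
    have := key 0 _ 0 (hk 0) hz
    rw [pow_zero, mul_one] at this
    refine this.trans ?_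
    rw [show (⟨0 + 0 • m, hz⟩ : dualMonoid L σ) = 0 from Subtype.ext (by simp), character_zero,
      map_one, one_mul]
  · intro m₁ m₂
    have hs : (m₁ + m₂).1 + (k m₁ + k m₂) • m ∈ dualMonoid L σ := by
      have := add_mem (hk m₁) (hk m₂)
      rwa [add_add_add_comm, ← add_smul] at this
    rw [div_mul_div_comm, ← pow_add, div_eq_div_iff (pow_ne_zero _ hγ) (pow_ne_zero _ hγ),
      key _ _ _ (hk (m₁ + m₂)) hs, ← map_mul, ← character_add]
    congr 3
    refine Subtype.ext ?_
    change m₁.1 + m₂.1 + (k m₁ + k m₂) • m = _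
    rw [add_smul, add_add_add_comm]
    rfl
  · refine affineToric_ext fun m' => ?_
    have hm' := dualMonoid_anti L h m'.2
    rw [restrict_character, mkPoint_character, div_eq_iff (pow_ne_zero _ hγ)]
    have := key m'.1 (k ⟨m'.1, hm'⟩) 0 (hk ⟨m'.1, hm'⟩) (by simp)
    rw [pow_zero, mul_one] at this
    refine this.trans ?_
    congr 3
    exact Subtype.ext (by simp)

/-- Clearing denominators: `ℂ[τ^∨ ∩ M]` is the localization of `ℂ[σ^∨ ∩ M]` at the character of the
cut. -/
theorem exists_numerator (hm : IsFaceCut L τ σ m) (h : τ ≤ σ) (q : CoordRing L τ) :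
    ∃ (K : ℕ) (q' : CoordRing L σ), ∀ δ : AffineToric L τ, restrict L h δ q' =
      δ q * restrict L h δ (character L ⟨m, hm.mem⟩) ^ K := by
  induction q using AddMonoidAlgebra.induction_linear with
  | zero => exact ⟨0, 0, by simp⟩
  | add p q hp hq =>
    obtain ⟨K, p', hp'⟩ := hp
    obtain ⟨K', q', hq'⟩ := hq
    refine ⟨K + K', p' * character L ⟨m, hm.mem⟩ ^ K' + q' * character L ⟨m, hm.mem⟩ ^ K,
      fun δ => ?_⟩
    rw [map_add, map_mul, map_mul, map_pow, map_pow, hp', hq', map_add]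
    ring
  | single m' c =>
    obtain ⟨k, hk⟩ := hm.bound m'.1 m'.2
    refine ⟨k, c • character L ⟨_, hk⟩, fun δ => ?_⟩
    have : (AddMonoidAlgebra.single m' c : CoordRing L τ) = c • character L m' := by
      simp [character]
    rw [this, map_smul, map_smul, ← hm.apply_mul_pow h δ m'.2 hk, restrict_character, smul_mul_assoc]

theorem isOpenEmb_restrict (hm : IsFaceCut L τ σ m) (h : τ ≤ σ) : IsOpenEmb (restrict L h) where
  injective := hm.restrict_injective h
  isMorphism := isMorphism_restrict h
  zOpen_image := by
    rintro U hU _ ⟨δ, hδ, rfl⟩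
    obtain ⟨q, hq, hqU⟩ := hU δ hδ
    obtain ⟨K, q', hq'⟩ := hm.exists_numerator h q
    refine ⟨q' * character L ⟨m, hm.mem⟩, ?_, fun γ hγ => ?_⟩
    · rw [map_mul, hq']
      exact mul_ne_zero (mul_ne_zero hq (pow_ne_zero _ (hm.restrict_ne_zero h δ)))
        (hm.restrict_ne_zero h δ)
    · rw [map_mul] at hγ
      obtain ⟨δ', rfl⟩ := hm.exists_restrict_eq h γ (right_ne_zero_of_mul hγ)
      rw [hq'] at hγ
      exact ⟨δ', hqU _ (left_ne_zero_of_mul (left_ne_zero_of_mul hγ)), rfl⟩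
  regular_image := by
    rintro U hU k hk _ ⟨δ, hδ, rfl⟩
    obtain ⟨p, q, hq, hpq⟩ := hk δ hδ
    obtain ⟨K, p', hp'⟩ := hm.exists_numerator h p
    obtain ⟨K', q', hq'⟩ := hm.exists_numerator h q
    refine ⟨p' * character L ⟨m, hm.mem⟩ ^ K', q' * character L ⟨m, hm.mem⟩ ^ K, ?_, ?_⟩
    · rw [map_mul, hq', map_pow]
      have := hm.restrict_ne_zero h δ
      exact mul_ne_zero (mul_ne_zero hq (pow_ne_zero _ this)) (pow_ne_zero _ this)
    · rintro _ ⟨δ', hδ', rfl⟩ hne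
      rw [map_mul, hq', map_pow] at hne
      have hq0 := left_ne_zero_of_mul (left_ne_zero_of_mul hne)
      have hc := hm.restrict_ne_zero h δ'
      rw [map_mul, map_mul, hp', hq', map_pow, map_pow]
      have := hpq δ' hδ' hq0
      simp only [Function.comp_apply] at this
      rw [this]
      field_simp

end IsFaceCut

end Affine

end Toric

namespace Toric

open SpaceWithFunctions

/-! ### Gluing the charts of a fan, orbits and orbit closures. -/

section Fans

variable {V : Type*} [AddCommGroup V] [Module ℝ V] {L : AddSubgroup V}

/-- A fan of cones generated by parts of lattice bases. -/
structure IsRegularFan (L : AddSubgroup V) (F : Set (PointedCone ℝ V)) : Prop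
    extends IsFan L F where
  regular : ∀ σ ∈ F, IsRegularCone L σ

variable {F : Set (PointedCone ℝ V)}

theorem IsFan.inf_mem (hF : IsFan L F) {σ τ : PointedCone ℝ V} (hσ : σ ∈ F) (hτ : τ ∈ F) :
    σ ⊓ τ ∈ F :=
  hF.face_mem σ hσ _ (hF.inter_isFace σ hσ τ hτ).1

theorem IsFan.isFaceOf_of_le (hF : IsFan L F) {σ τ : PointedCone ℝ V} (hσ : σ ∈ F) (hτ : τ ∈ F)
    (h : τ ≤ σ) : τ.IsFaceOf σ := by
  have := (hF.inter_isFace σ hσ τ hτ).1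
  rwa [inf_eq_right.2 h] at this

theorem IsRegularFan.exists_cut (hF : IsRegularFan L F) {σ τ : PointedCone ℝ V} (hσ : σ ∈ F)
    (hτ : τ ∈ F) (h : τ ≤ σ) : ∃ m, IsFaceCut L τ σ m :=
  exists_isFaceCut (hF.regular σ hσ) (hF.isFaceOf_of_le hσ hτ h)

theorem chart_restrict {σ τ : F} (h : τ.1 ≤ σ.1) (δ : AffineToric L τ.1) :
    chart L F σ (restrict L h δ) = chart L F τ δ :=
  (Quot.sound ⟨h, rfl⟩ : Quot.mk (Glue L F) ⟨τ, δ⟩ = Quot.mk (Glue L F) ⟨σ, restrict L h δ⟩).symm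

theorem exists_chart (x : ToricVariety L F) : ∃ (σ : F) (γ : AffineToric L σ.1),
    chart L F σ γ = x := by
  obtain ⟨⟨σ, γ⟩, rfl⟩ := Quot.exists_rep x
  exact ⟨σ, γ, rfl⟩

/-- Two points of charts coincide if and only if they come from a point of the chart of the
intersection of the two cones. -/
theorem IsRegularFan.chart_eq_iff (hF : IsRegularFan L F) {σ τ : F} {γ : AffineToric L σ.1}
    {δ : AffineToric L τ.1} : chart L F σ γ = chart L F τ δ ↔
      ∃ α : AffineToric L (σ.1 ⊓ τ.1),
        restrict L inf_le_left α = γ ∧ restrict L inf_le_right α = δ := by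
  constructor
  · intro h
    suffices H : ∀ x y : (Σ σ : F, AffineToric L σ.1), Relation.EqvGen (Glue L F) x y →
        ∃ α : AffineToric L (x.1.1 ⊓ y.1.1),
          restrict L inf_le_left α = x.2 ∧ restrict L inf_le_right α = y.2 from
      H ⟨σ, γ⟩ ⟨τ, δ⟩ (Quot.eqvGen_exact h)
    intro x y hxy
    induction hxy with
    | rel x y h =>
      obtain ⟨hle, h⟩ := h
      refine ⟨restrict L (le_inf le_rfl hle) x.2, ?_, ?_⟩
      · rw [restrict_restrict, restrict_rfl]
      · rw [restrict_restrict, h]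
    | refl x =>
      refine ⟨restrict L (le_inf le_rfl le_rfl) x.2, ?_, ?_⟩ <;> rw [restrict_restrict, restrict_rfl]
    | symm x y _ ih =>
      obtain ⟨α, h1, h2⟩ := ih
      refine ⟨restrict L (le_inf inf_le_right inf_le_left) α, ?_, ?_⟩
      · rw [restrict_restrict, h2]
      · rw [restrict_restrict, h1]
    | trans x y z _ _ ih1 ih2 =>
      obtain ⟨α, h1, h2⟩ := ih1
      obtain ⟨β, h3, h4⟩ := ih2
      -- Inside the chart of `y` the two overlaps are the loci where `χ^m` and `χ^m'` do not vanish.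
      -- The point `y` is in both, so `χ^(m + m')` does not vanish there and the point comes from
      -- the triple intersection.
      obtain ⟨m, hm⟩ := hF.exists_cut y.1.2 (hF.inf_mem x.1.2 y.1.2) inf_le_right
      obtain ⟨m', hm'⟩ := hF.exists_cut y.1.2 (hF.inf_mem y.1.2 z.1.2) inf_le_left
      have hmm := hm.inf (hF.regular _ y.1.2) hm'
      obtain ⟨ε, hε⟩ := hmm.exists_restrict_eq (inf_le_left.trans inf_le_right) y.2 (by
        rw [show (⟨m + m', hmm.mem⟩ : dualMonoid L y.1.1) = ⟨m, hm.mem⟩ + ⟨m', hm'.mem⟩ from rfl,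
          character_add, map_mul]
        refine mul_ne_zero ?_ ?_
        · rw [← h2]
          exact hm.restrict_ne_zero _ _
        · rw [← h3]
          exact hm'.restrict_ne_zero _ _)
      refine ⟨restrict L (le_inf (inf_le_left.trans inf_le_left) (inf_le_right.trans inf_le_right)) ε,
        ?_, ?_⟩
      · have : restrict L inf_le_left ε = α := hm.restrict_injective inf_le_right (by
          rw [restrict_restrict, hε, h2])
        rw [restrict_restrict, ← h1, ← this, restrict_restrict]
      · have : restrict L inf_le_right ε = β := hm'.restrict_injective inf_le_left (by
          rw [restrict_restrict, hε, h3])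
        rw [restrict_restrict, ← h4, ← this, restrict_restrict]
  · rintro ⟨α, rfl, rfl⟩
    have h1 := chart_restrict (τ := ⟨σ.1 ⊓ τ.1, hF.inf_mem σ.2 τ.2⟩) (σ := σ) inf_le_left α
    have h2 := chart_restrict (τ := ⟨σ.1 ⊓ τ.1, hF.inf_mem σ.2 τ.2⟩) (σ := τ) inf_le_right α
    exact h1.trans h2.symm

theorem IsRegularFan.chart_injective (hF : IsRegularFan L F) (σ : F) :
    Function.Injective (chart L F σ) := by
  intro γ δ h
  obtain ⟨α, rfl, rfl⟩ := hF.chart_eq_iff.1 h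
  rfl

theorem isMorphism_chart (σ : F) : IsMorphism (chart L F σ) :=
  fun _ hW => ⟨hW σ, fun _ hk => hk σ⟩

theorem IsRegularFan.preimage_image_chart (hF : IsRegularFan L F) (σ τ : F)
    (U : Set (AffineToric L σ.1)) : chart L F τ ⁻¹' (chart L F σ '' U) =
      restrict L (inf_le_right : σ.1 ⊓ τ.1 ≤ τ.1) ''
        (restrict L (inf_le_left : σ.1 ⊓ τ.1 ≤ σ.1) ⁻¹' U) := by
  ext δ
  constructor
  · rintro ⟨γ, hγ, h⟩
    obtain ⟨α, rfl, rfl⟩ := hF.chart_eq_iff.1 h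
    exact ⟨α, hγ, rfl⟩
  · rintro ⟨α, hα, rfl⟩
    exact ⟨_, hα, hF.chart_eq_iff.2 ⟨α, rfl, rfl⟩⟩

theorem IsRegularFan.isOpenEmb_chart (hF : IsRegularFan L F) (σ : F) :
    IsOpenEmb (chart L F σ) where
  injective := hF.chart_injective σ
  isMorphism := isMorphism_chart σ
  zOpen_image U hU τ := by
    rw [hF.preimage_image_chart]
    obtain ⟨m, hm⟩ := hF.exists_cut τ.2 (hF.inf_mem σ.2 τ.2) inf_le_right
    exact (hm.isOpenEmb_restrict _).zOpen_image _ (isMorphism_restrict _ U hU).1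
  regular_image U hU k hk τ := by
    rw [hF.preimage_image_chart]
    obtain ⟨m, hm⟩ := hF.exists_cut τ.2 (hF.inf_mem σ.2 τ.2) inf_le_right
    refine (hm.isOpenEmb_restrict _).regular_image _ (isMorphism_restrict _ U hU).1 _ ?_
    have h := (isMorphism_restrict (L := L) (inf_le_left : σ.1 ⊓ τ.1 ≤ σ.1) U hU).2 _ hk
    convert! h using 1
    ext α
    simp only [Function.comp_apply]
    rw [hF.chart_eq_iff.2 ⟨α, rfl, rfl⟩]

/-- The criterion `chart_eq_iff` involves only two cones and their intersection, so it reads the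
same in both fans and gives injectivity. The remaining claims are local and hold in the charts. -/
theorem IsRegularFan.isOpenEmb_inclusion {F' : Set (PointedCone ℝ V)} (hF : IsRegularFan L F)
    (hF' : IsRegularFan L F') (h : F ⊆ F') : IsOpenEmb (inclusion L h) := by
  have hchart : ∀ σ : F, inclusion L h ∘ chart L F σ = chart L F' ⟨σ.1, h σ.2⟩ := fun _ => rfl
  have himage : ∀ (U : Set (ToricVariety L F)) (σ : F),
      chart L F' ⟨σ.1, h σ.2⟩ '' (chart L F σ ⁻¹' U) ⊆ inclusion L h '' U := by
    rintro U σ _ ⟨γ, hγ, rfl⟩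
    exact ⟨_, hγ, rfl⟩
  refine ⟨?_, ?_, fun U hU => zOpen_of_local ?_, fun U hU k hk => regular_of_local ?_⟩
  · intro x y hxy
    obtain ⟨σ, γ, rfl⟩ := exists_chart x
    obtain ⟨τ, δ, rfl⟩ := exists_chart y
    exact hF.chart_eq_iff.2
      ((hF'.chart_eq_iff (σ := ⟨σ.1, h σ.2⟩) (τ := ⟨τ.1, h τ.2⟩)).1 hxy)
  · exact isMorphism_of_cover hF.isOpenEmb_chart
      (fun x => by obtain ⟨σ, γ, h⟩ := exists_chart x; exact ⟨σ, γ, h⟩)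
      fun σ => isMorphism_chart (F := F') ⟨σ.1, h σ.2⟩
  · rintro _ ⟨x, hx, rfl⟩
    obtain ⟨σ, γ, rfl⟩ := exists_chart x
    exact ⟨_, (hF'.isOpenEmb_chart ⟨σ.1, h σ.2⟩).zOpen_image _ (hU σ), ⟨γ, hx, rfl⟩, himage U σ⟩
  · rintro _ ⟨x, hx, rfl⟩
    obtain ⟨σ, γ, rfl⟩ := exists_chart x
    exact ⟨_, (hF'.isOpenEmb_chart ⟨σ.1, h σ.2⟩).zOpen_image _ (hU σ), ⟨γ, hx, rfl⟩, k,
      (hF'.isOpenEmb_chart ⟨σ.1, h σ.2⟩).regular_image _ (hU σ) _ (hk σ), fun _ _ => rfl⟩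

theorem IsRegularFan.chart_mem_orbit_iff (hF : IsRegularFan L F) {σ τ : F} (h : τ.1 ≤ σ.1)
    {γ : AffineToric L σ.1} : chart L F σ γ ∈ orbit L F τ.1 ↔ ∃ δ : AffineToric L τ.1,
      restrict L h δ = γ ∧ ∀ m : dualMonoid L τ.1, δ (character L m) ≠ 0 ↔ ∀ u ∈ τ.1, m.1 u = 0 := by
  constructor
  · rintro ⟨hτ, δ, hx, hδ⟩
    refine ⟨δ, hF.chart_injective σ ?_, hδ⟩
    rw [hx, chart_restrict]
  · rintro ⟨δ, rfl, hδ⟩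
    exact ⟨τ.2, δ, chart_restrict h δ, hδ⟩

theorem mem_orbitClosure_iff {τ : PointedCone ℝ V} {x : ToricVariety L F} :
    x ∈ orbitClosure L F τ ↔ ∀ W : Set (ToricVariety L F), ZOpen W → x ∈ W →
      ∃ y ∈ W, y ∈ orbit L F τ :=
  @mem_closure_iff _ zariski _ _

/-- The character cutting `σ ∩ τ` out of `τ` does not vanish at the point. On the orbit of `τ` this
forces its exponent to vanish on all of `τ`, so `τ = σ ∩ τ`. -/
theorem IsRegularFan.le_of_chart_mem_orbit (hF : IsRegularFan L F) {σ : F} {τ : PointedCone ℝ V}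
    {γ : AffineToric L σ.1} (h : chart L F σ γ ∈ orbit L F τ) : τ ≤ σ.1 := by
  obtain ⟨hτ, δ, hx, hδ⟩ := h
  obtain ⟨α, -, rfl⟩ := (hF.chart_eq_iff (τ := ⟨τ, hτ⟩)).1 hx
  obtain ⟨m, hm⟩ := hF.exists_cut hτ (hF.inf_mem σ.2 hτ) inf_le_right
  intro u hu
  have := (hδ ⟨m, hm.mem⟩).1 (hm.restrict_ne_zero _ α) u hu
  exact ((hm.mem_iff u hu).2 this).1

/-- The chart of `σ` is an open neighbourhood of the point, hence meets the orbit itself. -/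
theorem IsRegularFan.le_of_chart_mem_orbitClosure (hF : IsRegularFan L F) {σ : F}
    {τ : PointedCone ℝ V} {γ : AffineToric L σ.1} (h : chart L F σ γ ∈ orbitClosure L F τ) :
    τ ≤ σ.1 := by
  obtain ⟨_, ⟨δ, rfl⟩, hδ⟩ := mem_orbitClosure_iff.1 h _ (hF.isOpenEmb_chart σ).zOpen_range ⟨γ, rfl⟩
  exact hF.le_of_chart_mem_orbit hδ

theorem inclusion_mem_orbit_iff {F' : Set (PointedCone ℝ V)} (hF : IsRegularFan L F)
    (hF' : IsRegularFan L F') (h : F ⊆ F') {τ : PointedCone ℝ V} (hτ : τ ∈ F)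
    {x : ToricVariety L F} : inclusion L h x ∈ orbit L F' τ ↔ x ∈ orbit L F τ := by
  constructor
  · rintro ⟨hτ', δ, hx, hδ⟩
    exact ⟨hτ, δ, (hF.isOpenEmb_inclusion hF' h).injective hx, hδ⟩
  · rintro ⟨hτ, δ, rfl, hδ⟩
    exact ⟨h hτ, δ, rfl, hδ⟩

/-- The orbit closure of `τ` lies in the open subvariety of a subfan containing all cones of the
fan that contain `τ`. -/
theorem inclusion_image_orbitClosure {F' : Set (PointedCone ℝ V)} (hF : IsRegularFan L F)
    (hF' : IsRegularFan L F') (h : F ⊆ F') {τ : PointedCone ℝ V} (hτ : τ ∈ F)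
    (hstar : ∀ σ ∈ F', τ ≤ σ → σ ∈ F) :
    inclusion L h '' orbitClosure L F τ = orbitClosure L F' τ := by
  have hemb := hF.isOpenEmb_inclusion hF' h
  ext y
  constructor
  · rintro ⟨x, hx, rfl⟩
    refine mem_orbitClosure_iff.2 fun W hW hxW => ?_
    obtain ⟨x', hx', hx'τ⟩ := mem_orbitClosure_iff.1 hx _ (hemb.isMorphism W hW).1 hxW
    exact ⟨_, hx', (inclusion_mem_orbit_iff hF hF' h hτ).2 hx'τ⟩
  · intro hy
    obtain ⟨σ, γ, rfl⟩ := exists_chart y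
    have hσ := hstar σ.1 σ.2 (hF'.le_of_chart_mem_orbitClosure hy)
    refine ⟨chart L F ⟨σ.1, hσ⟩ γ, mem_orbitClosure_iff.2 fun W hW hγ => ?_, rfl⟩
    obtain ⟨_, ⟨x, hx, rfl⟩, hxτ⟩ := mem_orbitClosure_iff.1 hy _ (hemb.zOpen_image W hW) ⟨_, hγ, rfl⟩
    exact ⟨x, hx, (inclusion_mem_orbit_iff hF hF' h hτ).1 hxτ⟩

end Fans

end Toric

namespace Toric

open SpaceWithFunctions

/-! ### Natural number exponents and vanishing of polynomials on coordinate subspaces. -/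

section Exponents

variable {V : Type*} [AddCommGroup V] [Module ℝ V] {L : AddSubgroup V} {σ : PointedCone ℝ V}

/-- The value is a nonnegative integer, so `⌊m u⌋₊` loses nothing and may serve as an exponent. -/
theorem cast_floor_apply {m : Module.Dual ℝ V} (hm : m ∈ dualMonoid L σ) {u : V} (hu : u ∈ L)
    (huσ : u ∈ σ) : (⌊m u⌋₊ : ℝ) = m u := by
  obtain ⟨k, hk⟩ := hm.1 u hu
  have h0 := hm.2 u huσ
  rw [hk] at h0 ⊢
  have hk0 : 0 ≤ k := by exact_mod_cast h0
  lift k to ℕ using hk0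
  simp

theorem floor_add_apply {m m' : Module.Dual ℝ V} (hm : m ∈ dualMonoid L σ)
    (hm' : m' ∈ dualMonoid L σ) {u : V} (hu : u ∈ L) (huσ : u ∈ σ) :
    ⌊(m + m') u⌋₊ = ⌊m u⌋₊ + ⌊m' u⌋₊ := by
  have h : (⌊(m + m') u⌋₊ : ℝ) = ⌊m u⌋₊ + ⌊m' u⌋₊ := by
    rw [cast_floor_apply (add_mem hm hm') hu huσ, cast_floor_apply hm hu huσ,
      cast_floor_apply hm' hu huσ, LinearMap.add_apply]
  exact_mod_cast h

theorem floor_apply_eq_zero_iff {m : Module.Dual ℝ V} (hm : m ∈ dualMonoid L σ) {u : V}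
    (hu : u ∈ L) (huσ : u ∈ σ) : ⌊m u⌋₊ = 0 ↔ m u = 0 := by
  rw [← Nat.cast_eq_zero (R := ℝ), cast_floor_apply hm hu huσ]

end Exponents

section Polynomials

variable {ι : Type*}

/-- Density of the torus in a coordinate subspace: `P` stays nonzero after the variables in `S` are
set to zero, and a nonzero polynomial over an infinite field has a nonvanishing point. -/
theorem exists_eval_ne_zero [Finite ι] (S : Set ι) {P : MvPolynomial ι ℂ} {z : ι → ℂ}
    (hz : ∀ i ∈ S, z i = 0) (hP : MvPolynomial.eval z P ≠ 0) :
    ∃ w : ι → ℂ, (∀ i, w i = 0 ↔ i ∈ S) ∧ MvPolynomial.eval w P ≠ 0 := by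
  classical
  have := Fintype.ofFinite ι
  set f : ι → MvPolynomial ι ℂ := fun i => if i ∈ S then 0 else MvPolynomial.X i with hf
  have heval : ∀ w : ι → ℂ, MvPolynomial.eval w (MvPolynomial.bind₁ f P) =
      MvPolynomial.eval (fun i => if i ∈ S then 0 else w i) P := fun w => by
    rw [← MvPolynomial.coe_aeval_eq_eval, RingHom.coe_coe, MvPolynomial.aeval_bind₁,
      ← MvPolynomial.coe_aeval_eq_eval, RingHom.coe_coe]
    congr 2
    ext i
    simp only [hf]
    split_ifs <;> simp
  -- The extra factor `∏ X i` makes the point found below have all its coordinates nonzero before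
  -- those in `S` are reset to zero.
  have hne : MvPolynomial.bind₁ f P * ∏ i, MvPolynomial.X i ≠ 0 := by
    refine mul_ne_zero (fun h0 => hP ?_) (Finset.prod_ne_zero_iff.2 fun i _ => MvPolynomial.X_ne_zero i)
    have := heval z
    rw [h0, map_zero] at this
    rw [this]
    congr 2
    ext i
    split_ifs with hi
    · exact hz i hi
    · rfl
  obtain ⟨w, hw⟩ : ∃ w, MvPolynomial.eval w (MvPolynomial.bind₁ f P * ∏ i, MvPolynomial.X i) ≠ 0 := by
    by_contra! h
    exact hne (MvPolynomial.funext fun w => by rw [h w, map_zero])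
  rw [map_mul, heval, map_prod] at hw
  refine ⟨_, fun i => ?_, left_ne_zero_of_mul hw⟩
  have h0 := Finset.prod_ne_zero_iff.1 (right_ne_zero_of_mul hw) i (Finset.mem_univ i)
  rw [MvPolynomial.eval_X] at h0
  by_cases hi : i ∈ S <;> simp [hi, h0]

theorem eval_eq_zero_of_forall_ne_zero [Finite ι] {P : MvPolynomial ι ℂ}
    (h : ∀ w : ι → ℂ, (∀ i, w i ≠ 0) → MvPolynomial.eval w P = 0) (z : ι → ℂ) :
    MvPolynomial.eval z P = 0 := by
  by_contra hz
  obtain ⟨w, hw, hwP⟩ := exists_eval_ne_zero ∅ (fun _ h => h.elim) hz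
  exact hwP (h w fun i => by simp [hw])

/-- Modulo `X i`, the polynomial `P` agrees with its restriction to `X i = 0`, and by hypothesis
this restriction vanishes at every point. -/
theorem exists_eq_X_mul {P : MvPolynomial ι ℂ} {i : ι}
    (h : ∀ z : ι → ℂ, z i = 0 → MvPolynomial.eval z P = 0) :
    ∃ Q : MvPolynomial ι ℂ, ∀ z, MvPolynomial.eval z P = z i * MvPolynomial.eval z Q := by
  classical
  set f : ι → MvPolynomial ι ℂ := fun j => if j = i then 0 else MvPolynomial.X j with hf
  have hdvd : P - MvPolynomial.bind₁ f P ∈ Ideal.span {(MvPolynomial.X i : MvPolynomial ι ℂ)} := by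
    rw [← Ideal.Quotient.eq]
    have : (Ideal.Quotient.mkₐ ℂ (Ideal.span {(MvPolynomial.X i : MvPolynomial ι ℂ)})) =
        (Ideal.Quotient.mkₐ ℂ (Ideal.span {(MvPolynomial.X i : MvPolynomial ι ℂ)})).comp
          (MvPolynomial.bind₁ f) := by
      refine MvPolynomial.algHom_ext fun j => ?_
      simp only [AlgHom.comp_apply, MvPolynomial.bind₁_X_right, hf]
      split_ifs with hj
      · subst hj
        rw [map_zero]
        exact Ideal.Quotient.eq_zero_iff_mem.2 (Ideal.mem_span_singleton_self _)
      · rfl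
    exact congrArg (fun φ => φ P) this
  obtain ⟨Q, hQ⟩ := Ideal.mem_span_singleton'.1 hdvd
  refine ⟨Q, fun z => ?_⟩
  have h0 : MvPolynomial.eval z (MvPolynomial.bind₁ f P) = 0 := by
    rw [← MvPolynomial.coe_aeval_eq_eval, RingHom.coe_coe, MvPolynomial.aeval_bind₁]
    refine h _ ?_
    simp [hf]
  have := congrArg (MvPolynomial.eval z) hQ
  rw [map_mul, map_sub, h0, sub_zero, MvPolynomial.eval_X, mul_comm] at this
  exact this.symm

end Polynomials

/-! ### Coordinates on the chart of a cone generated by a lattice basis. -/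

section Coordinates

variable {V : Type*} [AddCommGroup V] [Module ℝ V] {L : AddSubgroup V}
  {ι : Type*} {B : Module.Basis ι ℝ V} {η : PointedCone ℝ V}

/-- The cone `η` is generated by the lattice basis `B`. -/
structure IsBasisCone (L : AddSubgroup V) (B : Module.Basis ι ℝ V) (η : PointedCone ℝ V) : Prop
    extends IsLatticeBasis L B where
  eq_hull : η = PointedCone.hull ℝ (Set.range B)

namespace IsBasisCone

theorem basis_mem (hη : IsBasisCone L B η) (i : ι) : B i ∈ η := by
  rw [hη.eq_hull]
  exact PointedCone.subset_hull ⟨i, rfl⟩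

theorem floor_coord [DecidableEq ι] (i j : ι) : ⌊B.coord i (B j)⌋₊ = if j = i then 1 else 0 := by
  simp only [Module.Basis.coord_apply, Module.Basis.repr_self, Finsupp.single_apply]
  split_ifs <;> simp

variable [Fintype ι]

theorem mem_iff (hη : IsBasisCone L B η) {x : V} : x ∈ η ↔ ∀ i, 0 ≤ B.coord i x := by
  rw [hη.eq_hull, ← Set.image_univ, mem_hull_basis]
  simp

theorem coord_eq_zero_of_face (hη : IsBasisCone L B η) {τ : PointedCone ℝ V} (hτ : τ.IsFaceOf η)
    {u : V} (hu : u ∈ τ) {i : ι} (hi : B i ∉ τ) : B.coord i u = 0 := by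
  rw [hη.eq_hull, ← Set.image_univ] at hτ
  exact Toric.coord_eq_zero_of_face hτ hu hi

theorem mem_dualMonoid (hη : IsBasisCone L B η) {m : Module.Dual ℝ V} (hm : m ∈ dualLattice L)
    (h : ∀ i, 0 ≤ m (B i)) : m ∈ dualMonoid L η :=
  ⟨hm, fun u hu => by
    rw [apply_eq_sum_coord B]
    exact Finset.sum_nonneg fun i _ => mul_nonneg (hη.mem_iff.1 hu i) (h i)⟩

theorem coord_mem_dualMonoid (hη : IsBasisCone L B η) (i : ι) : B.coord i ∈ dualMonoid L η :=
  hη.mem_dualMonoid (hη.coord_mem i) fun j => coord_nonneg_basis B i j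

/-- The character of the `i`-th coordinate form. -/
noncomputable def coordChar (hη : IsBasisCone L B η) (i : ι) : dualMonoid L η :=
  ⟨B.coord i, hη.coord_mem_dualMonoid i⟩

/-- The point of `U_η` with coordinates `z`. -/
noncomputable def point (hη : IsBasisCone L B η) (z : ι → ℂ) : AffineToric L η :=
  mkPoint (fun m => ∏ i, z i ^ ⌊m.1 (B i)⌋₊) (by simp) fun m m' => by
    rw [← Finset.prod_mul_distrib]
    refine Finset.prod_congr rfl fun i _ => ?_
    rw [← pow_add, ← floor_add_apply m.2 m'.2 (hη.mem i) (hη.basis_mem i)]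
    rfl

theorem point_character (hη : IsBasisCone L B η) (z : ι → ℂ) (m : dualMonoid L η) :
    hη.point z (character L m) = ∏ i, z i ^ ⌊m.1 (B i)⌋₊ :=
  mkPoint_character _ _ _ m

@[simp] theorem point_coordChar (hη : IsBasisCone L B η) (z : ι → ℂ) (i : ι) :
    hη.point z (character L (hη.coordChar i)) = z i := by
  classical
  rw [point_character]
  simp only [coordChar, floor_coord, pow_ite, pow_one, pow_zero]
  simp

/-- The coordinates of a point of `U_η`. -/
noncomputable def coords (hη : IsBasisCone L B η) (γ : AffineToric L η) (i : ι) : ℂ :=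
  γ (character L (hη.coordChar i))

/-- The coordinate forms generate the dual monoid, with `m` equal to the sum of `m (B i)` times the
`i`-th form; hence the chart is an affine space. -/
theorem apply_character (hη : IsBasisCone L B η) (γ : AffineToric L η) (m : dualMonoid L η) :
    γ (character L m) = ∏ i, hη.coords γ i ^ ⌊m.1 (B i)⌋₊ := by
  have hm : m = ∑ i, ⌊m.1 (B i)⌋₊ • hη.coordChar i := by
    refine Subtype.ext (B.ext fun j => ?_)
    classical
    rw [AddSubmonoid.coe_finsetSum, LinearMap.sum_apply]
    have : ∀ i, (⌊m.1 (B i)⌋₊ • hη.coordChar i : dualMonoid L η).1 (B j) =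
        if j = i then m.1 (B i) else 0 := fun i => by
      change (⌊m.1 (B i)⌋₊ • B.coord i) (B j) = _
      rw [LinearMap.smul_apply, nsmul_eq_mul, cast_floor_apply m.2 (hη.mem _) (hη.basis_mem _),
        Module.Basis.coord_apply, Module.Basis.repr_self, Finsupp.single_apply, mul_ite, mul_one,
        mul_zero]
    simp only [this]
    simp
  have hsum : ∀ (s : Finset ι) (k : ι → ℕ), γ (character L (∑ i ∈ s, k i • hη.coordChar i)) =
      ∏ i ∈ s, hη.coords γ i ^ k i := by
    classical
    intro s k
    induction s using Finset.induction_on with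
    | empty => simp [character_zero]
    | insert i s hi ih =>
      rw [Finset.sum_insert hi, Finset.prod_insert hi, character_add, map_mul, ih, character_nsmul,
        map_pow]
      rfl
  conv_lhs => rw [hm]
  exact hsum _ _

theorem point_coords (hη : IsBasisCone L B η) (γ : AffineToric L η) :
    hη.point (hη.coords γ) = γ :=
  affineToric_ext fun m => by rw [point_character, hη.apply_character]

theorem coords_point (hη : IsBasisCone L B η) (z : ι → ℂ) : hη.coords (hη.point z) = z :=
  funext fun i => hη.point_coordChar z i

theorem point_character_ne_zero_iff (hη : IsBasisCone L B η) (z : ι → ℂ) (m : dualMonoid L η) :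
    hη.point z (character L m) ≠ 0 ↔ ∀ i, z i = 0 → m.1 (B i) = 0 := by
  rw [point_character, Finset.prod_ne_zero_iff]
  refine ⟨fun h i hi => ?_, fun h i _ => ?_⟩
  · have := h i (Finset.mem_univ i)
    rw [hi] at this
    rw [← floor_apply_eq_zero_iff m.2 (hη.mem i) (hη.basis_mem i)]
    by_contra h0
    exact this (zero_pow h0)
  · by_cases hi : z i = 0
    · rw [(floor_apply_eq_zero_iff m.2 (hη.mem i) (hη.basis_mem i)).2 (h i hi), pow_zero]
      exact one_ne_zero
    · exact pow_ne_zero _ hi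

theorem exists_mvPolynomial (hη : IsBasisCone L B η) (q : CoordRing L η) :
    ∃ P : MvPolynomial ι ℂ, ∀ z, hη.point z q = MvPolynomial.eval z P := by
  induction q using AddMonoidAlgebra.induction_linear with
  | zero => exact ⟨0, by simp⟩
  | add p q hp hq =>
    obtain ⟨P, hP⟩ := hp
    obtain ⟨Q, hQ⟩ := hq
    exact ⟨P + Q, fun z => by rw [map_add, map_add, hP, hQ]⟩
  | single m c =>
    refine ⟨MvPolynomial.C c * ∏ i, MvPolynomial.X i ^ ⌊m.1 (B i)⌋₊, fun z => ?_⟩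
    have : (AddMonoidAlgebra.single m c : CoordRing L η) = c • character L m := by
      simp [character]
    rw [this, map_smul, point_character, smul_eq_mul]
    simp

/-- The orbit closure of a face in the chart of a cone generated by a lattice basis is a coordinate
subspace. -/
theorem chart_mem_orbitClosure_iff {F : Set (PointedCone ℝ V)} (hF : IsRegularFan L F) {σ τ : F}
    (hσ : IsBasisCone L B σ.1) (h : τ.1 ≤ σ.1) (γ : AffineToric L σ.1) :
    chart L F σ γ ∈ orbitClosure L F τ.1 ↔ ∀ i, B i ∈ τ.1 → hσ.coords γ i = 0 := by
  constructor
  · intro hγ i hi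
    -- If the coordinate is nonzero, the open set where it does not vanish meets the orbit. There
    -- nonvanishing of the character makes `B.coord i` zero on `τ`, although its value at `B i ∈ τ`
    -- is `1`.
    by_contra hne
    obtain ⟨_, ⟨γ', hγ', rfl⟩, hδ⟩ := mem_orbitClosure_iff.1 hγ _
      ((hF.isOpenEmb_chart σ).zOpen_image _ (zOpen_ne_zero (character L (hσ.coordChar i))))
      ⟨γ, hne, rfl⟩
    obtain ⟨δ, rfl, hδ'⟩ := (hF.chart_mem_orbit_iff h).1 hδ
    rw [Set.mem_ofPred_eq, restrict_character] at hγ'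
    have := (hδ' _).1 hγ' (B i) hi
    simp [coordChar] at this
  · intro hγ
    refine mem_orbitClosure_iff.2 fun W hW hγW => ?_
    obtain ⟨q, hq, hqW⟩ := hW σ γ hγW
    obtain ⟨P, hP⟩ := hσ.exists_mvPolynomial q
    rw [← hσ.point_coords γ, hP] at hq
    -- Within the given principal neighbourhood, the point is moved to one whose vanishing
    -- coordinates are exactly those of `τ`. Such a point lies in the orbit.
    obtain ⟨w, hw, hwP⟩ := exists_eval_ne_zero {i | B i ∈ τ.1} hγ hq
    rw [← hP] at hwP
    refine ⟨_, hqW _ hwP, (hF.chart_mem_orbit_iff h).2 ?_⟩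
    obtain ⟨m, hm⟩ := hF.exists_cut σ.2 τ.2 h
    have hτ := hF.isFaceOf_of_le σ.2 τ.2 h
    obtain ⟨δ, hδ⟩ := hm.exists_restrict_eq h (hσ.point w)
      ((hσ.point_character_ne_zero_iff w _).2 fun i hi =>
        (hm.mem_iff _ (hσ.basis_mem i)).1 ((hw i).1 hi))
    refine ⟨δ, hδ, fun m' => ?_⟩
    -- A character of `U_τ` is tested after multiplication by a power of the invertible `χ^m`, which
    -- moves it into the coordinate ring of `U_σ`.
    obtain ⟨k, hk⟩ := hm.bound m'.1 m'.2
    have hpow := pow_ne_zero k (hm.apply_ne_zero h δ)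
    rw [← mul_ne_zero_iff_right hpow, hm.apply_mul_pow h δ m'.2 hk, hδ,
      hσ.point_character_ne_zero_iff]
    have hB : ∀ i, B i ∈ τ.1 → (m'.1 + k • m) (B i) = m'.1 (B i) := fun i hi => by
      rw [LinearMap.add_apply, LinearMap.smul_apply, (hm.mem_iff _ (hσ.basis_mem i)).1 hi, smul_zero,
        add_zero]
    constructor
    · intro h0 u hu
      rw [apply_eq_sum_coord B]
      refine Finset.sum_eq_zero fun i _ => ?_
      by_cases hi : B i ∈ τ.1
      · rw [← hB i hi, h0 i ((hw i).2 hi), mul_zero]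
      · rw [hσ.coord_eq_zero_of_face hτ hu hi, zero_mul]
    · intro h0 i hi
      rw [hB i ((hw i).1 hi), h0 _ ((hw i).1 hi)]

end IsBasisCone

end Coordinates

end Toric

namespace Toric

open SpaceWithFunctions

/-! ### The one-parameter subgroup of a lattice vector, including its limit at `t = 0`, on affine
charts. -/

section Scaling

variable {V : Type*} [AddCommGroup V] [Module ℝ V] {L : AddSubgroup V} {v : V}
  {σ τ : PointedCone ℝ V}

/-- The action of `t` by the one-parameter subgroup of `v`, extended to `t = 0`, on `U_σ` for a cone
`σ` that contains `v`. -/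
noncomputable def scale (hv : v ∈ L) (hσ : v ∈ σ) (t : ℂ) (γ : AffineToric L σ) : AffineToric L σ :=
  mkPoint (fun m => t ^ ⌊m.1 v⌋₊ * γ (character L m)) (by simp [character_zero]) fun m m' => by
    rw [character_add, map_mul, AddSubmonoid.coe_add, floor_add_apply m.2 m'.2 hv hσ, pow_add]
    ring

theorem scale_character (hv : v ∈ L) (hσ : v ∈ σ) (t : ℂ) (γ : AffineToric L σ)
    (m : dualMonoid L σ) :
    scale hv hσ t γ (character L m) = t ^ ⌊m.1 v⌋₊ * γ (character L m) :=
  mkPoint_character _ _ _ m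

theorem scale_one (hv : v ∈ L) (hσ : v ∈ σ) (γ : AffineToric L σ) : scale hv hσ 1 γ = γ :=
  affineToric_ext fun m => by rw [scale_character, one_pow, one_mul]

theorem restrict_scale (hv : v ∈ L) (h : τ ≤ σ) (hτ : v ∈ τ) (t : ℂ) (γ : AffineToric L τ) :
    restrict L h (scale hv hτ t γ) = scale hv (h hτ) t (restrict L h γ) :=
  affineToric_ext fun m => by
    rw [restrict_character, scale_character, scale_character, restrict_character]

theorem isMorphism_scale (hv : v ∈ L) (hσ : v ∈ σ) (t : ℂ) : IsMorphism (scale hv hσ t) := by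
  refine isMorphism_specm fun a => ?_
  induction a using AddMonoidAlgebra.induction_linear with
  | zero =>
    simp only [map_zero]
    exact zero_mem _
  | add p q hp hq =>
    simp only [map_add]
    exact add_mem hp hq
  | single m c =>
    have : (AddMonoidAlgebra.single m c : CoordRing L σ) = c • character L m := by
      simp [character]
    simp only [this, map_smul, scale_character]
    exact Subalgebra.smul_mem _ (Subalgebra.smul_mem _ (regular_eval _ _) (t ^ ⌊m.1 v⌋₊)) c

theorem continuous_scale (hv : v ∈ L) (hσ : v ∈ σ) :
    @Continuous (ℂ × AffineToric L σ) _
      (@instTopologicalSpaceProd _ _ _ (classicalTopology (AffineToric L σ)))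
      (classicalTopology (AffineToric L σ)) (fun p => scale hv hσ p.1 p.2) := by
  let _ : TopologicalSpace (AffineToric L σ) := classicalTopology (AffineToric L σ)
  refine continuous_specm fun a => ?_
  induction a using AddMonoidAlgebra.induction_linear with
  | zero =>
    simp only [map_zero]
    exact continuous_const
  | add p q hp hq =>
    simp only [map_add]
    exact hp.add hq
  | single m c =>
    have : (AddMonoidAlgebra.single m c : CoordRing L σ) = c • character L m := by
      simp [character]
    simp only [this, map_smul, scale_character]
    have hev : Continuous fun γ : AffineToric L σ => γ (character L m) :=
      continuous_of_regular (regular_eval _ _)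
    exact ((continuous_fst.pow _).mul (hev.comp continuous_snd)).const_smul c

end Scaling

/-! ### Star fans, the global scaling and the deformation retraction. -/

section StarFan

variable {V : Type*} [AddCommGroup V] [Module ℝ V] {L : AddSubgroup V} {v : V}
  {F : Set (PointedCone ℝ V)}

/-- The cone `η` is generated by the lattice basis `B`, one of whose members is `v`. -/
structure IsStarCone {k : ℕ} (L : AddSubgroup V) (v : V) (B : Module.Basis (Fin k) ℝ V) (i₀ : Fin k)
    (η : PointedCone ℝ V) : Prop extends IsBasisCone L B η where
  basis_eq : B i₀ = v

/-- A fan in which every cone is contained in a cone generated by a lattice basis containing `v`. -/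
structure IsStarFan (L : AddSubgroup V) (F : Set (PointedCone ℝ V)) (v : V) : Prop
    extends IsRegularFan L F where
  exists_starCone : ∀ σ ∈ F, ∃ η ∈ F, σ ≤ η ∧ ∃ (k : ℕ) (B : Module.Basis (Fin k) ℝ V) (i₀ : Fin k),
    IsStarCone L v B i₀ η

theorem IsBasisCone.hull_isFaceOf {ι : Type*} [Fintype ι] {B : Module.Basis ι ℝ V}
    {η : PointedCone ℝ V} (hη : IsBasisCone L B η) (s : Set ι) :
    (PointedCone.hull ℝ (B '' s)).IsFaceOf η := by
  refine ⟨fun x hx => hη.mem_iff.2 ((mem_hull_basis B s).1 hx).1, fun {x y a} hx hy ha h => ?_⟩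
  refine (mem_hull_basis B s).2 ⟨hη.mem_iff.1 hx, fun i hi => ?_⟩
  have h0 := ((mem_hull_basis B s).1 h).2 i hi
  rw [map_add, map_smul, smul_eq_mul] at h0
  have hx' := hη.mem_iff.1 hx i
  have hy' := hη.mem_iff.1 hy i
  have : a * B.coord i x = 0 := by linarith [mul_nonneg ha.le hx']
  exact (mul_eq_zero.1 this).resolve_left ha.ne'

theorem basis_mem_hull_iff {ι : Type*} [Fintype ι] {B : Module.Basis ι ℝ V} {s : Set ι} {i : ι} :
    B i ∈ PointedCone.hull ℝ (B '' s) ↔ i ∈ s := by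
  refine ⟨fun h => ?_, fun h => PointedCone.subset_hull ⟨i, h, rfl⟩⟩
  by_contra hi
  have := ((mem_hull_basis B s).1 h).2 i hi
  simp at this

namespace IsStarCone

variable {k : ℕ} {B : Module.Basis (Fin k) ℝ V} {i₀ : Fin k} {η : PointedCone ℝ V}

theorem vertex_mem (hη : IsStarCone L v B i₀ η) : v ∈ η := hη.basis_eq ▸ hη.basis_mem i₀

theorem vertex_mem_lattice (hη : IsStarCone L v B i₀ η) : v ∈ L := hη.basis_eq ▸ hη.mem i₀

theorem hull_eq (hη : IsStarCone L v B i₀ η) :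
    PointedCone.hull ℝ {v} = PointedCone.hull ℝ (B '' {i₀}) := by
  rw [Set.image_singleton, hη.basis_eq]

theorem hull_isFaceOf (hη : IsStarCone L v B i₀ η) : (PointedCone.hull ℝ {v}).IsFaceOf η := by
  rw [hη.hull_eq]
  exact hη.toIsBasisCone.hull_isFaceOf _

theorem coords_scale (hη : IsStarCone L v B i₀ η) (t : ℂ) (γ : AffineToric L η) (i : Fin k) :
    hη.coords (scale hη.vertex_mem_lattice hη.vertex_mem t γ) i =
      if i = i₀ then t * hη.coords γ i else hη.coords γ i := by
  rw [IsBasisCone.coords, scale_character]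
  have : ⌊(hη.coordChar i).1 v⌋₊ = if i₀ = i then 1 else 0 := by
    change ⌊B.coord i v⌋₊ = _
    rw [← hη.basis_eq]
    exact IsBasisCone.floor_coord i i₀
  rw [this]
  split_ifs with h1 h2 h2
  · simp [IsBasisCone.coords]
  · exact absurd h1.symm h2
  · exact absurd h2.symm h1
  · simp [IsBasisCone.coords]

end IsStarCone

namespace IsStarFan

theorem vertex_mem (hF : IsStarFan L F v) : v ∈ L := by
  obtain ⟨σ, hσ⟩ := hF.nonempty
  obtain ⟨_, _, _, _, _, _, hη⟩ := hF.exists_starCone σ hσ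
  exact hη.vertex_mem_lattice

theorem exists_star_chart (hF : IsStarFan L F v) (x : ToricVariety L F) :
    ∃ η : F, (∃ (k : ℕ) (B : Module.Basis (Fin k) ℝ V) (i₀ : Fin k), IsStarCone L v B i₀ η.1) ∧
      ∃ γ, chart L F η γ = x := by
  obtain ⟨σ, γ, rfl⟩ := exists_chart x
  obtain ⟨η, hη, hle, h⟩ := hF.exists_starCone σ.1 σ.2
  exact ⟨⟨η, hη⟩, h, restrict L hle γ, chart_restrict (σ := ⟨η, hη⟩) hle γ⟩

theorem exists_vertex_chart (hF : IsStarFan L F v) (x : ToricVariety L F) :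
    ∃ (η : F) (_ : v ∈ η.1) (γ : AffineToric L η.1), chart L F η γ = x := by
  obtain ⟨η, ⟨_, _, _, hη⟩, γ, h⟩ := hF.exists_star_chart x
  exact ⟨η, hη.vertex_mem, γ, h⟩

/-- The action of `t` by the one-parameter subgroup of `v`, extended to `t = 0`. -/
noncomputable def scaling (hF : IsStarFan L F v) (t : ℂ) (x : ToricVariety L F) :
    ToricVariety L F :=
  chart L F (hF.exists_vertex_chart x).choose
    (scale hF.vertex_mem (hF.exists_vertex_chart x).choose_spec.choose t
      (hF.exists_vertex_chart x).choose_spec.choose_spec.choose)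

theorem scaling_chart (hF : IsStarFan L F v) (t : ℂ) (σ : F) (hσ : v ∈ σ.1)
    (γ : AffineToric L σ.1) :
    hF.scaling t (chart L F σ γ) = chart L F σ (scale hF.vertex_mem hσ t γ) := by
  obtain ⟨α, h1, h2⟩ := hF.chart_eq_iff.1
    (hF.exists_vertex_chart (chart L F σ γ)).choose_spec.choose_spec.choose_spec
  have hv := (hF.exists_vertex_chart (chart L F σ γ)).choose_spec.choose
  refine hF.chart_eq_iff.2 ⟨scale hF.vertex_mem (Submodule.mem_inf.2 ⟨hv, hσ⟩) t α, ?_, ?_⟩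
  · rw [restrict_scale, h1]
  · rw [restrict_scale, h2]

theorem scaling_one (hF : IsStarFan L F v) (x : ToricVariety L F) : hF.scaling 1 x = x := by
  obtain ⟨σ, hσ, γ, rfl⟩ := hF.exists_vertex_chart x
  rw [hF.scaling_chart 1 σ hσ, scale_one]

theorem isMorphism_scaling (hF : IsStarFan L F v) (t : ℂ) : IsMorphism (hF.scaling t) := by
  refine isMorphism_of_cover (ι := {σ : F // v ∈ σ.1}) (c := fun σ => chart L F σ.1)
    (fun σ => hF.isOpenEmb_chart σ.1) (fun x => ?_) fun σ => ?_
  · obtain ⟨σ, hσ, γ, h⟩ := hF.exists_vertex_chart x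
    exact ⟨⟨σ, hσ⟩, γ, h⟩
  · have : hF.scaling t ∘ chart L F σ.1 = chart L F σ.1 ∘ scale hF.vertex_mem σ.2 t :=
      funext fun γ => hF.scaling_chart t σ.1 σ.2 γ
    rw [this]
    exact (isMorphism_chart σ.1).comp (isMorphism_scale _ _ _)

/-- The product of the identity with a chart is an open map, so continuity can be checked on `ℂ ×
U_σ`. -/
theorem continuous_scaling (hF : IsStarFan L F v) :
    @Continuous (ℂ × ToricVariety L F) _
      (@instTopologicalSpaceProd _ _ _ (classicalTopology (ToricVariety L F)))
      (classicalTopology (ToricVariety L F)) (fun p => hF.scaling p.1 p.2) := by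
  let _ : TopologicalSpace (ToricVariety L F) := classicalTopology (ToricVariety L F)
  refine continuous_iff_continuousAt.2 fun p => ?_
  obtain ⟨σ, hσ, γ, hγ⟩ := hF.exists_vertex_chart p.2
  let _ : TopologicalSpace (AffineToric L σ.1) := classicalTopology (AffineToric L σ.1)
  have hopen : IsOpenMap (Prod.map id (chart L F σ) : ℂ × AffineToric L σ.1 → _) :=
    IsOpenMap.id.prodMap (hF.isOpenEmb_chart σ).isOpenMap
  have hchart : Continuous (chart L F σ) := (isMorphism_chart σ).continuous
  have hcomp : Continuous ((fun p : ℂ × ToricVariety L F => hF.scaling p.1 p.2) ∘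
      (Prod.map id (chart L F σ) : ℂ × AffineToric L σ.1 → _)) := by
    have : ((fun p : ℂ × ToricVariety L F => hF.scaling p.1 p.2) ∘
        (Prod.map id (chart L F σ) : ℂ × AffineToric L σ.1 → _)) =
        fun q => chart L F σ (scale hF.vertex_mem hσ q.1 q.2) :=
      funext fun q => hF.scaling_chart q.1 σ hσ q.2
    rw [this]
    exact hchart.comp (continuous_scale _ _)
  have hp : p = Prod.map id (chart L F σ) (p.1, γ) := Prod.ext rfl hγ.symm
  rw [hp]
  intro s hs
  have := hopen.image_mem_nhds (hcomp.continuousAt (x := (p.1, γ)) hs)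
  exact Filter.mem_map.2 (Filter.mem_of_superset this (Set.image_subset_iff.2 fun _ h => h))

theorem ray_mem (hF : IsStarFan L F v) : PointedCone.hull ℝ {v} ∈ F := by
  obtain ⟨σ, hσ⟩ := hF.nonempty
  obtain ⟨η, hη, _, _, _, _, h⟩ := hF.exists_starCone σ hσ
  exact hF.face_mem η hη _ h.hull_isFaceOf

theorem chart_mem_divisor_iff (hF : IsStarFan L F v) {η : F} {k : ℕ}
    {B : Module.Basis (Fin k) ℝ V} {i₀ : Fin k} (hη : IsStarCone L v B i₀ η.1)
    (γ : AffineToric L η.1) :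
    chart L F η γ ∈ orbitClosure L F (PointedCone.hull ℝ {v}) ↔ hη.coords γ i₀ = 0 := by
  rw [IsBasisCone.chart_mem_orbitClosure_iff hF.toIsRegularFan (τ := ⟨_, hF.ray_mem⟩)
    hη.toIsBasisCone hη.hull_isFaceOf.le]
  simp only [hη.hull_eq, basis_mem_hull_iff, Set.mem_singleton_iff, forall_eq]

theorem scaling_zero_mem (hF : IsStarFan L F v) (x : ToricVariety L F) :
    hF.scaling 0 x ∈ orbitClosure L F (PointedCone.hull ℝ {v}) := by
  obtain ⟨η, ⟨k, B, i₀, hη⟩, γ, rfl⟩ := hF.exists_star_chart x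
  rw [hF.scaling_chart 0 η hη.vertex_mem, hF.chart_mem_divisor_iff hη, hη.coords_scale]
  simp

theorem scaling_of_mem (hF : IsStarFan L F v) (t : ℂ) {x : ToricVariety L F}
    (hx : x ∈ orbitClosure L F (PointedCone.hull ℝ {v})) : hF.scaling t x = x := by
  obtain ⟨η, ⟨k, B, i₀, hη⟩, γ, rfl⟩ := hF.exists_star_chart x
  rw [hF.chart_mem_divisor_iff hη] at hx
  rw [hF.scaling_chart t η hη.vertex_mem]
  congr 1
  rw [← hη.point_coords (scale _ _ t γ), ← hη.point_coords γ]
  congr 1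
  ext i
  rw [hη.point_coords γ, hη.coords_scale]
  split_ifs with h
  · rw [h, hx, mul_zero]
  · rfl

/-- The homotopy is `scaling (1 - t)`, from the identity to `scaling 0`. Points of the divisor have
zero coordinate along `v` and are fixed throughout. -/
theorem isStrongDeformationRetract (hF : IsStarFan L F v) :
    @IsStrongDeformationRetract (ToricVariety L F) (classicalTopology _)
      (orbitClosure L F (PointedCone.hull ℝ {v})) := by
  let _ : TopologicalSpace (ToricVariety L F) := classicalTopology (ToricVariety L F)
  have hc : Continuous fun p : ℂ × ToricVariety L F => hF.scaling p.1 p.2 := hF.continuous_scaling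
  refine ⟨⟨hF.scaling 0, hc.comp (Continuous.prodMk_right 0)⟩, hF.scaling_zero_mem, ⟨⟨⟨⟨
    fun p => hF.scaling (1 - (p.1 : ℝ)) p.2, ?_⟩, fun x => ?_, fun x => ?_⟩, fun t x hx => ?_⟩⟩⟩
  · exact hc.comp ((continuous_const.sub (Complex.continuous_ofReal.comp
      (continuous_subtype_val.comp continuous_fst))).prodMk continuous_snd)
  · simp [hF.scaling_one]
  · simp
  · exact hF.scaling_of_mem _ hx

end IsStarFan

end StarFan

end Toric

namespace SpaceWithFunctions

/-! ### Gluing regular functions and pulling them back along sections. -/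

section Extension

open Classical in
/-- The pullback of a function along a section over `U`, extended by zero. -/
noncomputable def pullSection {Y T : Type*} {U : Set Y} (s : U → T) (f : T → ℂ) (e : Y) : ℂ :=
  if h : e ∈ U then f (s ⟨e, h⟩) else 0

theorem pullSection_of_mem {Y T : Type*} {U : Set Y} (s : U → T) (f : T → ℂ) {e : Y} (h : e ∈ U) :
    pullSection s f e = f (s ⟨e, h⟩) := dif_pos h

variable {X Y T ι : Type*} [SpaceWithFunctions X] [SpaceWithFunctions Y] [SpaceWithFunctions T]

theorem regular_eval_mvPolynomial {U : Set Y} {f : ι → Y → ℂ} (hf : ∀ i, f i ∈ regular U)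
    (P : MvPolynomial ι ℂ) : (fun y => MvPolynomial.eval (fun i => f i y) P) ∈ regular U := by
  induction P using MvPolynomial.induction_on with
  | C c =>
    simp only [MvPolynomial.eval_C]
    exact (regular U).algebraMap_mem c
  | add p q hp hq =>
    simp only [map_add]
    exact add_mem hp hq
  | mul_X p i hp =>
    simp only [map_mul, MvPolynomial.eval_X]
    exact mul_mem hp (hf i)

/-- Local regular functions that agree on overlaps glue. -/
theorem exists_regular_of_local {W : Set X} (R : Set X → (X → ℂ) → Prop)
    (hex : ∀ x ∈ W, ∃ W' ⊆ W, ZOpen W' ∧ x ∈ W' ∧ ∃ q ∈ regular W', R W' q)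
    (huniq : ∀ W₁ ⊆ W, ∀ W₂ ⊆ W, ZOpen W₁ → ZOpen W₂ → ∀ q₁ ∈ regular W₁, ∀ q₂ ∈ regular W₂,
      R W₁ q₁ → R W₂ q₂ → Set.EqOn q₁ q₂ (W₁ ∩ W₂)) :
    ∃ q ∈ regular W, ∀ x ∈ W, ∃ W' ⊆ W, ZOpen W' ∧ x ∈ W' ∧ ∃ q' ∈ regular W', R W' q' ∧
      Set.EqOn q q' W' := by
  classical
  choose! N hNW hN hxN q hq hR using hex
  have heq : ∀ x ∈ W, Set.EqOn (fun y => q y y) (q x) (N x) := fun x hx y hy =>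
    huniq _ (hNW y (hNW x hx hy)) _ (hNW x hx) (hN y (hNW x hx hy)) (hN x hx) _
      (hq y (hNW x hx hy)) _ (hq x hx) (hR y (hNW x hx hy)) (hR x hx) ⟨hxN y (hNW x hx hy), hy⟩
  exact ⟨fun x => q x x,
    regular_of_local fun x hx => ⟨N x, hN x hx, hxN x hx, q x, hq x hx, fun y hy => heq x hx hy.2⟩,
    fun x hx => ⟨N x, hNW x hx, hN x hx, hxN x hx, q x, hq x hx, hR x hx, heq x hx⟩⟩

theorem regular_pullSection {U : Set Y} (hU : ZOpen U) {s : U → T} (hs : IsMorphism s) {W : Set T}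
    (hW : ZOpen W) {f : T → ℂ} (hf : f ∈ regular W) :
    pullSection s f ∈ regular (Subtype.val '' (s ⁻¹' W)) := by
  refine (isOpenEmb_val hU).regular_image _ (hs W hW).1 _ ?_
  convert! (hs W hW).2 f hf using 1
  ext e
  exact pullSection_of_mem s f e.2

end Extension

end SpaceWithFunctions

namespace Toric

open SpaceWithFunctions

/-! ### The projection to the divisor, and coordinates and local equations on it. -/

section StarCoordinates

variable {V : Type*} [AddCommGroup V] [Module ℝ V] {L : AddSubgroup V} {v : V}
  {F : Set (PointedCone ℝ V)} {k : ℕ} {B : Module.Basis (Fin k) ℝ V} {i₀ : Fin k} {η : F}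

/-- The divisor of the ray spanned by `v`. -/
abbrev Divisor (L : AddSubgroup V) (F : Set (PointedCone ℝ V)) (v : V) : Set (ToricVariety L F) :=
  orbitClosure L F (PointedCone.hull ℝ {v})

/-- The part of the divisor of `v` in the chart of `η`. -/
def patch (L : AddSubgroup V) (v : V) (η : F) : Set (Divisor L F v) :=
  {e | e.1 ∈ Set.range (chart L F η)}

namespace IsStarFan

/-- The projection to the divisor of `v`. -/
noncomputable def proj (hF : IsStarFan L F v) (x : ToricVariety L F) : Divisor L F v :=
  ⟨hF.scaling 0 x, hF.scaling_zero_mem x⟩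

theorem isMorphism_proj (hF : IsStarFan L F v) : IsMorphism hF.proj :=
  isMorphism_codRestrict (hF.isMorphism_scaling 0) hF.scaling_zero_mem

theorem proj_val (hF : IsStarFan L F v) (e : Divisor L F v) : hF.proj e.1 = e :=
  Subtype.ext (hF.scaling_of_mem 0 e.2)

theorem zOpen_patch (hF : IsStarFan L F v) (η : F) : ZOpen (patch L v η) :=
  (isMorphism_val _ _ (hF.isOpenEmb_chart η).zOpen_range).1

/-- This makes the chart of `η` the full preimage of its part of the divisor: a point whose limit
under scaling lies in `U_η` was in `U_η` already. -/
theorem proj_mem_patch_iff (hF : IsStarFan L F v) (hη : v ∈ η.1) {x : ToricVariety L F} :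
    hF.proj x ∈ patch L v η ↔ x ∈ Set.range (chart L F η) := by
  constructor
  · rintro ⟨γ, hγ⟩
    obtain ⟨τ, hτ, δ, rfl⟩ := hF.exists_vertex_chart x
    change chart L F η γ = hF.scaling 0 (chart L F τ δ) at hγ
    rw [hF.scaling_chart 0 τ hτ] at hγ
    obtain ⟨α, -, hα⟩ := hF.chart_eq_iff.1 hγ
    obtain ⟨m, hm⟩ := hF.exists_cut τ.2 (hF.inf_mem η.2 τ.2) inf_le_right
    -- The character cutting out `η ∩ τ` is nonzero at the limit point, where its value is `0 ^
    -- m(v)` times its value at `δ`; hence it is nonzero at `δ`.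
    have h0 := hm.restrict_ne_zero inf_le_right α
    rw [hα, scale_character] at h0
    obtain ⟨β, rfl⟩ := hm.exists_restrict_eq inf_le_right δ (right_ne_zero_of_mul h0)
    exact ⟨restrict L inf_le_left β, hF.chart_eq_iff.2 ⟨β, rfl, rfl⟩⟩
  · rintro ⟨γ, rfl⟩
    exact ⟨_, (hF.scaling_chart 0 η hη γ).symm⟩

end IsStarFan

namespace IsStarCone

/-- The point with coordinates `z` in the chart of `η`. -/
noncomputable def starPoint (hη : IsStarCone L v B i₀ η.1) (z : Fin k → ℂ) : ToricVariety L F :=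
  chart L F η (hη.point z)

/-- The `i`-th coordinate function of the chart of `η`. -/
noncomputable def coordFun (hη : IsStarCone L v B i₀ η.1) (i : Fin k) : ToricVariety L F → ℂ :=
  Function.extend (chart L F η) (fun γ => hη.coords γ i) 0

/-- The coordinates, in the chart of `η`, of a point of the divisor of `v`. -/
noncomputable def divCoord (hη : IsStarCone L v B i₀ η.1) (i : Fin k) (e : Divisor L F v) : ℂ :=
  hη.coordFun i e.1

theorem exists_starPoint (hη : IsStarCone L v B i₀ η.1) {x : ToricVariety L F}
    (hx : x ∈ Set.range (chart L F η)) : ∃ z, hη.starPoint z = x := by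
  obtain ⟨γ, rfl⟩ := hx
  exact ⟨hη.coords γ, by rw [starPoint, hη.point_coords]⟩

theorem starPoint_mem_range (hη : IsStarCone L v B i₀ η.1) (z : Fin k → ℂ) :
    hη.starPoint z ∈ Set.range (chart L F η) := ⟨_, rfl⟩

theorem coordFun_chart (hF : IsStarFan L F v) (hη : IsStarCone L v B i₀ η.1) (i : Fin k)
    (γ : AffineToric L η.1) : hη.coordFun i (chart L F η γ) = hη.coords γ i :=
  (hF.chart_injective η).extend_apply _ _ γ

theorem coordFun_starPoint (hF : IsStarFan L F v) (hη : IsStarCone L v B i₀ η.1) (z : Fin k → ℂ)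
    (i : Fin k) : hη.coordFun i (hη.starPoint z) = z i := by
  rw [starPoint, hη.coordFun_chart hF, hη.coords_point]

theorem starPoint_coordFun (hF : IsStarFan L F v) (hη : IsStarCone L v B i₀ η.1)
    {x : ToricVariety L F} (hx : x ∈ Set.range (chart L F η)) :
    hη.starPoint (fun i => hη.coordFun i x) = x := by
  obtain ⟨z, rfl⟩ := hη.exists_starPoint hx
  simp only [hη.coordFun_starPoint hF]

theorem regular_coordFun (hF : IsStarFan L F v) (hη : IsStarCone L v B i₀ η.1) (i : Fin k) :
    hη.coordFun i ∈ regular (Set.range (chart L F η)) := by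
  rw [← Set.image_univ]
  refine (hF.isOpenEmb_chart η).regular_image _ zOpen_univ _ ?_
  rw [coordFun, Function.extend_comp (hF.chart_injective η)]
  exact regular_eval _ _

theorem regular_divCoord (hF : IsStarFan L F v) (hη : IsStarCone L v B i₀ η.1) (i : Fin k) :
    hη.divCoord i ∈ regular (patch L v η) :=
  regular_restrict (hF.isOpenEmb_chart η).zOpen_range (hη.regular_coordFun hF i) fun _ h => h

theorem scaling_starPoint (hF : IsStarFan L F v) (hη : IsStarCone L v B i₀ η.1) (t : ℂ)
    (z : Fin k → ℂ) :
    hF.scaling t (hη.starPoint z) = hη.starPoint (Function.update z i₀ (t * z i₀)) := by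
  rw [starPoint, hF.scaling_chart t η hη.vertex_mem, starPoint]
  congr 1
  rw [← hη.point_coords (scale _ _ t _)]
  congr 1
  ext i
  rw [hη.coords_scale, hη.coords_point]
  by_cases h : i = i₀
  · subst h
    simp
  · simp [h]

/-- The point of the divisor of `v` with coordinates `z` in the chart of `η`; the coordinate of `v`
is ignored. -/
noncomputable def divPoint (hF : IsStarFan L F v) (hη : IsStarCone L v B i₀ η.1) (z : Fin k → ℂ) :
    Divisor L F v :=
  hF.proj (hη.starPoint z)

theorem divPoint_val (hF : IsStarFan L F v) (hη : IsStarCone L v B i₀ η.1) (z : Fin k → ℂ) :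
    (hη.divPoint hF z).1 = hη.starPoint (Function.update z i₀ 0) := by
  have := hη.scaling_starPoint hF 0 z
  rwa [zero_mul] at this

theorem divPoint_mem_patch (hF : IsStarFan L F v) (hη : IsStarCone L v B i₀ η.1)
    (z : Fin k → ℂ) : hη.divPoint hF z ∈ patch L v η :=
  (hF.proj_mem_patch_iff hη.vertex_mem).2 (hη.starPoint_mem_range z)

theorem divCoord_divPoint (hF : IsStarFan L F v) (hη : IsStarCone L v B i₀ η.1) (z : Fin k → ℂ)
    (i : Fin k) : hη.divCoord i (hη.divPoint hF z) = Function.update z i₀ 0 i := by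
  rw [divCoord, divPoint_val, coordFun_starPoint hF]

theorem divCoord_divPoint_of_ne (hF : IsStarFan L F v) (hη : IsStarCone L v B i₀ η.1)
    (z : Fin k → ℂ) {i : Fin k} (hi : i ≠ i₀) : hη.divCoord i (hη.divPoint hF z) = z i := by
  rw [divCoord_divPoint, Function.update_of_ne hi]

theorem divPoint_divCoord (hF : IsStarFan L F v) (hη : IsStarCone L v B i₀ η.1)
    {e : Divisor L F v} (he : e ∈ patch L v η) : hη.divPoint hF (fun i => hη.divCoord i e) = e := by
  rw [divPoint]
  simp only [divCoord]
  rw [hη.starPoint_coordFun hF he, hF.proj_val]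

theorem coordFun_eq_divCoord_proj (hF : IsStarFan L F v) (hη : IsStarCone L v B i₀ η.1)
    {x : ToricVariety L F} (hx : x ∈ Set.range (chart L F η)) {i : Fin k} (hi : i ≠ i₀) :
    hη.divCoord i (hF.proj x) = hη.coordFun i x := by
  obtain ⟨z, rfl⟩ := hη.exists_starPoint hx
  rw [hη.coordFun_starPoint hF]
  exact hη.divCoord_divPoint_of_ne hF z hi

theorem isMorphism_divPoint (hF : IsStarFan L F v) (hη : IsStarCone L v B i₀ η.1) :
    IsMorphism (fun γ : Specm (MvPolynomial (Fin k) ℂ) =>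
      hη.divPoint hF fun i => γ (MvPolynomial.X i)) := by
  refine hF.isMorphism_proj.comp ((isMorphism_chart η).comp
    (f := fun γ : Specm (MvPolynomial (Fin k) ℂ) => hη.point fun i => γ (MvPolynomial.X i))
    (isMorphism_specm fun a => ?_))
  obtain ⟨P, hP⟩ := hη.exists_mvPolynomial a
  simp only [hP]
  exact regular_eval_mvPolynomial (fun i => regular_eval _ _) P

/-- Regular functions on the divisor of `v` are locally fractions of polynomials. -/
theorem exists_fraction (hF : IsStarFan L F v) (hη : IsStarCone L v B i₀ η.1)
    {W : Set (Divisor L F v)} (hW : ZOpen W) {f : Divisor L F v → ℂ} (hf : f ∈ regular W)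
    {z : Fin k → ℂ} (hz : hη.divPoint hF z ∈ W) :
    ∃ P Q : MvPolynomial (Fin k) ℂ, MvPolynomial.eval z Q ≠ 0 ∧
      ∀ w, MvPolynomial.eval w Q ≠ 0 → hη.divPoint hF w ∈ W ∧
        f (hη.divPoint hF w) = MvPolynomial.eval w P / MvPolynomial.eval w Q := by
  -- The function is pulled back along the parametrization of the patch by affine space, where
  -- regular functions are local fractions by definition.
  have hmor := hη.isMorphism_divPoint hF W hW
  have haeval : ∀ w : Fin k → ℂ, (fun i => (MvPolynomial.aeval w : MvPolynomial (Fin k) ℂ →ₐ[ℂ] ℂ)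
      (MvPolynomial.X i)) = w := fun w => by simp
  have hmem : ∀ w : Fin k → ℂ, hη.divPoint hF w ∈ W ↔ (MvPolynomial.aeval w : Specm _) ∈
      (fun γ : Specm (MvPolynomial (Fin k) ℂ) => hη.divPoint hF fun i => γ (MvPolynomial.X i)) ⁻¹' W :=
    fun w => by rw [Set.mem_preimage, haeval]
  obtain ⟨r, hr, hrW⟩ := hmor.1 _ ((hmem z).1 hz)
  obtain ⟨p, q, hq, hpq⟩ := hmor.2 f hf _ ((hmem z).1 hz)
  have hev : ∀ (w : Fin k → ℂ) (P : MvPolynomial (Fin k) ℂ),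
      (MvPolynomial.aeval w : Specm (MvPolynomial (Fin k) ℂ)) P = MvPolynomial.eval w P :=
    fun w P => by rw [← MvPolynomial.coe_aeval_eq_eval]; rfl
  rw [hev] at hr hq
  refine ⟨p * r, q * r, by rw [map_mul]; exact mul_ne_zero hq hr, fun w hw => ?_⟩
  rw [map_mul] at hw
  have hwW := hrW (MvPolynomial.aeval w) (by rw [hev]; exact right_ne_zero_of_mul hw)
  have := hpq _ hwW (by rw [hev]; exact left_ne_zero_of_mul hw)
  simp only [Function.comp_apply, hev, MvPolynomial.eval_X] at this
  refine ⟨(hmem w).2 hwW, ?_⟩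
  rw [this, map_mul, map_mul, mul_div_mul_right _ _ (right_ne_zero_of_mul hw)]

/-- A regular function on the divisor of `v` that vanishes at the points of the torus vanishes. -/
theorem eq_zero_of_torus (hF : IsStarFan L F v) (hη : IsStarCone L v B i₀ η.1)
    {W : Set (Divisor L F v)} (hW : ZOpen W) (hWη : W ⊆ patch L v η) {f : Divisor L F v → ℂ}
    (hf : f ∈ regular W) (h0 : ∀ e ∈ W, (∀ i ≠ i₀, hη.divCoord i e ≠ 0) → f e = 0) :
    ∀ e ∈ W, f e = 0 := by
  intro e he
  have hpt := hη.divPoint_divCoord hF (hWη he)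
  rw [← hpt] at he ⊢
  obtain ⟨P, Q, hQ, hPQ⟩ := hη.exists_fraction hF hW hf he
  -- The fraction represents `f` only where `Q` is nonzero, so it is `P * Q`, rather than `P`, that
  -- is known to vanish on the whole torus.
  have hzero := eval_eq_zero_of_forall_ne_zero (P := P * Q) (fun w hw => ?_)
    fun i => hη.divCoord i e
  · rw [map_mul] at hzero
    rw [(hPQ _ hQ).2, (mul_eq_zero.1 hzero).resolve_right hQ, zero_div]
  · rw [map_mul]
    by_cases hQw : MvPolynomial.eval w Q = 0
    · rw [hQw, mul_zero]
    · have h1 := h0 _ (hPQ w hQw).1 fun i hi => by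
        rw [hη.divCoord_divPoint_of_ne hF w hi]
        exact hw i
      rw [(hPQ w hQw).2, div_eq_zero_iff] at h1
      rw [h1.resolve_right hQw, zero_mul]

theorem eqOn_of_torus (hF : IsStarFan L F v) (hη : IsStarCone L v B i₀ η.1)
    {W : Set (Divisor L F v)} (hW : ZOpen W) (hWη : W ⊆ patch L v η) {f g : Divisor L F v → ℂ}
    (hf : f ∈ regular W) (hg : g ∈ regular W)
    (h0 : ∀ e ∈ W, (∀ i ≠ i₀, hη.divCoord i e ≠ 0) → f e = g e) : Set.EqOn f g W := fun e he =>
  sub_eq_zero.1 (hη.eq_zero_of_torus hF hW hWη (sub_mem hf hg)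
    (fun e he h => sub_eq_zero.2 (h0 e he h)) e he)

/-- The coordinate hyperplanes have the coordinates as local equations. -/
theorem isLocalEquation_divCoord (hF : IsStarFan L F v) (hη : IsStarCone L v B i₀ η.1)
    {W : Set (Divisor L F v)} (hW : W ⊆ patch L v η) {i : Fin k} (hi : i ≠ i₀)
    {Z : Set (Divisor L F v)} (hZ : ∀ e ∈ patch L v η, e ∈ Z ↔ hη.divCoord i e = 0) :
    IsLocalEquation W Z (hη.divCoord i) := by
  refine ⟨regular_mono hW (hη.regular_divCoord hF i), fun e he => (hZ e (hW he.1)).1 he.2,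
    fun W' hW' hW'o f hf hfZ => ?_⟩
  have hW'η := hW'.trans hW
  -- The quotient of `f` by the coordinate is constructed locally; local quotients agree on overlaps
  -- because they agree on the dense torus, where the coordinate can be cancelled.
  suffices H : ∃ q ∈ regular W', ∀ x ∈ W', ∃ N ⊆ W', ZOpen N ∧ x ∈ N ∧ ∃ q' ∈ regular N,
      (∀ e ∈ N, f e = q' e * hη.divCoord i e) ∧ Set.EqOn q q' N by
    obtain ⟨q, hq, hq'⟩ := H
    refine ⟨q, hq, fun e he => ?_⟩
    obtain ⟨N, hN, -, heN, q', -, hR, heq⟩ := hq' e he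
    rw [heq heN, hR e heN]
  refine exists_regular_of_local (W := W')
    (fun N q => ∀ e ∈ N, f e = q e * hη.divCoord i e) (fun e he => ?_)
    fun W₁ h₁ W₂ h₂ ho₁ ho₂ q₁ hq₁ q₂ hq₂ hR₁ hR₂ => ?_
  · have hpt := hη.divPoint_divCoord hF (hW'η he)
    obtain ⟨P, Q, hQ, hPQ⟩ := hη.exists_fraction hF hW'o hf (hpt.symm ▸ he)
    -- From `P * Q = X i * R` and `f = P / Q = P * Q / Q ^ 2`, the local quotient is `R / Q ^ 2`.
    obtain ⟨R, hR⟩ := exists_eq_X_mul (P := P * Q) (i := i) fun z hz => by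
      rw [map_mul]
      by_cases hQz : MvPolynomial.eval z Q = 0
      · rw [hQz, mul_zero]
      · have h1 := hfZ _ ⟨(hPQ z hQz).1, (hZ _ (hη.divPoint_mem_patch hF z)).2 (by
          rw [hη.divCoord_divPoint_of_ne hF z hi, hz])⟩
        rw [(hPQ z hQz).2, div_eq_zero_iff] at h1
        rw [h1.resolve_right hQz, zero_mul]
    have hreg : ∀ S : MvPolynomial (Fin k) ℂ,
        (fun e => MvPolynomial.eval (fun i => hη.divCoord i e) S) ∈ regular W' := fun S =>
      regular_eval_mvPolynomial (fun i => regular_mono hW'η (hη.regular_divCoord hF i)) S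
    have hopen := (regular_inv hW'o (hreg Q)).1
    refine ⟨_, fun e' he' => he'.1, hopen, ⟨he, hQ⟩,
      (fun e => MvPolynomial.eval (fun i => hη.divCoord i e) R) *
        ((fun e => MvPolynomial.eval (fun i => hη.divCoord i e) Q)⁻¹ ^ 2),
      mul_mem (regular_mono (fun e' he' => he'.1) (hreg R))
        (pow_mem (regular_inv hW'o (hreg Q)).2 2), fun e' he' => ?_⟩
    have h2 := (hPQ _ he'.2).2
    rw [hη.divPoint_divCoord hF (hW'η he'.1)] at h2
    have h3 := hR fun i => hη.divCoord i e'
    rw [map_mul] at h3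
    have hQ' := he'.2
    simp only [Pi.mul_apply, Pi.pow_apply, Pi.inv_apply]
    rw [h2]
    field_simp
    rw [h3]
    ring
  · refine hη.eqOn_of_torus hF (ho₁.inter ho₂) (Set.inter_subset_left.trans (h₁.trans hW'η))
      (regular_mono Set.inter_subset_left hq₁) (regular_mono Set.inter_subset_right hq₂)
      fun e he hne => mul_right_cancel₀ (hne i hi) ?_
    rw [← hR₁ e he.1, ← hR₂ e he.2]

end IsStarCone

end StarCoordinates

end Toric

namespace Toric

open SpaceWithFunctions

/-! ### Trivializations, transition functions and the line bundle atlas. -/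

section LineBundle

variable {V : Type*} [AddCommGroup V] [Module ℝ V] {L : AddSubgroup V} {v : V}
  {F : Set (PointedCone ℝ V)} {k : ℕ} {B : Module.Basis (Fin k) ℝ V} {i₀ : Fin k} {η : F}

namespace IsStarCone

/-- The point over `e` with fibre coordinate `c` in the chart of `η`. -/
noncomputable def lift (hη : IsStarCone L v B i₀ η.1) (e : Divisor L F v) (c : ℂ) :
    ToricVariety L F :=
  hη.starPoint (Function.update (fun i => hη.divCoord i e) i₀ c)

theorem proj_lift (hF : IsStarFan L F v) (hη : IsStarCone L v B i₀ η.1) {e : Divisor L F v}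
    (he : e ∈ patch L v η) (c : ℂ) : hF.proj (hη.lift e c) = e := by
  refine Subtype.ext ?_
  conv_rhs => rw [← hη.divPoint_divCoord hF he]
  rw [divPoint_val]
  refine (hη.scaling_starPoint hF 0 _).trans ?_
  rw [zero_mul, Function.update_idem]

theorem coordFun_lift (hF : IsStarFan L F v) (hη : IsStarCone L v B i₀ η.1) (e : Divisor L F v)
    (c : ℂ) : hη.coordFun i₀ (hη.lift e c) = c := by
  rw [lift, hη.coordFun_starPoint hF, Function.update_self]

theorem lift_proj (hF : IsStarFan L F v) (hη : IsStarCone L v B i₀ η.1) {x : ToricVariety L F}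
    (hx : x ∈ Set.range (chart L F η)) : hη.lift (hF.proj x) (hη.coordFun i₀ x) = x := by
  conv_rhs => rw [← hη.starPoint_coordFun hF hx]
  rw [lift]
  congr 1
  ext i
  by_cases hi : i = i₀
  · subst hi
    rw [Function.update_self]
  · rw [Function.update_of_ne hi, hη.coordFun_eq_divCoord_proj hF hx hi]

theorem isMorphism_lift (hF : IsStarFan L F v) (hη : IsStarCone L v B i₀ η.1) :
    IsMorphism (fun p : patch L v η × ℂ => hη.lift p.1.1 p.2) := by
  refine (isMorphism_chart η).comp
    (f := fun p : patch L v η × ℂ =>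
      hη.point (Function.update (fun i => hη.divCoord i p.1.1) i₀ p.2))
    (isMorphism_specm fun a => ?_)
  obtain ⟨P, hP⟩ := hη.exists_mvPolynomial a
  simp only [hP]
  refine regular_eval_mvPolynomial
    (f := fun i (p : patch L v η × ℂ) => Function.update (fun i => hη.divCoord i p.1.1) i₀ p.2 i)
    (fun i => ?_) P
  by_cases hi : i = i₀
  · subst hi
    simp only [Function.update_self]
    exact regular_snd _
  · simp only [Function.update_of_ne hi]
    have h1 : (fun e : patch L v η => hη.divCoord i e.1) ∈ regular (Set.univ : Set (patch L v η)) :=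
      regular_restrict (hF.zOpen_patch η) (hη.regular_divCoord hF i) fun e _ => e.2
    exact (isMorphism_fst _ zOpen_univ).2 _ h1

/-- The inverse of `(π, x_v)` is `lift`, which fills the coordinate along `v` with the given scalar.
-/
theorem isTrivialization (hF : IsStarFan L F v) (hη : IsStarCone L v B i₀ η.1) :
    IsTrivialization hF.proj (patch L v η) (hη.coordFun i₀) := by
  have hmem : ∀ x : hF.proj ⁻¹' patch L v η, x.1 ∈ Set.range (chart L F η) := fun x =>
    (hF.proj_mem_patch_iff hη.vertex_mem).1 x.2
  have hproj : ∀ p : patch L v η × ℂ, hF.proj (hη.lift p.1.1 p.2) = p.1.1 := fun p =>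
    hη.proj_lift hF p.1.2 p.2
  have hmem' : ∀ p : patch L v η × ℂ, hη.lift p.1.1 p.2 ∈ hF.proj ⁻¹' patch L v η := fun p => by
    rw [Set.mem_preimage, hproj]
    exact p.1.2
  refine ⟨hF.zOpen_patch η, isMorphism_prodMk
    (isMorphism_codRestrict (hF.isMorphism_proj.comp (isMorphism_val _)) fun x => x.2)
    (regular_restrict (hF.isOpenEmb_chart η).zOpen_range (hη.regular_coordFun hF i₀)
      fun x _ => hmem x),
    fun p => ⟨hη.lift p.1.1 p.2, hmem' p⟩,
    isMorphism_codRestrict (hη.isMorphism_lift hF) hmem', fun x => ?_, fun p => ?_⟩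
  · exact Subtype.ext (hη.lift_proj hF (hmem x))
  · exact Prod.ext (Subtype.ext (hproj p)) (hη.coordFun_lift hF _ _)

/-- The linear form dual to `v` is the same for two cones on their intersection. -/
theorem coord_eq_coord (hF : IsStarFan L F v) (hη : IsStarCone L v B i₀ η.1) {k' : ℕ}
    {B' : Module.Basis (Fin k') ℝ V} {i₀' : Fin k'} {η' : F} (hη' : IsStarCone L v B' i₀' η'.1)
    {x : V} (hx : x ∈ η.1) (hx' : x ∈ η'.1) : B.coord i₀ x = B'.coord i₀' x := by
  have key : ∀ {k k' : ℕ} {B : Module.Basis (Fin k) ℝ V} {i₀ : Fin k} {η : F}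
      {B' : Module.Basis (Fin k') ℝ V} {i₀' : Fin k'} {η' : F} (_ : IsStarCone L v B i₀ η.1)
      (_ : IsStarCone L v B' i₀' η'.1) (_ : x ∈ η.1) (_ : x ∈ η'.1),
      B.coord i₀ x ≤ B'.coord i₀' x := by
    intro k k' B i₀ η B' i₀' η' hη hη' hx hx'
    have h1 : x - B.coord i₀ x • v ∈ η.1 := hη.mem_iff.2 fun i => by
      rw [map_sub, map_smul, ← hη.basis_eq, smul_eq_mul]
      by_cases hi : i = i₀
      · subst hi
        simp
      · simpa [hi, Ne.symm hi] using hη.mem_iff.1 hx i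
    -- Subtracting the `v`-component of `x` stays in `η`, and both pieces sum to `x`, which lies in
    -- the face `η ∩ η'`. So the remainder is also in `η'`, and nonnegativity of its `v`-coordinate
    -- there is the desired inequality.
    have h2 : x - B.coord i₀ x • v ∈ η.1 ⊓ η'.1 := by
      refine (hF.inter_isFace _ η.2 _ η'.2).1.mem_of_add_mem_left h1
        (PointedCone.smul_mem _ (hη.mem_iff.1 hx i₀) hη.vertex_mem) ?_
      rw [sub_add_cancel]
      exact Submodule.mem_inf.2 ⟨hx, hx'⟩
    have h3 := hη'.mem_iff.1 (Submodule.mem_inf.1 h2).2 i₀'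
    rw [map_sub, map_smul, ← hη'.basis_eq, smul_eq_mul] at h3
    simpa using h3
  exact le_antisymm (key hη hη' hx hx') (key hη' hη hx' hx)

theorem exists_transition (hF : IsStarFan L F v) (hη : IsStarCone L v B i₀ η.1) {k' : ℕ}
    {B' : Module.Basis (Fin k') ℝ V} {i₀' : Fin k'} {η' : F} (hη' : IsStarCone L v B' i₀' η'.1) :
    ∃ u ∈ regular (patch L v η ∩ patch L v η'), (∀ e ∈ patch L v η ∩ patch L v η', u e ≠ 0) ∧
      ∀ x, hF.proj x ∈ patch L v η ∩ patch L v η' →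
        hη'.coordFun i₀' x = u (hF.proj x) * hη.coordFun i₀ x := by
  set τ : F := ⟨η.1 ⊓ η'.1, hF.inf_mem η.2 η'.2⟩ with hτ
  have hvτ : v ∈ τ.1 := Submodule.mem_inf.2 ⟨hη.vertex_mem, hη'.vertex_mem⟩
  -- The exponent of the transition function. It vanishes on `η ∩ η'`, so both `χ^m` and its inverse
  -- are regular on the overlap.
  set m : Module.Dual ℝ V := B'.coord i₀' - B.coord i₀ with hm
  have hm0 : ∀ x ∈ τ.1, m x = 0 := fun x hx => by
    rw [hm, LinearMap.sub_apply, hη.coord_eq_coord hF hη' (Submodule.mem_inf.1 hx).1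
      (Submodule.mem_inf.1 hx).2, sub_self]
  have hmL : m ∈ dualLattice L := sub_mem (hη'.coord_mem i₀') (hη.coord_mem i₀)
  have hmτ : m ∈ dualMonoid L τ.1 := ⟨hmL, fun x hx => (hm0 x hx).ge⟩
  have hmτ' : -m ∈ dualMonoid L τ.1 := ⟨neg_mem hmL, fun x hx => by
    rw [LinearMap.neg_apply, hm0 x hx, neg_zero]⟩
  have hrange : ∀ x : ToricVariety L F, x ∈ Set.range (chart L F η) →
      x ∈ Set.range (chart L F η') → ∃ δ, chart L F τ δ = x := by
    rintro _ ⟨γ, rfl⟩ ⟨γ', hγ⟩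
    obtain ⟨α, -, rfl⟩ := hF.chart_eq_iff.1 hγ.symm
    exact ⟨α, by rw [← hγ]; exact (chart_restrict (σ := η') (τ := τ) inf_le_right α).symm⟩
  set u : ToricVariety L F → ℂ :=
    Function.extend (chart L F τ) (fun δ => δ (character L ⟨m, hmτ⟩)) 0 with hu
  have huc : ∀ δ, u (chart L F τ δ) = δ (character L ⟨m, hmτ⟩) :=
    fun δ => (hF.chart_injective τ).extend_apply _ _ δ
  have hureg : u ∈ regular (Set.range (chart L F τ)) := by
    rw [← Set.image_univ]
    refine (hF.isOpenEmb_chart τ).regular_image _ zOpen_univ _ ?_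
    rw [hu, Function.extend_comp (hF.chart_injective τ)]
    exact regular_eval _ _
  refine ⟨fun e => u e.1, regular_restrict (hF.isOpenEmb_chart τ).zOpen_range hureg
    fun e he => hrange e.1 he.1 he.2, fun e he h0 => ?_, fun x hx => ?_⟩
  · obtain ⟨δ, hδ⟩ := hrange e.1 he.1 he.2
    beta_reduce at h0
    rw [← hδ, huc] at h0
    have h1 : δ (character L (⟨m, hmτ⟩ + ⟨-m, hmτ'⟩)) = 1 := by
      rw [show (⟨m, hmτ⟩ + ⟨-m, hmτ'⟩ : dualMonoid L τ.1) = 0 from Subtype.ext (add_neg_cancel m),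
        character_zero, map_one]
    rw [character_add, map_mul, h0, zero_mul] at h1
    exact zero_ne_one h1
  · obtain ⟨δ, rfl⟩ := hrange x ((hF.proj_mem_patch_iff hη.vertex_mem).1 hx.1)
      ((hF.proj_mem_patch_iff hη'.vertex_mem).1 hx.2)
    -- As `m v = 0`, the character `χ^m` is invariant under scaling, including `t = 0`; its value
    -- depends only on the projection to the divisor.
    have h1 : u (hF.proj (chart L F τ δ)).1 = δ (character L ⟨m, hmτ⟩) := by
      change u (hF.scaling 0 (chart L F τ δ)) = _
      rw [hF.scaling_chart 0 τ hvτ, huc, scale_character]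
      simp [hm0 v hvτ]
    have h2 : hη.coordFun i₀ (chart L F τ δ) =
        δ (character L ⟨B.coord i₀, dualMonoid_anti L inf_le_left (hη.coordChar i₀).2⟩) := by
      rw [← chart_restrict (σ := η) (τ := τ) inf_le_left, hη.coordFun_chart hF,
        IsBasisCone.coords, restrict_character]
      rfl
    have h3 : hη'.coordFun i₀' (chart L F τ δ) =
        δ (character L ⟨B'.coord i₀', dualMonoid_anti L inf_le_right (hη'.coordChar i₀').2⟩) := by
      rw [← chart_restrict (σ := η') (τ := τ) inf_le_right, hη'.coordFun_chart hF,
        IsBasisCone.coords, restrict_character]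
      rfl
    beta_reduce
    rw [h1, h2, h3, ← map_mul, ← character_add]
    congr 2
    exact Subtype.ext (sub_add_cancel _ _).symm

end IsStarCone

/-- The atlas of the star charts. -/
def starAtlas (L : AddSubgroup V) (F : Set (PointedCone ℝ V)) (v : V) :
    Set (Set (Divisor L F v) × (ToricVariety L F → ℂ)) :=
  {c | ∃ (η : F) (k : ℕ) (B : Module.Basis (Fin k) ℝ V) (i₀ : Fin k) (hη : IsStarCone L v B i₀ η.1),
    c = (patch L v η, hη.coordFun i₀)}

theorem IsStarFan.exists_mem_patch (hF : IsStarFan L F v) (e : Divisor L F v) :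
    ∃ (η : F) (k : ℕ) (B : Module.Basis (Fin k) ℝ V) (i₀ : Fin k) (_ : IsStarCone L v B i₀ η.1),
      e ∈ patch L v η := by
  obtain ⟨η, ⟨k, B, i₀, hη⟩, γ, h⟩ := hF.exists_star_chart e.1
  exact ⟨η, k, B, i₀, hη, γ, h⟩

theorem IsStarFan.isLineBundleAtlas (hF : IsStarFan L F v) :
    IsLineBundleAtlas hF.proj (starAtlas L F v) where
  isMorphism := hF.isMorphism_proj
  trivialization := by
    rintro _ ⟨η, k, B, i₀, hη, rfl⟩
    exact hη.isTrivialization hF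
  cover e := by
    obtain ⟨η, k, B, i₀, hη, he⟩ := hF.exists_mem_patch e
    exact ⟨_, ⟨η, k, B, i₀, hη, rfl⟩, he⟩
  linear := by
    rintro _ ⟨η, k, B, i₀, hη, rfl⟩ _ ⟨η', k', B', i₀', hη', rfl⟩
    exact hη.exists_transition hF hη'

end LineBundle

end Toric

namespace Toric

open SpaceWithFunctions

/-! ### The sheaf of sections and the sheaf of the boundary divisor. -/

section SheafOfSections

variable {V : Type*} [AddCommGroup V] [Module ℝ V] {L : AddSubgroup V} {v : V}
  {F : Set (PointedCone ℝ V)} {k : ℕ} {B : Module.Basis (Fin k) ℝ V} {i₀ : Fin k} {η : F}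
  {w : Module.Dual ℝ V}

/-- The global regular function given by a linear form which is nonnegative on all cones. -/
noncomputable def weightFun (hw : ∀ σ ∈ F, w ∈ dualMonoid L σ) : ToricVariety L F → ℂ :=
  Quot.lift (fun y => y.2 (character L ⟨w, hw _ y.1.2⟩)) fun x y hxy => by
    obtain ⟨h, hxy⟩ := hxy
    rw [← hxy, restrict_character]

theorem weightFun_chart (hw : ∀ σ ∈ F, w ∈ dualMonoid L σ) (σ : F) (γ : AffineToric L σ.1) :
    weightFun hw (chart L F σ γ) = γ (character L ⟨w, hw _ σ.2⟩) := rfl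

namespace IsStarCone

/-- The character of `w - m` on the divisor of `v`, where `m` is the form dual to `v`. -/
noncomputable def divMonomial (hη : IsStarCone L v B i₀ η.1) (w : Module.Dual ℝ V)
    (e : Divisor L F v) : ℂ :=
  ∏ i : {i // i ≠ i₀}, hη.divCoord i e ^ ⌊w (B i)⌋₊

/-- The character `χ^w` is the product of all coordinates raised to the values of `w` on the basis.
Since `w v = 1`, the fibre coordinate occurs to the first power, which makes `χ^w` linear on fibres.
-/
theorem weightFun_eq (hF : IsStarFan L F v) (hη : IsStarCone L v B i₀ η.1)
    (hw : ∀ σ ∈ F, w ∈ dualMonoid L σ) (hwv : w v = 1) {x : ToricVariety L F}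
    (hx : hF.proj x ∈ patch L v η) :
    weightFun hw x = hη.coordFun i₀ x * hη.divMonomial w (hF.proj x) := by
  rw [hF.proj_mem_patch_iff hη.vertex_mem] at hx
  have hco : ∀ i : {i // i ≠ i₀}, hη.divCoord i.1 (hF.proj x) = hη.coordFun i.1 x := fun i =>
    hη.coordFun_eq_divCoord_proj hF hx i.2
  simp only [divMonomial, hco]
  obtain ⟨γ, rfl⟩ := hx
  simp only [hη.coordFun_chart hF]
  rw [weightFun_chart, hη.apply_character, ← Finset.mul_prod_erase _ _ (Finset.mem_univ i₀)]
  congr 1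
  · rw [hη.basis_eq, hwv, Nat.floor_one, pow_one]
  · exact Finset.prod_subtype _ (fun i => by simp) _

theorem divMonomial_ne_zero (hη : IsStarCone L v B i₀ η.1) {e : Divisor L F v}
    (h : ∀ i ≠ i₀, hη.divCoord i e ≠ 0) : hη.divMonomial w e ≠ 0 :=
  Finset.prod_ne_zero_iff.2 fun i _ => pow_ne_zero _ (h i.1 i.2)

end IsStarCone

/-- The prime divisors `Z j` are the coordinate hyperplanes in all star charts, and `a j` is minus
the value of `w` on the corresponding ray. -/
def IsBoundary {J : Type*} (w : Module.Dual ℝ V) (Z : J → Set (Divisor L F v)) (a : J → ℤ) : Prop :=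
  ∀ ⦃k : ℕ⦄ ⦃B : Module.Basis (Fin k) ℝ V⦄ ⦃i₀ : Fin k⦄ ⦃η : F⦄ (hη : IsStarCone L v B i₀ η.1),
    ∃ f : {i // i ≠ i₀} → J, Function.Injective f ∧
      (∀ i, ∀ e ∈ patch L v η, e ∈ Z (f i) ↔ hη.divCoord i.1 e = 0) ∧
      (∀ j ∉ Set.range f, ∀ e ∈ patch L v η, e ∉ Z j) ∧ ∀ i, a (f i) = -(⌊w (B i.1)⌋₊ : ℤ)

variable {J : Type*} {Z : J → Set (Divisor L F v)} {a : J → ℤ}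

theorem IsBoundary.mem_torus_iff (hZ : IsBoundary w Z a) (hη : IsStarCone L v B i₀ η.1)
    {e : Divisor L F v} (he : e ∈ patch L v η) :
    e ∉ ⋃ j, Z j ↔ ∀ i ≠ i₀, hη.divCoord i e ≠ 0 := by
  obtain ⟨f, -, hf, hf', -⟩ := hZ hη
  rw [Set.mem_iUnion, not_exists]
  constructor
  · exact fun h i hi h0 => h (f ⟨i, hi⟩) ((hf ⟨i, hi⟩ e he).2 h0)
  · intro h j hj
    by_cases hjf : j ∈ Set.range f
    · obtain ⟨i, rfl⟩ := hjf
      exact h i.1 i.2 ((hf i e he).1 hj)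
    · exact hf' j hjf e he hj

/-- Standard local equations of the boundary divisors in a star chart. -/
theorem IsBoundary.exists_equations [Finite J] (hF : IsStarFan L F v) (hZ : IsBoundary w Z a)
    (hη : IsStarCone L v B i₀ η.1) : ∃ h : J → Divisor L F v → ℂ,
      (∀ W ⊆ patch L v η, ∀ j, IsLocalEquation W (Z j) (h j)) ∧
      ∀ e ∈ patch L v η, e ∉ ⋃ j, Z j →
        (∀ j, h j e ≠ 0) ∧ (∏ᶠ j, h j e ^ a j) * hη.divMonomial w e = 1 := by
  classical
  obtain ⟨f, hinj, hf, hf', ha⟩ := id (hZ hη)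
  -- Divisors that do not meet the chart receive the local equation `1`.
  set h : J → Divisor L F v → ℂ := Function.extend f (fun i => hη.divCoord i.1) 1 with hh
  have h1 : ∀ i, h (f i) = hη.divCoord i.1 := fun i => hinj.extend_apply _ _ i
  have h2 : ∀ j ∉ Set.range f, h j = 1 := fun j hj => Function.extend_apply' _ _ _ hj
  refine ⟨h, fun W hW j => ?_, fun e he heZ => ?_⟩
  · by_cases hj : j ∈ Set.range f
    · obtain ⟨i, rfl⟩ := hj
      rw [h1]
      exact hη.isLocalEquation_divCoord hF hW i.2 (hf i)
    · rw [h2 j hj]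
      exact ⟨one_mem _, fun e he => absurd he.2 (hf' j hj e (hW he.1)),
        fun W' _ _ q hq _ => ⟨q, hq, fun e _ => by simp⟩⟩
  · have hne := (hZ.mem_torus_iff hη he).1 heZ
    refine ⟨fun j => ?_, ?_⟩
    · by_cases hj : j ∈ Set.range f
      · obtain ⟨i, rfl⟩ := hj
        rw [h1]
        exact hne i.1 i.2
      · rw [h2 j hj]
        exact one_ne_zero
    · have := Fintype.ofFinite J
      rw [finprod_eq_prod_of_fintype, ← Fintype.prod_of_injective f hinj
        (fun i => hη.divCoord i.1 e ^ (-(⌊w (B i.1)⌋₊ : ℤ))) _ (fun j hj => by simp [h2 j hj])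
        (fun i => by rw [h1, ha]), IsStarCone.divMonomial, ← Finset.prod_mul_distrib]
      refine Finset.prod_eq_one fun i _ => ?_
      rw [zpow_neg, zpow_natCast]
      exact inv_mul_cancel₀ (pow_ne_zero _ (hne i.1 i.2))

/-- In a star chart, a section of the sheaf of the boundary divisor is a regular multiple of the
standard monomial. -/
theorem IsBoundary.exists_regular_multiple [Finite J] (hF : IsStarFan L F v)
    (hZ : IsBoundary w Z a) (hη : IsStarCone L v B i₀ η.1) {U : Set (Divisor L F v)}
    {f : Divisor L F v → ℂ} (hf : IsDivisorSection Z a U f) {e : Divisor L F v} (heU : e ∈ U)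
    (he : e ∈ patch L v η) : ∃ W ⊆ U, W ⊆ patch L v η ∧ ZOpen W ∧ e ∈ W ∧ ∃ c ∈ regular W,
      ∀ y ∈ W \ ⋃ j, Z j, f y = c y * hη.divMonomial w y := by
  obtain ⟨W, hWU, hW, heW, h', hh', c, hc, hfc⟩ := hf e heU
  obtain ⟨h, hh, hmon⟩ := hZ.exists_equations hF hη
  have hN : ZOpen (W ∩ patch L v η) := hW.inter (hF.zOpen_patch η)
  have hNη : W ∩ patch L v η ⊆ patch L v η := Set.inter_subset_right
  -- The definition of a divisor section allows arbitrary local equations `h'`. Each divides, and is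
  -- divided by, the standard equation `h`; the quotients `q` and `p` are mutually inverse on the
  -- torus, hence everywhere, so `q` is a unit and `q ^ a` is regular for negative `a` too.
  choose q hq hq' using fun j => (hh' j).2.2 (W ∩ patch L v η) Set.inter_subset_left hN (h j)
    (hh _ hNη j).1 (hh _ hNη j).2.1
  choose p hp hp' using fun j => (hh _ hNη j).2.2 (W ∩ patch L v η) subset_rfl hN (h' j)
    (regular_mono Set.inter_subset_left (hh' j).1) fun y hy => (hh' j).2.1 y ⟨hy.1.1, hy.2⟩
  have hpq : ∀ j, Set.EqOn (q j * p j) 1 (W ∩ patch L v η) := fun j =>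
    hη.eqOn_of_torus hF hN hNη (mul_mem (hq j) (hp j)) (one_mem _) fun y hy hne => by
      have h0 := (hmon y hy.2 ((hZ.mem_torus_iff hη hy.2).2 hne)).1 j
      refine mul_right_cancel₀ h0 ?_
      rw [Pi.mul_apply, Pi.one_apply, one_mul, mul_assoc, ← hp' j y hy, ← hq' j y hy]
  have hq0 : ∀ j, ∀ y ∈ W ∩ patch L v η, q j y ≠ 0 := fun j y hy h0 => by
    have := hpq j hy
    rw [Pi.mul_apply, h0, zero_mul] at this
    exact zero_ne_one this
  have := Fintype.ofFinite J
  refine ⟨W ∩ patch L v η, Set.inter_subset_left.trans hWU, hNη, hN, ⟨heW, he⟩,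
    c * ∏ j, q j ^ a j, mul_mem (regular_mono Set.inter_subset_left hc)
      (prod_mem fun j _ => regular_zpow_of_ne_zero hN (hq j) (hq0 j) (a j)), fun y hy => ?_⟩
  have h1 := hfc y ⟨hy.1.1, hy.2⟩
  have h2 := (hmon y hy.1.2 hy.2).2
  rw [finprod_eq_prod_of_fintype] at h1 h2
  have h3 : ∏ j, h j y ^ a j = (∏ j, h' j y ^ a j) * ∏ j, q j y ^ a j := by
    rw [← Finset.prod_mul_distrib]
    exact Finset.prod_congr rfl fun j _ => by rw [hq' j y hy.1, mul_zpow, mul_comm]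
  rw [Pi.mul_apply, Finset.prod_apply, ← h1]
  simp only [Pi.pow_apply]
  rw [mul_assoc (f y), ← h3, mul_assoc, h2, mul_one]

theorem regular_pullSection_coordFun (hF : IsStarFan L F v) (hη : IsStarCone L v B i₀ η.1)
    {U : Set (Divisor L F v)} (hU : ZOpen U) {s : U → ToricVariety L F}
    (hs : IsSection hF.proj U s) :
    pullSection s (hη.coordFun i₀) ∈ regular (U ∩ patch L v η) := by
  have := regular_pullSection hU hs.1 (hF.isOpenEmb_chart η).zOpen_range (hη.regular_coordFun hF i₀)
  refine regular_mono ?_ this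
  rintro e ⟨heU, he⟩
  refine ⟨⟨e, heU⟩, (hF.proj_mem_patch_iff hη.vertex_mem).1 ?_, rfl⟩
  rw [hs.2]
  exact he

theorem pullSection_weightFun (hF : IsStarFan L F v) (hη : IsStarCone L v B i₀ η.1)
    (hw : ∀ σ ∈ F, w ∈ dualMonoid L σ) (hwv : w v = 1) {U : Set (Divisor L F v)}
    {s : U → ToricVariety L F} (hs : IsSection hF.proj U s) {e : Divisor L F v} (heU : e ∈ U)
    (he : e ∈ patch L v η) : pullSection s (weightFun hw) e =
      pullSection s (hη.coordFun i₀) e * hη.divMonomial w e := by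
  have h := hs.2 ⟨e, heU⟩
  rw [pullSection_of_mem s _ heU, pullSection_of_mem s _ heU,
    hη.weightFun_eq hF hw hwv (by rw [h]; exact he), h]

/-- Sections of the sheaf of the boundary divisor come from sections of the line bundle. -/
theorem IsBoundary.exists_section [Finite J] (hF : IsStarFan L F v) (hZ : IsBoundary w Z a)
    (hw : ∀ σ ∈ F, w ∈ dualMonoid L σ) (hwv : w v = 1) {U : Set (Divisor L F v)}
    {f : Divisor L F v → ℂ} (hf : IsDivisorSection Z a U f) :
    ∃ s, IsSection hF.proj U s ∧ Set.EqOn (pullSection s (weightFun hw)) f (U \ ⋃ j, Z j) := by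
  choose η k B i₀ hη heη using hF.exists_mem_patch
  choose W hWU hWη hW heW c hc hfc using fun e : U =>
    hZ.exists_regular_multiple hF (hη e.1) hf e.2 (heη e.1)
  have key : ∀ e₁ e₂ : U, ∀ y ∈ W e₁ ∩ W e₂,
      (hη e₂.1).lift y (c e₂ y) = (hη e₁.1).lift y (c e₁ y) := by
    intro e₁ e₂
    obtain ⟨u, hu, -, htr⟩ := (hη e₁.1).exists_transition hF (hη e₂.1)
    have hsub : W e₁ ∩ W e₂ ⊆ patch L v (η e₁.1) ∩ patch L v (η e₂.1) :=
      Set.inter_subset_inter (hWη e₁) (hWη e₂)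
    -- The local fibre coordinates transform with the transition function `u`. Evaluating `χ^w` in
    -- both charts at the point with fibre coordinate `1` relates the two monomials by `u`;
    -- comparison of the two expressions for `f` on the torus then gives the claim.
    have heq : Set.EqOn (c e₂) (u * c e₁) (W e₁ ∩ W e₂) := by
      refine (hη e₂.1).eqOn_of_torus hF ((hW e₁).inter (hW e₂)) (fun y hy => (hsub hy).2)
        (regular_mono Set.inter_subset_right (hc e₂))
        (mul_mem (regular_mono hsub hu) (regular_mono Set.inter_subset_left (hc e₁)))
        fun y hy hne => ?_
      have hyZ := (hZ.mem_torus_iff (hη e₂.1) (hsub hy).2).2 hne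
      have hpr := (hη e₁.1).proj_lift hF (hsub hy).1 1
      have hw₁ := (hη e₁.1).weightFun_eq hF hw hwv (x := (hη e₁.1).lift y 1)
        (by rw [hpr]; exact (hsub hy).1)
      rw [(hη e₂.1).weightFun_eq hF hw hwv (by rw [hpr]; exact (hsub hy).2),
        htr _ (by rw [hpr]; exact hsub hy), (hη e₁.1).coordFun_lift hF, hpr, mul_one, one_mul] at hw₁
      refine mul_right_cancel₀ ((hη e₂.1).divMonomial_ne_zero (w := w) hne) ?_
      rw [← hfc e₂ y ⟨hy.2, hyZ⟩, hfc e₁ y ⟨hy.1, hyZ⟩, ← hw₁, Pi.mul_apply]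
      ring
    intro y hy
    have hpr := (hη e₁.1).proj_lift hF (hsub hy).1 (c e₁ y)
    have h2 := (hη e₂.1).lift_proj hF (x := (hη e₁.1).lift y (c e₁ y))
      ((hF.proj_mem_patch_iff (hη e₂.1).vertex_mem).1 (by rw [hpr]; exact (hsub hy).2))
    rw [htr _ (by rw [hpr]; exact hsub hy), hpr, (hη e₁.1).coordFun_lift hF] at h2
    rw [heq hy, Pi.mul_apply, h2]
  -- The section is defined at each point by the chart chosen for that point; `key` shows that near
  -- `e` it is given by the single chart chosen for `e`, hence is a morphism.
  set s : U → ToricVariety L F := fun e => (hη e.1).lift e.1 (c e e.1) with hs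
  have hsW : ∀ e y : U, y.1 ∈ W e → s y = (hη e.1).lift y.1 (c e y.1) := fun e y hy =>
    key e y y.1 ⟨hy, heW y⟩
  have hproj : ∀ e : U, hF.proj (s e) = e.1 := fun e => (hη e.1).proj_lift hF (heη e.1) _
  have hsmor : IsMorphism s := by
    refine isMorphism_of_cover (c := fun e (y : (Subtype.val ⁻¹' W e : Set U)) => y.1)
      (fun e => isOpenEmb_val ⟨W e, hW e, rfl⟩) (fun e => ⟨e, ⟨e, heW e⟩, rfl⟩) fun e => ?_
    have hmor : IsMorphism fun y : (Subtype.val ⁻¹' W e : Set U) =>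
        ((⟨y.1.1, hWη e y.2⟩, c e y.1.1) : patch L v (η e.1) × ℂ) := by
      refine isMorphism_prodMk (isMorphism_codRestrict
        ((isMorphism_val U).comp (isMorphism_val _)) fun y => hWη e y.2) ?_
      have h1 : (fun y : U => c e y.1) ∈ regular (Subtype.val ⁻¹' W e : Set U) :=
        regular_restrict (hW e) (hc e) fun _ h => h
      exact regular_restrict (isMorphism_val U _ (hW e)).1 h1 fun y _ => y.2
    have hcomp := ((hη e.1).isMorphism_lift hF).comp hmor
    convert! hcomp using 1
    exact funext fun y => hsW e y.1 y.2
  refine ⟨s, ⟨hsmor, hproj⟩, fun y hy => ?_⟩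
  rw [pullSection_weightFun hF (hη y) hw hwv ⟨hsmor, hproj⟩ hy.1 (heη y),
    hfc ⟨y, hy.1⟩ y ⟨heW ⟨y, hy.1⟩, hy.2⟩, pullSection_of_mem s _ hy.1]
  congr 1
  exact (hη y).coordFun_lift hF _ _

/-- The isomorphism is `s ↦ χ^w ∘ s`. In a star chart this is the fibre coordinate of `s` times the
standard monomial, and the product of the powers of the local equations prescribed by `a` is the
inverse of that monomial. -/
theorem IsBoundary.hasSheafOfSections [Finite J] (hF : IsStarFan L F v) (hZ : IsBoundary w Z a)
    (hw : ∀ σ ∈ F, w ∈ dualMonoid L σ) (hwv : w v = 1) :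
    HasSheafOfSections hF.proj (starAtlas L F v) Z a := by
  refine ⟨fun U s => pullSection s (weightFun hw), fun U hU s hs e he => ?_,
    fun U hU s s' hs hs' heq => ?_, fun U _ f hf => hZ.exists_section hF hw hwv hf,
    fun U W hU hW hWU s hs e he => ?_, fun U hU s₁ s₂ s₃ h₁ h₂ h₃ r hr hadd e he => ?_⟩
  · obtain ⟨η, k, B, i₀, hη, heη⟩ := hF.exists_mem_patch e
    obtain ⟨h, hh, hmon⟩ := hZ.exists_equations hF hη
    refine ⟨U ∩ patch L v η, Set.inter_subset_left, hU.inter (hF.zOpen_patch η), ⟨he, heη⟩, h,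
      hh _ Set.inter_subset_right, _, regular_pullSection_coordFun hF hη hU hs, fun y hy => ?_⟩
    beta_reduce
    rw [pullSection_weightFun hF hη hw hwv hs hy.1.1 hy.1.2, mul_assoc,
      mul_comm (hη.divMonomial w y), (hmon y hy.1.2 hy.2).2, mul_one]
  · ext ⟨e, he⟩
    obtain ⟨η, k, B, i₀, hη, heη⟩ := hF.exists_mem_patch e
    -- Off the boundary the monomial can be cancelled, so the fibre coordinates of the two sections
    -- agree on the torus and therefore on the whole patch.
    have hcoord := hη.eqOn_of_torus hF (hU.inter (hF.zOpen_patch η)) Set.inter_subset_right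
      (regular_pullSection_coordFun hF hη hU hs) (regular_pullSection_coordFun hF hη hU hs')
      fun y hy hne => by
        refine mul_right_cancel₀ (hη.divMonomial_ne_zero (w := w) hne) ?_
        rw [← pullSection_weightFun hF hη hw hwv hs hy.1 hy.2,
          ← pullSection_weightFun hF hη hw hwv hs' hy.1 hy.2]
        exact heq ⟨hy.1, (hZ.mem_torus_iff hη hy.2).2 hne⟩
    have h := hcoord ⟨he, heη⟩
    rw [pullSection_of_mem s _ he, pullSection_of_mem s' _ he] at h
    have hmem : ∀ {s : U → ToricVariety L F}, IsSection hF.proj U s →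
        s ⟨e, he⟩ ∈ Set.range (chart L F η) := fun hs =>
      (hF.proj_mem_patch_iff hη.vertex_mem).1 (by rw [hs.2]; exact heη)
    rw [← hη.lift_proj hF (hmem hs), ← hη.lift_proj hF (hmem hs'), hs.2, hs'.2, h]
  · beta_reduce
    rw [pullSection_of_mem _ _ he.1, pullSection_of_mem _ _ (hWU he.1)]
    rfl
  · obtain ⟨η, k, B, i₀, hη, heη⟩ := hF.exists_mem_patch e
    have h := hadd _ ⟨η, k, B, i₀, hη, rfl⟩ ⟨e, he.1⟩ heη
    dsimp only at h
    rw [Pi.add_apply, Pi.mul_apply]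
    beta_reduce
    rw [pullSection_weightFun hF hη hw hwv h₁ he.1 heη,
      pullSection_weightFun hF hη hw hwv h₂ he.1 heη, pullSection_weightFun hF hη hw hwv h₃ he.1 heη,
      pullSection_of_mem s₁ _ he.1, pullSection_of_mem s₂ _ he.1, pullSection_of_mem s₃ _ he.1, h]
    ring

/-- The toric variety is the total space of the line bundle of the boundary divisor. -/
theorem IsBoundary.isTotalSpace [Finite J] (hF : IsStarFan L F v) (hZ : IsBoundary w Z a)
    (hw : ∀ σ ∈ F, w ∈ dualMonoid L σ) (hwv : w v = 1) :
    IsTotalSpace hF.proj Subtype.val Z a := by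
  refine ⟨starAtlas L F v, hF.isLineBundleAtlas, hZ.hasSheafOfSections hF hw hwv,
    ⟨(isMorphism_val _).comp (isMorphism_val _), fun e => hF.proj_val e.1⟩, ?_⟩
  rintro _ ⟨η, k, B, i₀, hη, rfl⟩ e ⟨γ, hγ⟩
  change hη.coordFun i₀ e.1 = 0
  have := e.2
  rw [← hγ, hF.chart_mem_divisor_iff hη] at this
  rw [← hγ, hη.coordFun_chart hF, this]

end SheafOfSections

end Toric

namespace Toric

open SpaceWithFunctions

/-! ### Ray generators and lattice bases. -/

section Rays

variable {V : Type*} [AddCommGroup V] [Module ℝ V] {L : AddSubgroup V} {F : Set (PointedCone ℝ V)}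
  {ι : Type*} [Fintype ι] {B : Module.Basis ι ℝ V} {η : PointedCone ℝ V} {u : V}

/-- A ray generator of a fan in a cone generated by a lattice basis is a member of the basis. -/
theorem IsBasisCone.exists_basis_eq (hF : IsFan L F) (hηF : η ∈ F) (hη : IsBasisCone L B η)
    (hu : u ∈ rayGenerators L F) (huη : u ∈ η) : ∃ i, B i = u := by
  obtain ⟨huL, hu0, huF, hprim⟩ := hu
  have hface : (PointedCone.hull ℝ {u}).IsFaceOf η :=
    hF.isFaceOf_of_le hηF huF (Submodule.span_le.2 (Set.singleton_subset_iff.2 huη))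
  obtain ⟨i, hi⟩ : ∃ i, B.coord i u ≠ 0 := by
    by_contra! h
    exact hu0 (B.forall_coord_eq_zero_iff.1 h)
  -- The ray of `u` is a face of `η`, so it contains every basis vector along which `u` has a
  -- nonzero coordinate. Primitivity then gives `B i = K • u`, and integrality of the `i`-th
  -- coordinate of `u` forces `K = 1`.
  have hmem : B i ∈ PointedCone.hull ℝ {u} := by
    by_contra h
    exact hi (hη.coord_eq_zero_of_face hface (PointedCone.subset_hull rfl) h)
  obtain ⟨K, hK⟩ := hprim _ (hη.mem i) hmem
  obtain ⟨c, hc⟩ := hη.coord_mem i u huL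
  have h1 : B.coord i (B i) = 1 := by simp
  rw [hK, map_nsmul, hc, nsmul_eq_mul] at h1
  have h2 : (K : ℤ) * c = 1 := by exact_mod_cast h1
  have h3 : (K : ℤ) = 1 :=
    Int.eq_one_or_neg_one_of_mul_eq_one h2 |>.resolve_right (by omega)
  have h4 : K = 1 := by exact_mod_cast h3
  exact ⟨i, by rw [hK, h4, one_smul]⟩

theorem IsBasisCone.basis_mem_rayGenerators (hF : IsFan L F) (hηF : η ∈ F)
    (hη : IsBasisCone L B η) (i : ι) : B i ∈ rayGenerators L F := by
  have himage : PointedCone.hull ℝ {B i} = PointedCone.hull ℝ (B '' {i}) := by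
    rw [Set.image_singleton]
  refine ⟨hη.mem i, B.ne_zero i, ?_, fun x hxL hx => ?_⟩
  · rw [himage]
    exact hF.face_mem η hηF _ (hη.hull_isFaceOf _)
  · rw [himage] at hx
    have hx' := (mem_hull_basis B {i}).1 hx
    refine ⟨⌊B.coord i x⌋₊, ?_⟩
    rw [← Nat.cast_smul_eq_nsmul ℝ, cast_floor_apply (hη.coord_mem_dualMonoid i) hxL
      (hη.mem_iff.2 hx'.1)]
    conv_lhs => rw [← B.sum_repr x]
    refine Finset.sum_eq_single i (fun j _ hj => ?_) fun h => absurd (Finset.mem_univ i) h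
    have := hx'.2 j hj
    rw [B.coord_apply] at this
    rw [this, zero_smul]

/-- A ray has only one generator: two of them are natural multiples of each other, with factors
whose product is `1`. -/
theorem finite_rayGenerators (hF : F.Finite) : (rayGenerators L F).Finite := by
  refine Set.Finite.of_finite_image (f := fun u => PointedCone.hull ℝ {u})
    (hF.subset (by rintro _ ⟨u, hu, rfl⟩; exact hu.2.2.1)) fun u hu u' hu' h => ?_
  dsimp only at h
  obtain ⟨K, hK⟩ := hu.2.2.2 u' hu'.1 (by
    have : u' ∈ PointedCone.hull ℝ {u'} := PointedCone.subset_hull rfl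
    rw [← h] at this
    exact this)
  obtain ⟨K', hK'⟩ := hu'.2.2.2 u hu.1 (by
    have : u ∈ PointedCone.hull ℝ {u} := PointedCone.subset_hull rfl
    rw [h] at this
    exact this)
  have h1 : ((K' * K : ℕ) : ℝ) • u = (1 : ℝ) • u := by
    rw [Nat.cast_smul_eq_nsmul, one_smul, mul_smul, ← hK, ← hK']
  have h2 : K' * K = 1 := by exact_mod_cast smul_left_injective ℝ hu.2.1 h1
  rw [hK, Nat.eq_one_of_mul_eq_one_left h2, one_smul]

end Rays

/-! ### Full-dimensional regular cones. -/

section FullDimensional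

variable {V : Type*} [AddCommGroup V] [Module ℝ V] {L : AddSubgroup V}

/-- If a basis vector were missing from the generators, its coordinate form would vanish on the cone
and hence on its span, the whole space. -/
theorem isBasisCone_of_finrank_eq [FiniteDimensional ℝ V] {η : PointedCone ℝ V}
    (hη : IsRegularCone L η)
    (h : Module.finrank ℝ (Submodule.span ℝ (η : Set V)) = Module.finrank ℝ V) :
    ∃ (k : ℕ) (B : Module.Basis (Fin k) ℝ V), IsBasisCone L B η := by
  obtain ⟨k, B, s, hB, rfl⟩ := hη
  refine ⟨k, B, hB, ?_⟩
  rw [← Set.image_univ]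
  congr 2
  refine Set.eq_univ_of_forall fun i => ?_
  by_contra hi
  have hle : Submodule.span ℝ (PointedCone.hull ℝ (B '' s) : Set V) ≤ LinearMap.ker (B.coord i) :=
    Submodule.span_le.2 fun x hx => ((mem_hull_basis B s).1 hx).2 i hi
  rw [Submodule.eq_top_of_finrank_eq h] at hle
  have := hle (Submodule.mem_top (x := B i))
  simp at this

theorem IsBasisCone.finrank_span_eq {ι : Type*} {B : Module.Basis ι ℝ V} {η : PointedCone ℝ V}
    (hη : IsBasisCone L B η) :
    Module.finrank ℝ (Submodule.span ℝ (η : Set V)) = Module.finrank ℝ V := by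
  have : Submodule.span ℝ (η : Set V) = ⊤ := by
    rw [eq_top_iff, ← B.span_eq]
    refine Submodule.span_mono ?_
    rintro _ ⟨i, rfl⟩
    exact hη.basis_mem i
  rw [this, finrank_top]

end FullDimensional

/-! ### Refinements of the orthant: every cone lies in a full-dimensional one. -/

section Orthant

variable {n : ℕ}

theorem mem_orthant_iff {x : Fin n → ℝ} : x ∈ orthant n ↔ ∀ i, 0 ≤ x i := by
  have : orthant n = PointedCone.hull ℝ (Pi.basisFun ℝ (Fin n) '' Set.univ) := by
    rw [orthant, Set.image_univ]
    congr 2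
    ext i : 1
    simp
  rw [this, mem_hull_basis]
  simp

/-- A linear form along the curve `p + ∑ t ^ (l + 1) e_l`. -/
theorem exists_curve_polynomial (p : Fin n → ℝ) (m : Module.Dual ℝ (Fin n → ℝ)) :
    ∃ q : Polynomial ℝ, (∀ t : ℝ, m (p + fun l => t ^ (l.1 + 1)) = q.eval t) ∧
      q.eval 0 = m p ∧ (q = 0 → m = 0) := by
  have hm : ∀ x, m x = ∑ l, x l * m (Pi.single l 1) := fun x => by
    have := apply_eq_sum_coord (Pi.basisFun ℝ (Fin n)) m x
    simpa using this
  -- The exponents start at `1`, so the constant term is `m p` and the coefficient of `X ^ (l + 1)`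
  -- is `m e_l`. A zero polynomial therefore means `m = 0`.
  refine ⟨Polynomial.C (m p) + ∑ l : Fin n, Polynomial.C (m (Pi.single l 1)) *
    Polynomial.X ^ (l.1 + 1), fun t => ?_, ?_, fun h => ?_⟩
  · rw [map_add, hm fun l => t ^ (l.1 + 1)]
    rw [Polynomial.eval_add, Polynomial.eval_C, Polynomial.eval_finsetSum]
    congr 1
    refine Finset.sum_congr rfl fun l _ => ?_
    rw [Polynomial.eval_mul, Polynomial.eval_C, Polynomial.eval_pow, Polynomial.eval_X, mul_comm]
  · simp [Polynomial.eval_finsetSum]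
  · refine (Pi.basisFun ℝ (Fin n)).ext fun l => ?_
    have := congrArg (fun q => Polynomial.coeff q (l.1 + 1)) h
    simp only [Polynomial.coeff_add, Polynomial.coeff_C_succ, Polynomial.finsetSum_coeff,
      Polynomial.coeff_C_mul, Polynomial.coeff_X_pow, Polynomial.coeff_zero, zero_add] at this
    rw [Finset.sum_eq_single l (fun j _ hj => by
      rw [if_neg, mul_zero]
      intro h
      exact hj (Fin.ext (by omega))) (by simp)] at this
    simpa using this

/-- In a refinement of the orthant by regular cones, every cone lies in a full-dimensional one. -/
theorem exists_le_isBasisCone {L : AddSubgroup (Fin n → ℝ)} {F : Set (PointedCone ℝ (Fin n → ℝ))}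
    (hF : IsRegularFan L F) (hcov : (⋃ τ ∈ F, (τ : Set (Fin n → ℝ))) = orthant n)
    {τ : PointedCone ℝ (Fin n → ℝ)} (hτ : τ ∈ F) :
    ∃ η ∈ F, τ ≤ η ∧ ∃ (k : ℕ) (B : Module.Basis (Fin k) ℝ (Fin n → ℝ)), IsBasisCone L B η := by
  classical
  obtain ⟨k, B, s, hB, hτs⟩ := hF.regular τ hτ
  set g : Fin k → Fin n → ℝ := fun i => if i ∈ s then B i else 0 with hg
  have hgτ : ∀ i, g i ∈ τ := fun i => by
    simp only [hg]
    split_ifs with hi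
    · rw [hτs]
      exact PointedCone.subset_hull ⟨i, hi, rfl⟩
    · exact zero_mem _
  -- The sum of the generators is a point in the relative interior of `τ`.
  set p := ∑ i, g i with hp
  have hpτ : p ∈ τ := sum_mem fun i _ => hgτ i
  have hpos : ∀ i, 0 ≤ p i := mem_orthant_iff.1 (by
    have : p ∈ (⋃ τ ∈ F, (τ : Set (Fin n → ℝ))) := Set.mem_biUnion hτ hpτ
    rw [hcov] at this
    exact this)
  -- A sequence tending to `p` along a moment curve stays in the orthant. As the fan is finite, one
  -- cone `η` contains infinitely many of its points.
  have hcurve : ∀ j : ℕ, ∃ η : F, (p + fun l => (1 / ((j : ℝ) + 1)) ^ (l.1 + 1)) ∈ η.1 := by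
    intro j
    have : (p + fun l => (1 / ((j : ℝ) + 1)) ^ (l.1 + 1)) ∈
        (⋃ τ ∈ F, (τ : Set (Fin n → ℝ))) := by
      rw [hcov]
      refine mem_orthant_iff.2 fun i => add_nonneg (hpos i) ?_
      positivity
    simp only [Set.mem_iUnion] at this
    obtain ⟨η, hη, h⟩ := this
    exact ⟨⟨η, hη⟩, h⟩
  choose f hf using hcurve
  have := hF.finite.to_subtype
  obtain ⟨η, hη⟩ := Finite.exists_infinite_fiber f
  have hinf : (f ⁻¹' {η}).Infinite := Set.infinite_coe_iff.1 hη
  obtain ⟨k', B', s', hB', hηs⟩ := hF.regular η.1 η.2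
  have hmem : ∀ j ∈ f ⁻¹' {η}, (p + fun l => (1 / ((j : ℝ) + 1)) ^ (l.1 + 1)) ∈ η.1 := by
    rintro j rfl
    exact hf j
  -- A missing generator would make a nonzero coordinate form vanish at infinitely many points of
  -- the curve, contradicting the finiteness of the roots of a nonzero polynomial.
  have hs' : s' = Set.univ := by
    refine Set.eq_univ_of_forall fun i => ?_
    by_contra hi
    obtain ⟨q, hq, -, hq0⟩ := exists_curve_polynomial p (B'.coord i)
    have hzero : q = 0 := by
      refine Polynomial.eq_zero_of_infinite_isRoot q ((hinf.image
        (f := fun j : ℕ => 1 / ((j : ℝ) + 1)) fun a _ b _ h => ?_).mono ?_)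
      · simpa using h
      · rintro _ ⟨j, hj, rfl⟩
        have := hmem j hj
        rw [hηs, mem_hull_basis] at this
        have h0 := this.2 i hi
        rw [hq] at h0
        exact h0
    have := congrArg (fun m => m (B' i)) (hq0 hzero)
    simp at this
  rw [hs', Set.image_univ] at hηs
  have hηB : IsBasisCone L B' η.1 := ⟨hB', hηs⟩
  -- The cone `η` is closed, so it contains the limit `p`: nonnegativity of the coordinates at
  -- infinitely many points of the sequence passes to the limit.
  have hpη : p ∈ η.1 := by
    refine hηB.mem_iff.2 fun i => ?_
    obtain ⟨q, hq, hq0, -⟩ := exists_curve_polynomial p (B'.coord i)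
    have hlim : Filter.Tendsto (fun j : ℕ => q.eval (1 / ((j : ℝ) + 1))) Filter.atTop
        (𝓝 (B'.coord i p)) := by
      rw [← hq0]
      exact (q.continuous.tendsto 0).comp tendsto_one_div_add_atTop_nhds_zero_nat
    refine ge_of_tendsto_of_frequently hlim (Nat.frequently_atTop_iff_infinite.2 (hinf.mono ?_))
    intro j hj
    have := hηB.mem_iff.1 (hmem j hj) i
    rw [hq] at this
    exact this
  refine ⟨η.1, η.2, ?_, k', B', hηB⟩
  have hface := (hF.inter_isFace η.1 η.2 τ hτ).2
  rw [hτs]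
  refine Submodule.span_le.2 ?_
  rintro _ ⟨i, hi, rfl⟩
  -- The face `η ∩ τ` of `τ` contains the sum of the generators of `τ`, hence each generator.
  have h1 := hface.mem_of_sum_mem hgτ (Submodule.mem_inf.2 ⟨hpη, hpτ⟩) i
  simp only [hg, if_pos hi] at h1
  exact (Submodule.mem_inf.1 h1).1

end Orthant

end Toric

namespace Toric

open SpaceWithFunctions

/-! ### The lattice of `G`, integrality of the age and junior elements. -/

section Lattice

variable {n : ℕ}

/-- Smooth cones with respect to a lattice between `ℤⁿ` and `r⁻¹ ℤⁿ` are generated by a part of a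
real basis consisting of a lattice basis. -/
theorem IsSmoothCone.isRegularCone {L : AddSubgroup (Fin n → ℝ)} {r : ℕ} (hr : r ≠ 0)
    (hL : ∀ i, (Pi.single i 1 : Fin n → ℝ) ∈ L) (hLr : ∀ x ∈ L, ∀ i, ∃ k : ℤ, (r : ℝ) * x i = k)
    {σ : PointedCone ℝ (Fin n → ℝ)} (hσ : IsSmoothCone L σ) : IsRegularCone L σ := by
  obtain ⟨k, b, s, rfl⟩ := hσ
  have hr' : (r : ℝ) ≠ 0 := Nat.cast_ne_zero.2 hr
  set L' : Submodule ℤ (Fin n → ℝ) := AddSubgroup.toIntSubmodule L with hL'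
  -- The lattice spanned by this basis is `r⁻¹ ℤⁿ`. Being contained in it makes `L` discrete, and
  -- containing `ℤⁿ` makes it span the space, so a `ℤ`-basis of `L` is a real basis.
  set c : Module.Basis (Fin n) ℝ (Fin n → ℝ) := (Pi.basisFun ℝ (Fin n)).isUnitSMul
    (w := fun _ => (r : ℝ)⁻¹) fun _ => (inv_ne_zero hr').isUnit with hc
  have hle : (L' : Set (Fin n → ℝ)) ⊆ Submodule.span ℤ (Set.range c) := by
    intro x hx
    choose a ha using hLr x hx
    have hx' : x = ∑ i, a i • c i := by
      ext j
      rw [Finset.sum_apply, Finset.sum_eq_single j]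
      · simp only [hc, Module.Basis.isUnitSMul_apply, Pi.basisFun_apply, Pi.smul_apply,
          Pi.single_eq_same, smul_eq_mul, mul_one, zsmul_eq_mul]
        rw [← ha j]
        field_simp
      · intro i _ hi
        simp [hc, Module.Basis.isUnitSMul_apply, Pi.single_eq_of_ne hi.symm]
      · simp
    rw [hx']
    exact sum_mem fun i _ => Submodule.smul_mem _ _ (Submodule.subset_span ⟨i, rfl⟩)
  have hspan : DiscreteTopology (Submodule.span ℤ (Set.range c)) := inferInstance
  have hdisc : DiscreteTopology L' := DiscreteTopology.of_subset hspan hle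
  have hlat : IsZLattice ℝ L' := ⟨by
    rw [eq_top_iff, ← (Pi.basisFun ℝ (Fin n)).span_eq]
    refine Submodule.span_mono ?_
    rintro _ ⟨i, rfl⟩
    rw [Pi.basisFun_apply]
    exact hL i⟩
  set b' : Module.Basis (Fin k) ℤ L' := b.map (AddEquiv.toIntLinearEquiv
    { toFun := fun x => ⟨x.1, x.2⟩, invFun := fun x => ⟨x.1, x.2⟩, map_add' := fun _ _ => rfl })
    with hb'
  have hbv : ∀ i, (b' i : Fin n → ℝ) = b i := fun i => rfl
  refine ⟨k, b'.ofZLatticeBasis ℝ L', s, ⟨fun i => ?_, fun i u hu => ?_⟩, ?_⟩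
  · rw [Module.Basis.ofZLatticeBasis_apply, hbv]
    exact (b i).2
  · refine ⟨b'.repr ⟨u, hu⟩ i, ?_⟩
    rw [Module.Basis.coord_apply]
    exact b'.ofZLatticeBasis_repr_apply ℝ L' ⟨u, hu⟩ i
  · congr 2
    ext i : 1
    rw [Module.Basis.ofZLatticeBasis_apply, hbv]

/-- The age as a linear form. -/
noncomputable def ageForm (n : ℕ) : Module.Dual ℝ (Fin n → ℝ) := ∑ i, LinearMap.proj i

theorem ageForm_apply (x : Fin n → ℝ) : ageForm n x = age x := by
  simp [ageForm, age]

variable {G : Subgroup (Matrix.SpecialLinearGroup (Fin n) ℂ)} {ε : ℂ}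
  {b : Module.Basis (Fin n) ℂ (Fin n → ℂ)}

/-- This is where determinant one enters: in the eigenbasis the determinant of `g` is `ε` to the sum
of the exponents. As `ε` is primitive, `r` divides that sum and the age is an integer. -/
theorem IsFractionalExpression.prod_eq_one {g : Matrix.SpecialLinearGroup (Fin n) ℂ}
    {a : Fin n → ℕ} (ha : ∀ i, g.1.mulVec (b i) = ε ^ a i • b i) : ε ^ ∑ i, a i = 1 := by
  classical
  have h1 : LinearMap.toMatrix b b (Matrix.toLin' g.1) = Matrix.diagonal fun i => ε ^ a i := by
    ext i j
    rw [LinearMap.toMatrix_apply, Matrix.toLin'_apply, ha, map_smul, Module.Basis.repr_self,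
      Finsupp.smul_single, smul_eq_mul, mul_one, Finsupp.single_apply, Matrix.diagonal_apply]
    by_cases h : i = j
    · simp [h]
    · simp [h, Ne.symm h]
  have h2 : LinearMap.det (Matrix.toLin' g.1) = 1 := by
    rw [LinearMap.det_toLin']
    exact g.2
  rw [← LinearMap.det_toMatrix b, h1, Matrix.det_diagonal] at h2
  rw [← h2, Finset.prod_pow_eq_pow_sum]

theorem IsFractionalExpression.exists_age_eq {r : ℕ} (hr : r ≠ 0) (hε : IsPrimitiveRoot ε r)
    {g : Matrix.SpecialLinearGroup (Fin n) ℂ} {v : Fin n → ℝ}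
    (hv : IsFractionalExpression r ε b g v) : ∃ k : ℤ, age v = k := by
  obtain ⟨a, ha⟩ := hv
  obtain ⟨k, hk⟩ := hε.dvd_of_pow_eq_one _
    (IsFractionalExpression.prod_eq_one fun i => (ha i).2.1)
  refine ⟨k, ?_⟩
  have : age v = ((∑ i, a i : ℕ) : ℝ) / r := by
    rw [age, Nat.cast_sum, Finset.sum_div]
    exact Finset.sum_congr rfl fun i _ => (ha i).2.2
  rw [this, hk]
  have hr' : (r : ℝ) ≠ 0 := Nat.cast_ne_zero.2 hr
  push_cast
  field_simp

theorem single_mem_lattice (i : Fin n) : (Pi.single i 1 : Fin n → ℝ) ∈ lattice G ε b :=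
  AddSubgroup.subset_closure (Or.inl ⟨i, rfl⟩)

theorem exists_card_mul_eq [Finite G] {x : Fin n → ℝ} (hx : x ∈ lattice G ε b) (i : Fin n) :
    ∃ k : ℤ, (Nat.card G : ℝ) * x i = k := by
  have hr : (Nat.card G : ℝ) ≠ 0 := Nat.cast_ne_zero.2 Nat.card_pos.ne'
  induction hx using AddSubgroup.closure_induction with
  | mem x hx =>
    rcases hx with ⟨j, rfl⟩ | ⟨g, -, a, ha⟩
    · by_cases h : i = j
      · subst h
        exact ⟨Nat.card G, by simp⟩
      · exact ⟨0, by simp [h]⟩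
    · refine ⟨a i, ?_⟩
      rw [(ha i).2.2]
      push_cast
      field_simp
  | zero => exact ⟨0, by simp⟩
  | add x y _ _ hx hy =>
    obtain ⟨k, hk⟩ := hx
    obtain ⟨l, hl⟩ := hy
    exact ⟨k + l, by rw [Pi.add_apply, mul_add, hk, hl]; push_cast; rfl⟩
  | neg x _ hx =>
    obtain ⟨k, hk⟩ := hx
    exact ⟨-k, by rw [Pi.neg_apply, mul_neg, hk]; push_cast; rfl⟩

theorem ageForm_mem_dualLattice [Finite G] (hε : IsPrimitiveRoot ε (Nat.card G)) :
    ageForm n ∈ dualLattice (lattice G ε b) := by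
  intro x hx
  induction hx using AddSubgroup.closure_induction with
  | mem x hx =>
    rcases hx with ⟨j, rfl⟩ | ⟨g, -, hg⟩
    · exact ⟨1, by simp [ageForm_apply, age]⟩
    · rw [ageForm_apply]
      exact hg.exists_age_eq Nat.card_pos.ne' hε
  | zero => exact ⟨0, by simp⟩
  | add x y _ _ hx hy =>
    obtain ⟨k, hk⟩ := hx
    obtain ⟨l, hl⟩ := hy
    exact ⟨k + l, by rw [map_add, hk, hl]; push_cast; rfl⟩
  | neg x _ hx =>
    obtain ⟨k, hk⟩ := hx
    exact ⟨-k, by rw [map_neg, hk]; push_cast; rfl⟩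

theorem ageForm_mem_dualMonoid_orthant {L : AddSubgroup (Fin n → ℝ)}
    (hL : ageForm n ∈ dualLattice L) : ageForm n ∈ dualMonoid L (orthant n) :=
  ⟨hL, fun u hu => by
    rw [ageForm_apply]
    exact Finset.sum_nonneg fun i _ => mem_orthant_iff.1 hu i⟩

/-- Lattice vectors of age one in the orthant belong to the Hilbert basis. -/
theorem mem_hilbertBasis_of_age_eq_one {L : AddSubgroup (Fin n → ℝ)}
    (hL : ageForm n ∈ dualLattice L) {v : Fin n → ℝ} (hvL : v ∈ L) (hv : v ∈ orthant n)
    (hage : age v = 1) : v ∈ hilbertBasis L (orthant n) := by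
  refine ⟨hvL, hv, ?_, fun x hx y hy hxσ hyσ hxy => ?_⟩
  · rintro rfl
    simp [age] at hage
  · have hw := ageForm_mem_dualMonoid_orthant hL
    have hzero : ∀ x ∈ orthant n, age x = 0 → x = 0 := fun x hx h => by
      rw [age, Finset.sum_eq_zero_iff_of_nonneg fun i _ => mem_orthant_iff.1 hx i] at h
      exact funext fun i => h i (Finset.mem_univ i)
    have h1 := cast_floor_apply hw hx hxσ
    have h2 := cast_floor_apply hw hy hyσ
    have h3 : ageForm n x + ageForm n y = 1 := by rw [← map_add, ← hxy, ageForm_apply, hage]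
    rw [← h1, ← h2] at h3
    have h4 : ⌊ageForm n x⌋₊ + ⌊ageForm n y⌋₊ = 1 := by exact_mod_cast h3
    -- The ages of the summands are natural numbers with sum `1`, so one of them is zero, and in the
    -- orthant only the zero vector has age zero.
    rcases Nat.eq_zero_or_pos ⌊ageForm n x⌋₊ with h5 | h5
    · left
      refine hzero x hxσ ?_
      rw [← ageForm_apply, ← h1, h5, Nat.cast_zero]
    · right
      refine hzero y hyσ ?_
      rw [← ageForm_apply, ← h2, show ⌊ageForm n y⌋₊ = 0 by omega, Nat.cast_zero]

end Lattice

/-! ### The star neighbourhood of a ray and its boundary divisors. -/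

section StarNeighborhood

variable {n : ℕ} {L : AddSubgroup (Fin n → ℝ)} {F : Set (PointedCone ℝ (Fin n → ℝ))}
  {v : Fin n → ℝ}

theorem starNeighborhood_subset (hF : IsFan L F) (ρ : PointedCone ℝ (Fin n → ℝ)) :
    starNeighborhood F ρ ⊆ F := by
  rintro τ ⟨η, hη, -, -, hτ⟩
  exact hF.face_mem η hη τ hτ

/-- A cone containing `ρ` lies in a full-dimensional cone, which then also contains `ρ`. So passing
to full-dimensional cones loses no point of the orbit closure of `ρ`. -/
theorem mem_starNeighborhood_of_le (hF : IsRegularFan L F)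
    (hcov : (⋃ τ ∈ F, (τ : Set (Fin n → ℝ))) = orthant n) {ρ τ : PointedCone ℝ (Fin n → ℝ)}
    (hρ : ρ ∈ F) (hτ : τ ∈ F) (h : ρ ≤ τ) : τ ∈ starNeighborhood F ρ := by
  obtain ⟨η, hη, hle, k, B, hB⟩ := exists_le_isBasisCone hF hcov hτ
  exact ⟨η, hη, hB.finrank_span_eq, hF.isFaceOf_of_le hη hρ (h.trans hle),
    hF.isFaceOf_of_le hη hτ hle⟩

theorem isStarFan_starNeighborhood (hF : IsRegularFan L F)
    (hcov : (⋃ τ ∈ F, (τ : Set (Fin n → ℝ))) = orthant n) (hv : v ∈ rayGenerators L F) :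
    IsStarFan L (starNeighborhood F (PointedCone.hull ℝ {v})) v := by
  have hsub := starNeighborhood_subset hF.toIsFan (PointedCone.hull ℝ {v})
  refine ⟨⟨⟨hF.finite.subset hsub,
    ⟨_, mem_starNeighborhood_of_le hF hcov hv.2.2.1 hv.2.2.1 le_rfl⟩,
    fun σ hσ => hF.rational σ (hsub hσ), fun σ hσ => hF.stronglyConvex σ (hsub hσ), ?_,
    fun σ hσ τ hτ => hF.inter_isFace σ (hsub hσ) τ (hsub hτ)⟩,
    fun σ hσ => hF.regular σ (hsub hσ)⟩, ?_⟩
  · rintro σ ⟨η, hη, hdim, hρ, hσ⟩ τ hτ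
    exact ⟨η, hη, hdim, hρ, hτ.trans hσ⟩
  · rintro σ ⟨η, hη, hdim, hρ, hσ⟩
    obtain ⟨k, B, hB⟩ := isBasisCone_of_finrank_eq (hF.regular η hη) hdim
    obtain ⟨i₀, hi₀⟩ := hB.exists_basis_eq hF.toIsFan hη hv (hρ.le (PointedCone.subset_hull rfl))
    exact ⟨η, ⟨η, hη, hdim, hρ, .rfl⟩, hσ.le, k, B, i₀, hB, hi₀⟩

/-- In a star chart the star rays are the basis vectors other than `v`, and the orbit closure of
`Cone(v, B i)` is the locus where the coordinates of `v` and of `B i` vanish. -/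
theorem isBoundary_starRays (hF : IsStarFan L F v) (w : Module.Dual ℝ (Fin n → ℝ)) :
    IsBoundary w (fun u : starRays L F v =>
      (Subtype.val ⁻¹' orbitClosure L F (PointedCone.hull ℝ {v, u.1}) : Set (Divisor L F v)))
      fun u => -(⌊w u.1⌋₊ : ℤ) := by
  intro k B i₀ η hη
  have hpair : ∀ i, PointedCone.hull ℝ {v, B i} = PointedCone.hull ℝ (B '' {i₀, i}) := fun i => by
    rw [Set.image_pair, hη.basis_eq]
  have hmem : ∀ i, PointedCone.hull ℝ {v, B i} ∈ F := fun i => by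
    rw [hpair]
    exact hF.face_mem η.1 η.2 _ (hη.toIsBasisCone.hull_isFaceOf _)
  have hle : ∀ i, PointedCone.hull ℝ {v, B i} ≤ η.1 := fun i => by
    rw [hpair]
    exact (hη.toIsBasisCone.hull_isFaceOf _).le
  refine ⟨fun i => ⟨B i.1, hη.basis_mem_rayGenerators hF.toIsFan η.2 i.1, ?_, hmem i.1⟩,
    fun i j h => ?_, fun i e he => ?_, ?_, fun i => rfl⟩
  · rw [← hη.basis_eq]
    exact fun h => i.2 (B.injective h)
  · exact Subtype.ext (B.injective (congrArg Subtype.val h))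
  · obtain ⟨γ, hγ⟩ := he
    have h0 := e.2
    rw [← hγ, hF.chart_mem_divisor_iff hη] at h0
    change e.1 ∈ orbitClosure L F (PointedCone.hull ℝ {v, B i.1}) ↔ hη.coordFun i.1 e.1 = 0
    rw [← hγ, hη.coordFun_chart hF, IsBasisCone.chart_mem_orbitClosure_iff hF.toIsRegularFan
      (τ := ⟨_, hmem i.1⟩) hη.toIsBasisCone (hle i.1)]
    -- On the divisor the coordinate of `v` is already zero, so only the condition on the `i`-th
    -- coordinate remains.
    simp only [hpair, basis_mem_hull_iff, Set.mem_insert_iff, Set.mem_singleton_iff,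
      forall_eq_or_imp, forall_eq, h0, true_and]
  · rintro u hu e ⟨γ, hγ⟩ he
    rw [Set.mem_preimage, ← hγ] at he
    -- If the divisor of `u` meets the chart of `η`, then `u` lies in `η`, so it is a basis vector
    -- different from `v` and is one of the rays already accounted for.
    have huη : u.1 ∈ η.1 := hF.le_of_chart_mem_orbitClosure he (PointedCone.subset_hull (by simp))
    obtain ⟨i, hi⟩ := hη.exists_basis_eq hF.toIsFan η.2 u.2.1 huη
    refine hu ⟨⟨i, ?_⟩, Subtype.ext hi⟩
    rintro rfl
    exact u.2.2.1 (hi.symm.trans hη.basis_eq)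

end StarNeighborhood

end Toric

/-! ### The main theorem. -/

open SpaceWithFunctions Toric in
theorem theorem3p5 {n : ℕ} (G : Subgroup (Matrix.SpecialLinearGroup (Fin n) ℂ)) [Finite G]
    (hcomm : ∀ g ∈ G, ∀ h ∈ G, g * h = h * g)
    (ε : ℂ) (hε : IsPrimitiveRoot ε (Nat.card G))
    -- a basis of `ℂⁿ` in which `G` is diagonal
    (b : Module.Basis (Fin n) ℂ (Fin n → ℂ))
    (hb : ∀ g ∈ G, ∀ i, ∃ c : ℂ, g.1.mulVec (b i) = c • b i)
    (N : AddSubgroup (Fin n → ℝ)) (hN : N = lattice G ε b)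
    (Ξ : Set (PointedCone ℝ (Fin n → ℝ)))
    (hΞ : IsHilbertBasisResolution N Ξ (orthant n))
    -- a junior element `g` of `G` and its fractional expression `v`
    (g : Matrix.SpecialLinearGroup (Fin n) ℂ) (hg : g ∈ G)
    (v : Fin n → ℝ) (hv : IsFractionalExpression (Nat.card G) ε b g v) (hage : age v = 1)
    (ρ : PointedCone ℝ (Fin n → ℝ)) (hρ : ρ = PointedCone.hull ℝ {v})
    (Ξg : Set (PointedCone ℝ (Fin n → ℝ))) (hΞg : Ξg = starNeighborhood Ξ ρ)
    (E : Set (ToricVariety N Ξg)) (hE : E = orbitClosure N Ξg ρ) :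
    IsFan N Ξg ∧
    -- `X_Ξg` is an open subvariety of `X_Ξ`, and it contains the divisor of the ray `ρ` in `X_Ξ`
    (∃ h : Ξg ⊆ Ξ, IsOpenImmersion (inclusion N h) ∧ inclusion N h '' E = orbitClosure N Ξ ρ) ∧
    -- `X_Ξg` is the total space of `𝒪_E(-∑ age(u) D_u)`, with zero section the inclusion of `E`
    (∃ a : starRays N Ξg v → ℤ, (∀ u, (a u : ℝ) = -age u.1) ∧
      ∃ π : ToricVariety N Ξg → E, IsTotalSpace π Subtype.val
        (fun u : starRays N Ξg v => Subtype.val ⁻¹' orbitClosure N Ξg (PointedCone.hull ℝ {v, u.1}))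
        a) ∧
    @IsStrongDeformationRetract (ToricVariety N Ξg) (classicalTopology _) E := by
  obtain ⟨⟨hfan, hcov⟩, hsmooth, hrays⟩ := hΞ
  subst hρ
  have hw : ageForm n ∈ dualLattice N := by
    rw [hN]
    exact ageForm_mem_dualLattice hε
  have hvN : v ∈ N := by
    rw [hN]
    exact AddSubgroup.subset_closure (Or.inr ⟨g, hg, hv⟩)
  have hvσ : v ∈ orthant n := by
    obtain ⟨a, ha⟩ := hv
    refine mem_orthant_iff.2 fun i => ?_
    rw [(ha i).2.2]
    positivity
  have hregular : IsRegularFan N Ξ := ⟨hfan, fun σ hσ =>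
    (hsmooth σ hσ).isRegularCone (r := Nat.card G) Nat.card_pos.ne'
      (fun i => hN ▸ single_mem_lattice i) fun x hx i => exists_card_mul_eq (hN ▸ hx) i⟩
  -- The Hilbert basis condition is what turns the junior vector into a ray generator of `Ξ`.
  have hvray : v ∈ rayGenerators N Ξ := by
    rw [hrays]
    exact mem_hilbertBasis_of_age_eq_one hw hvN hvσ hage
  have hstar : IsStarFan N Ξg v := by
    rw [hΞg]
    exact isStarFan_starNeighborhood hregular hcov hvray
  have hsub : Ξg ⊆ Ξ := by
    rw [hΞg]
    exact starNeighborhood_subset hfan _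
  have horthant : ∀ σ ∈ Ξ, σ ≤ orthant n := fun σ hσ u hu => by
    have : u ∈ (⋃ τ ∈ Ξ, (τ : Set (Fin n → ℝ))) := Set.mem_biUnion hσ hu
    rw [hcov] at this
    exact this
  have hwσ : ∀ σ ∈ Ξg, ageForm n ∈ dualMonoid N σ := fun σ hσ =>
    dualMonoid_anti N (horthant σ (hsub hσ)) (ageForm_mem_dualMonoid_orthant hw)
  have hfinite : Finite (starRays N Ξg v) :=
    ((finite_rayGenerators hstar.finite).subset fun u hu => hu.1).to_subtype
  subst hE
  refine ⟨hstar.toIsFan, ⟨hsub, (hstar.isOpenEmb_inclusion hregular hsub).isOpenImmersion,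
    inclusion_image_orbitClosure hstar.toIsRegularFan hregular hsub hstar.ray_mem fun σ hσ hle => ?_⟩,
    ⟨fun u => -(⌊ageForm n u.1⌋₊ : ℤ), fun u => ?_, hstar.proj,
      IsBoundary.isTotalSpace hstar (isBoundary_starRays hstar (ageForm n)) hwσ ?_⟩,
    hstar.isStrongDeformationRetract⟩
  · rw [hΞg]
    exact mem_starNeighborhood_of_le hregular hcov hvray.2.2.1 hσ hle
  · have := cast_floor_apply (hwσ _ u.2.1.2.2.1) u.2.1.1 (PointedCone.subset_hull rfl)
    push_cast
    rw [this, ageForm_apply]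
  · rw [ageForm_apply, hage]
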